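/- Let $M$ be a smooth real supermanifold of dimension $p|q$ (Hausdorff and second countable), and let $\{\,\cdot,\cdot\,\}$ be an odd Poisson (Schouten) structure on $M$: an odd bracket on the structure sheaf, antisymmetric and satisfying the Jacobi identity with respect to shifted parity, and a derivation in each argument. For a function $f$ of parity $\tilde f$ let $X_f=(-1)^{\tilde f+1}\{f,\cdot\,\}$ be its Hamiltonian vector field, of parity $\tilde f+1$. For $w\in\mathbb R$, a density of weight $w$ is given in each chart by $s\,|Dx|^w$, where the coefficients in two charts are related by $|Dx'|^w=|\mathrm{Ber}(\partial x'/\partial x)|^w\,|Dx|^w$; volume forms are the densities of weight $1$. The Lie derivative along a vector field $X=X^a\partial_a$ of parity $\tilde X$ is $$\mathcal L_X(s|Dx|^w)=\Bigl(Xs+w\sum_a(-1)^{\tilde a(\tilde X+1)}\frac{\partial X^a}{\partial x^a}\,s\Bigr)|Dx|^w ,$$ and $\mathcal L_f:=\mathcal L_{X_f}$. Let $[\ ,\ ]$ denote the supercommutator; functions act on densities by multiplication. 1. If the bracket of functions on $M$ is not identically zero, then for $w\in\mathbb R$ a linear differential operator $\Delta$ on densities of weight $w$ that satisfies $[\Delta,f]=2\mathcal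 L_f$ for all functions $f$ exists if and only if $w=\tfrac12$. 2. For $w=\tfrac12$ (and an arbitrary odd Poisson structure) such an operator exists, and it can be chosen odd. It is unique up to a zeroth-order term: if $\Delta$ is such an operator, then the operators with this property are exactly the operators $\Delta+C$ with $C$ a function. 3. Let $\rho$ be a basis volume form, i.e. an even volume form whose coefficient in each chart is invertible, let $|\rho|^{1/2}$ be the half-density whose coefficient in each chart is $|r|^{1/2}$ if that of $\rho$ is $r$, and let $\Delta_\rho$ be the Laplace operator on functions, $\Delta_\rho f=(\mathcal L_f\rho)/\rho$. Then every half-density is $s|\rho|^{1/2}$ for a unique function $s$, and the linear operators $\Delta$ with the property above (for $w=\tfrac12$) are exactly those of the form $$\Delta\bigl(s|\rho|^{1/2}\bigr)=(\Delta_\rho s)\,|\rho|^{1/2}+C\,s\,|\rho|^{1/2}$$ with $C$ a function. -/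

import Mathlib

open TopologicalSpace CategoryTheory Opposite
open scoped ContDiff

universe u

/-- The Grassmann algebra `Λ_q` on `q` odd generators, over the reals. -/
abbrev Grassmann (q : ℕ) : Type := ExteriorAlgebra ℝ (Fin q → ℝ)

namespace Grassmann

noncomputable section

/-- The coefficients of an element of `Λ_q` in the monomial basis. -/
def coeff (q : ℕ) : Grassmann q ≃ₗ[ℝ] (Finset (Fin q) → ℝ) :=
  (Pi.basisFun ℝ (Fin q)).ExteriorAlgebra.equivFun

/-- A norm on the finite-dimensional space `Λ_q` (the largest absolute value of a coefficient).
It only serves to speak of smooth maps with values in `Λ_q`. -/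
instance (q : ℕ) : NormedAddCommGroup (Grassmann q) :=
  NormedAddCommGroup.induced _ _ (coeff q).toLinearMap (coeff q).injective

instance (q : ℕ) : NormedSpace ℝ (Grassmann q) :=
  NormedSpace.induced ℝ (Grassmann q) _ (coeff q).toLinearMap

instance (q : ℕ) : FiniteDimensional ℝ (Grassmann q) :=
  (coeff q).symm.finiteDimensional

/-- The parity automorphism: `+1` on even elements, `-1` on odd elements. -/
def parity (q : ℕ) : Grassmann q →ₐ[ℝ] Grassmann q := CliffordAlgebra.involute

/-- The subalgebra of even elements. -/
def even (q : ℕ) : Subalgebra ℝ (Grassmann q) := CliffordAlgebra.even 0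

theorem even_commute {q : ℕ} (a : Grassmann q) (ha : a ∈ even q) (b : Grassmann q) :
    Commute a b := by
  have ha' : a ∈ CliffordAlgebra.evenOdd (0 : QuadraticForm ℝ (Fin q → ℝ)) 0 := ha
  clear ha
  induction a, ha' using CliffordAlgebra.even_induction with
  | algebraMap r => exact Algebra.commutes r b
  | add x y hx hy ihx ihy => exact ihx.add_left ihy
  | ι_mul_ι_mul v w x hx ih =>
    refine Commute.mul_left ?_ ih
    clear ih
    induction b using ExteriorAlgebra.induction with
    | algebraMap r => exact (Algebra.commutes r _).symm
    | ι z =>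
      have h (x y : Fin q → ℝ) : ExteriorAlgebra.ι ℝ x * ExteriorAlgebra.ι ℝ y =
          - (ExteriorAlgebra.ι ℝ y * ExteriorAlgebra.ι ℝ x) :=
        eq_neg_of_add_eq_zero_left (ExteriorAlgebra.ι_add_mul_swap x y)
      change ExteriorAlgebra.ι ℝ v * ExteriorAlgebra.ι ℝ w * ExteriorAlgebra.ι ℝ z =
        ExteriorAlgebra.ι ℝ z * (ExteriorAlgebra.ι ℝ v * ExteriorAlgebra.ι ℝ w)
      rw [mul_assoc, h w z, mul_neg, ← mul_assoc, h v z, neg_mul, neg_neg, mul_assoc]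
    | mul x y hx hy => exact hx.mul_right hy
    | add x y hx hy => exact hx.add_right hy

instance (q : ℕ) : CommRing (even q) :=
  { (inferInstance : Ring (even q)) with
    mul_comm := fun a b => Subtype.ext (even_commute a.1 a.2 b.1) }

/-- The projection of `Λ_q` onto its even part. -/
def evenPart {q : ℕ} (a : Grassmann q) : even q :=
  ⟨(DirectSum.decompose (CliffordAlgebra.evenOdd (0 : QuadraticForm ℝ (Fin q → ℝ))) a 0 :
      CliffordAlgebra (0 : QuadraticForm ℝ (Fin q → ℝ))), SetLike.coe_mem _⟩

/-- The body (degree-zero coefficient) of an even element. -/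
def body {q : ℕ} (a : even q) : ℝ := ExteriorAlgebra.algebraMapInv (a : Grassmann q)

/-- The real power `|a|^w` of an even element `a` with nonzero body `a₀`: with `a = a₀ + n`,
`n` nilpotent, it is the (finite) binomial series
`|a₀|^w (1 + n/a₀)^w = ∑ₖ (w choose k) |a₀|^w a₀⁻ᵏ nᵏ`. -/
def absRpow {q : ℕ} (w : ℝ) (a : even q) : even q :=
  ∑ k ∈ Finset.range (q + 1),
    (Ring.choose w k * |body a| ^ w * ((body a)⁻¹) ^ k) •
      (a - algebraMap ℝ (even q) (body a)) ^ k

/-- The Berezinian `det (A - B D⁻¹ C) · (det D)⁻¹` of an even square supermatrix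
`((A, B), (C, D))` with entries in `Λ_q`: the entries of `A` and `D` are even, those of `B` and `C`
are odd, so that the entries of `A - B D⁻¹ C` are even. -/
def berezinian {m n q : ℕ} (J : Matrix (Fin m ⊕ Fin n) (Fin m ⊕ Fin n) (Grassmann q)) : even q :=
  let D : Matrix (Fin n) (Fin n) (even q) := J.toBlocks₂₂.map evenPart
  let S : Matrix (Fin m) (Fin m) (even q) :=
    (J.toBlocks₁₁ - J.toBlocks₁₂ * D⁻¹.map Subtype.val * J.toBlocks₂₁).map evenPart
  S.det * Ring.inverse D.det

end

end Grassmann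

/-! ### Superdomains -/

/-- The sign `(-1)^ε` of a parity `ε ∈ ℤ/2`. -/
def paritySign (ε : ZMod 2) : ℝ := if ε = 0 then 1 else -1

/-- The parity of a coordinate: the first `p` coordinates are even, the last `q` are odd. -/
def indexParity {p q : ℕ} : Fin p ⊕ Fin q → ZMod 2 := Sum.elim (fun _ => 0) (fun _ => 1)

noncomputable section

/-- Extension by zero of a function on an open set. -/
def extendZero {p q : ℕ} {V : Opens (EuclideanSpace ℝ (Fin p))} (f : V → Grassmann q) :
    EuclideanSpace ℝ (Fin p) → Grassmann q :=
  open Classical in fun x => if h : x ∈ V then f ⟨x, h⟩ else 0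

theorem extendZero_apply {p q : ℕ} {V : Opens (EuclideanSpace ℝ (Fin p))} (f : V → Grassmann q)
    {x : EuclideanSpace ℝ (Fin p)} (h : x ∈ V) : extendZero f x = f ⟨x, h⟩ := by
  simp [extendZero, h]

theorem contDiffOn_linear_comp {p q : ℕ} {V : Opens (EuclideanSpace ℝ (Fin p))}
    (L : Grassmann q →ₗ[ℝ] Grassmann q) {f : V → Grassmann q}
    (hf : ContDiffOn ℝ ∞ (extendZero f) V) :
    ContDiffOn ℝ ∞ (extendZero (fun x => L (f x))) V := by
  refine ((LinearMap.toContinuousLinearMap L).contDiff.comp_contDiffOn hf).congr ?_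
  intro x hx
  simp [extendZero_apply _ hx]

/-- The algebra `C^∞(V) ⊗ Λ_q` of superfunctions on the superdomain of dimension `p|q` over an open
set `V ⊆ ℝ^p`, realised as the algebra of smooth maps `V → Λ_q`. -/
def superFun {p : ℕ} (q : ℕ) (V : Opens (EuclideanSpace ℝ (Fin p))) :
    Subalgebra ℝ (V → Grassmann q) where
  carrier := {f | ContDiffOn ℝ ∞ (extendZero f) V}
  mul_mem' {f g} hf hg := by
    let B : Grassmann q →L[ℝ] Grassmann q →L[ℝ] Grassmann q :=
      LinearMap.toContinuousLinearMap
        ((LinearMap.toContinuousLinearMap (𝕜 := ℝ) (E := Grassmann q) (F' := Grassmann q)).toLinearMap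
          ∘ₗ LinearMap.mul ℝ (Grassmann q))
    have h : ContDiffOn ℝ ∞ (fun x => B (extendZero f x) (extendZero g x)) V :=
      B.isBoundedBilinearMap.contDiff.comp_contDiffOn (ContDiffOn.prodMk hf hg)
    refine h.congr ?_
    intro x hx
    simp [extendZero_apply _ hx, B]
  add_mem' {f g} hf hg := by
    refine (ContDiffOn.add hf hg).congr ?_
    intro x hx
    simp [extendZero_apply _ hx]
  algebraMap_mem' r := by
    refine (contDiffOn_const (c := algebraMap ℝ (Grassmann q) r)).congr ?_
    intro x hx
    simp [extendZero_apply _ hx]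

namespace superFun

variable {p q : ℕ}

/-- Restriction of superfunctions to a smaller open set. -/
def res {V W : Opens (EuclideanSpace ℝ (Fin p))} (h : V ≤ W) (f : superFun q W) : superFun q V :=
  ⟨fun x => f.1 ⟨x.1, h x.2⟩, by
    have hf : ContDiffOn ℝ ∞ (extendZero f.1) W := f.2
    refine (hf.mono h).congr ?_
    intro x hx
    rw [extendZero_apply _ hx, extendZero_apply _ (h hx)]⟩

/-- The parity automorphism of the algebra of superfunctions. -/
def parity {V : Opens (EuclideanSpace ℝ (Fin p))} (f : superFun q V) : superFun q V :=
  ⟨fun x => Grassmann.parity q (f.1 x), contDiffOn_linear_comp (Grassmann.parity q).toLinearMap f.2⟩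

/-- The coordinate functions: `p` even coordinates `x^i` and `q` odd coordinates `θ^j`. -/
def coord (V : Opens (EuclideanSpace ℝ (Fin p))) (a : Fin p ⊕ Fin q) : superFun q V :=
  match a with
  | .inl i => ⟨fun x => algebraMap ℝ (Grassmann q) (x.1 i), by
      let L : EuclideanSpace ℝ (Fin p) →L[ℝ] Grassmann q := LinearMap.toContinuousLinearMap
        ((Algebra.linearMap ℝ (Grassmann q)) ∘ₗ (EuclideanSpace.proj (𝕜 := ℝ) i).toLinearMap)
      refine (L.contDiff.contDiffOn (s := (V : Set (EuclideanSpace ℝ (Fin p))))).congr ?_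
      intro x hx
      simp [extendZero_apply _ hx, L]⟩
  | .inr j => ⟨fun _ => ExteriorAlgebra.ι ℝ (Pi.single j 1), by
      refine (contDiffOn_const (c := ExteriorAlgebra.ι ℝ (Pi.single j (1 : ℝ)))).congr ?_
      intro x hx
      simp [extendZero_apply _ hx]⟩

/-- The (left) partial derivatives: `∂/∂x^i` differentiates the coefficients, and `∂/∂θ^j` is the
left contraction with the `j`-th coordinate functional, i.e. the odd derivation with
`∂θ^k/∂θ^j = δ_j^k`. -/
def pderiv {V : Opens (EuclideanSpace ℝ (Fin p))} (a : Fin p ⊕ Fin q) :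
    superFun q V →ₗ[ℝ] superFun q V :=
  match a with
  | .inl i =>
    { toFun := fun f => ⟨fun x => fderiv ℝ (extendZero f.1) x.1 (EuclideanSpace.single i 1), by
        have hf : ContDiffOn ℝ ∞ (extendZero f.1) V := f.2
        have h := (hf.fderiv_of_isOpen V.isOpen (m := ∞) (by simp)).clm_apply
          (contDiffOn_const (c := EuclideanSpace.single i (1 : ℝ)))
        refine h.congr ?_
        intro x hx
        simp [extendZero_apply _ hx]⟩
      map_add' := fun f g => by
        apply Subtype.ext
        funext x
        have hf : ContDiffOn ℝ ∞ (extendZero f.1) V := f.2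
        have hg : ContDiffOn ℝ ∞ (extendZero g.1) V := g.2
        have hfx := (hf.contDiffAt (V.isOpen.mem_nhds x.2)).differentiableAt (by simp)
        have hgx := (hg.contDiffAt (V.isOpen.mem_nhds x.2)).differentiableAt (by simp)
        have e : extendZero (f + g).1 = extendZero f.1 + extendZero g.1 := by
          funext y
          by_cases hy : y ∈ V <;> simp [extendZero, hy]
        change fderiv ℝ (extendZero (f + g).1) x.1 _ = _
        rw [e, fderiv_add hfx hgx]
        rfl
      map_smul' := fun r f => by
        apply Subtype.ext
        funext x
        have hf : ContDiffOn ℝ ∞ (extendZero f.1) V := f.2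
        have hfx := (hf.contDiffAt (V.isOpen.mem_nhds x.2)).differentiableAt (by simp)
        have e : extendZero (r • f).1 = r • extendZero f.1 := by
          funext y
          by_cases hy : y ∈ V <;> simp [extendZero, hy]
        change fderiv ℝ (extendZero (r • f).1) x.1 _ = _
        rw [e, fderiv_const_smul hfx]
        rfl }
  | .inr j =>
    { toFun := fun f => ⟨fun x => CliffordAlgebra.contractLeft
          (Q := (0 : QuadraticForm ℝ (Fin q → ℝ))) (LinearMap.proj j) (f.1 x),
        contDiffOn_linear_comp (CliffordAlgebra.contractLeft
          (Q := (0 : QuadraticForm ℝ (Fin q → ℝ))) (LinearMap.proj j)) f.2⟩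
      map_add' := fun f g => by
        apply Subtype.ext
        funext x
        exact map_add _ _ _
      map_smul' := fun r f => by
        apply Subtype.ext
        funext x
        exact map_smul (CliffordAlgebra.contractLeft
          (Q := (0 : QuadraticForm ℝ (Fin q → ℝ))) (LinearMap.proj j)) r (f.1 x) }

end superFun

/-! ### Supermanifolds -/

/-- A topological space with a sheaf of real `ℤ/2`-graded algebras; the grading is given by
the parity automorphism, an involution equal to `+1` on even and `-1` on odd sections. -/
structure SuperringedSpace where
  body : TopCat.{u}
  sheaf : TopCat.Sheaf (AlgCat.{u} ℝ) body
  parityHom : sheaf ⟶ sheaf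
  parityHom_comp : parityHom ≫ parityHom = 𝟙 sheaf

namespace SuperringedSpace

variable (X : SuperringedSpace.{u})

/-- The algebra of sections over an open set. -/
abbrev Sec (U : Opens X.body) : Type u := X.sheaf.presheaf.obj (op U)

/-- Restriction of sections. -/
def res {U V : Opens X.body} (h : U ≤ V) : X.Sec V →ₐ[ℝ] X.Sec U :=
  (X.sheaf.presheaf.map (homOfLE h).op).hom

/-- The parity automorphism of the algebra of sections. -/
def parity (U : Opens X.body) : X.Sec U →ₐ[ℝ] X.Sec U := (X.parityHom.1.app (op U)).hom

variable {X}

theorem res_res {U V W : Opens X.body} (h : U ≤ V) (h' : V ≤ W) (f : X.Sec W) :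
    X.res h (X.res h' f) = X.res (h.trans h') f := by
  have e : (homOfLE (h.trans h')).op = (homOfLE h').op ≫ (homOfLE h).op := rfl
  simp only [res, e, Functor.map_comp]
  rfl

theorem res_parity {U V : Opens X.body} (h : U ≤ V) (f : X.Sec V) :
    X.res h (X.parity V f) = X.parity U (X.res h f) := by
  have e := X.parityHom.1.naturality (homOfLE h).op
  exact (congrArg (fun k => AlgCat.Hom.hom k f) e).symm

/-- `f` is homogeneous of parity `ε`. -/
def IsHomog {U : Opens X.body} (ε : ZMod 2) (f : X.Sec U) : Prop :=
  X.parity U f = paritySign ε • f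

theorem IsHomog.res {U V : Opens X.body} {ε : ZMod 2} {f : X.Sec V} (hf : IsHomog ε f)
    (h : U ≤ V) : IsHomog ε (X.res h f) := by
  have hf' : X.parity V f = paritySign ε • f := hf
  change X.parity U (X.res h f) = _
  rw [← res_parity, hf', map_smul]

end SuperringedSpace

/-- The image of `W` under a local homeomorphism, as an open subset of `ℝ^p`. -/
def chartImage {p : ℕ} {B : TopCat.{u}} (φ : OpenPartialHomeomorph B (EuclideanSpace ℝ (Fin p)))
    (W : Opens B) : Opens (EuclideanSpace ℝ (Fin p)) :=
  ⟨φ.target ∩ φ.symm ⁻¹' W, φ.symm.isOpen_inter_preimage W.isOpen⟩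

theorem chartImage_mono {p : ℕ} {B : TopCat.{u}}
    (φ : OpenPartialHomeomorph B (EuclideanSpace ℝ (Fin p))) {W W' : Opens B} (h : W ≤ W') :
    chartImage φ W ≤ chartImage φ W' :=
  fun _ hx => ⟨hx.1, h hx.2⟩

/-- A chart (local coordinate system) of dimension `p|q`: a homeomorphism `φ` of an open subset of
the body onto an open subset of `ℝ^p`, and an isomorphism, over `φ`, of the structure sheaf with
the sheaf of superfunctions (commuting with restrictions and with parity). -/
structure SuperChart (X : SuperringedSpace.{u}) (p q : ℕ) where
  φ : OpenPartialHomeomorph X.body (EuclideanSpace ℝ (Fin p))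
  iso : ∀ W : Opens X.body, (W : Set X.body) ⊆ φ.source → (X.Sec W ≃ₐ[ℝ] superFun q (chartImage φ W))
  iso_res : ∀ (W W' : Opens X.body) (h : W ≤ W') (hW : (W : Set X.body) ⊆ φ.source)
    (hW' : (W' : Set X.body) ⊆ φ.source) (f : X.Sec W'),
    iso W hW (X.res h f) = superFun.res (chartImage_mono φ h) (iso W' hW' f)
  iso_parity : ∀ (W : Opens X.body) (hW : (W : Set X.body) ⊆ φ.source) (f : X.Sec W),
    iso W hW (X.parity W f) = superFun.parity (iso W hW f)

/-- A smooth supermanifold of dimension `p|q`: a Hausdorff second countable space with a sheaf of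
superalgebras that is locally isomorphic to `(ℝ^p, C^∞ ⊗ Λ_q)`. -/
structure Supermanifold (p q : ℕ) extends SuperringedSpace.{u} where
  t2 : T2Space body
  secondCountable : SecondCountableTopology body
  exists_chart : ∀ x : body, ∃ c : SuperChart toSuperringedSpace p q, x ∈ c.φ.source

namespace SuperChart

variable {X : SuperringedSpace.{u}} {p q : ℕ}

/-- The domain of a chart. -/
def source (c : SuperChart X p q) : Opens X.body := ⟨c.φ.source, c.φ.open_source⟩

/-- The isomorphism of a chart on its whole domain. -/
def isoSource (c : SuperChart X p q) : X.Sec c.source ≃ₐ[ℝ] superFun q (chartImage c.φ c.source) :=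
  c.iso c.source subset_rfl

/-- The coordinates `x^a` of a chart. -/
def coord (c : SuperChart X p q) (a : Fin p ⊕ Fin q) : X.Sec c.source :=
  c.isoSource.symm (superFun.coord _ a)

/-- The partial derivatives `∂/∂x^a` of a chart. -/
def pderiv (c : SuperChart X p q) (a : Fin p ⊕ Fin q) : X.Sec c.source →ₗ[ℝ] X.Sec c.source :=
  c.isoSource.symm.toLinearMap ∘ₗ superFun.pderiv a ∘ₗ c.isoSource.toLinearMap

theorem overlap_subset (c c' : SuperChart X p q) :
    ((c.source ⊓ c'.source : Opens X.body) : Set X.body) ⊆ c.φ.source := fun _ hx => hx.1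

/-- A function on the domain of `c`, restricted to the overlap of `c` and `c'` and expressed in the
coordinates of `c`. -/
def onOverlapSelf (c c' : SuperChart X p q) (f : X.Sec c.source) :
    superFun q (chartImage c.φ (c.source ⊓ c'.source)) :=
  c.iso (c.source ⊓ c'.source) (c.overlap_subset c') (X.res inf_le_left f)

/-- A function on the domain of `c'`, restricted to the overlap of `c` and `c'` and expressed in the
coordinates of `c`. -/
def onOverlap (c c' : SuperChart X p q) (f : X.Sec c'.source) :
    superFun q (chartImage c.φ (c.source ⊓ c'.source)) :=
  c.iso (c.source ⊓ c'.source) (c.overlap_subset c') (X.res inf_le_right f)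

/-- The Jacobi matrix of the change of coordinates from `c` to `c'`, on the overlap, in the
coordinates of `c`: its entry in row `a` and column `b` is `∂x'^b/∂x^a`. -/
def jacobian (c c' : SuperChart X p q) (z : chartImage c.φ (c.source ⊓ c'.source)) :
    Matrix (Fin p ⊕ Fin q) (Fin p ⊕ Fin q) (Grassmann q) :=
  fun a b => (superFun.pderiv a (c.onOverlap c' (c'.coord b))).1 z

end SuperChart

namespace Supermanifold

variable {p q : ℕ} (M : Supermanifold.{u} p q)

/-- The charts of a supermanifold. -/
abbrev Chart : Type u := SuperChart M.toSuperringedSpace p q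

/-- The algebra `C^∞(M)` of functions on `M`. -/
abbrev Fn : Type u := M.Sec ⊤

/-- Densities of weight `w`. In each chart such a density is `s_c |Dx_c|^w` with a function `s_c` on
the domain of `c`; as `Dx' = Ber(∂x'/∂x) Dx`, the coefficients in two charts are related by
`s_c = s_{c'} |Ber(∂x_{c'}/∂x_c)|^w` on the overlap. -/
def density (w : ℝ) : Submodule ℝ (∀ c : M.Chart, M.Sec c.source) where
  carrier := {s | ∀ (c c' : M.Chart) (z : chartImage c.φ (c.source ⊓ c'.source)),
    (c.onOverlapSelf c' (s c)).1 z =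
      (c.onOverlap c' (s c')).1 z * (Grassmann.absRpow w (Grassmann.berezinian (c.jacobian c' z)))}
  add_mem' {s t} hs ht c c' z := by
    have h1 := hs c c' z
    have h2 := ht c c' z
    simp only [SuperChart.onOverlapSelf, SuperChart.onOverlap] at h1 h2 ⊢
    simp only [Pi.add_apply, map_add, Subalgebra.coe_add, h1, h2, add_mul]
  zero_mem' c c' z := by
    simp [SuperChart.onOverlapSelf, SuperChart.onOverlap]
  smul_mem' r s hs c c' z := by
    have h1 := hs c c' z
    simp only [SuperChart.onOverlapSelf, SuperChart.onOverlap] at h1 ⊢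
    simp only [Pi.smul_apply, map_smul, Subalgebra.coe_smul, h1, smul_mul_assoc]

/-- The space of densities of weight `w`. -/
abbrev Density (w : ℝ) : Type u := M.density w

variable {M}

/-- Densities of weight `w` form a (left) module over the functions. -/
instance (w : ℝ) : Module M.Fn (M.Density w) where
  smul f s := ⟨fun c => M.res le_top f * s.1 c, fun c c' z => by
    have h1 := s.2 c c' z
    simp only [SuperChart.onOverlapSelf, SuperChart.onOverlap] at h1 ⊢
    simp only [map_mul, SuperringedSpace.res_res, Subalgebra.coe_mul, Pi.mul_apply, h1, mul_assoc]⟩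
  one_smul s := Subtype.ext (funext fun c => by
    change M.res le_top 1 * s.1 c = s.1 c
    rw [map_one, one_mul])
  mul_smul f g s := Subtype.ext (funext fun c => by
    change M.res le_top (f * g) * s.1 c = M.res le_top f * (M.res le_top g * s.1 c)
    rw [map_mul, mul_assoc])
  smul_zero f := Subtype.ext (funext fun c => mul_zero _)
  smul_add f s t := Subtype.ext (funext fun c => mul_add _ _ _)
  add_smul f g s := Subtype.ext (funext fun c => by
    change M.res le_top (f + g) * s.1 c = M.res le_top f * s.1 c + M.res le_top g * s.1 c
    rw [map_add, add_mul])
  zero_smul s := Subtype.ext (funext fun c => by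
    change M.res le_top 0 * s.1 c = 0
    rw [map_zero, zero_mul])

namespace Density

variable {w : ℝ}

/-- The parity automorphism on densities, `s |Dx|^w ↦ (parity of s) |Dx|^w`. -/
def parity : M.Density w →ₗ[ℝ] M.Density w where
  toFun s := ⟨fun c => M.parity _ (s.1 c), fun c c' z => by
    have h1 := s.2 c c' z
    have he : ∀ e : Grassmann.even q, Grassmann.parity q (e : Grassmann q) = e :=
      fun e => CliffordAlgebra.involute_eq_of_mem_even e.2
    simp only [SuperChart.onOverlapSelf, SuperChart.onOverlap] at h1 ⊢
    rw [SuperringedSpace.res_parity, SuperringedSpace.res_parity, c.iso_parity, c.iso_parity]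
    simp only [superFun.parity, h1, map_mul, he]⟩
  map_add' s t := Subtype.ext (funext fun c => map_add _ _ _)
  map_smul' r s := Subtype.ext (funext fun c => map_smul _ _ _)

/-- Multiplication of densities by a function. -/
def mulFn (f : M.Fn) : M.Density w →ₗ[ℝ] M.Density w where
  toFun s := f • s
  map_add' s t := smul_add f s t
  map_smul' r s := Subtype.ext (funext fun c => by
    change M.res le_top f * (r • s.1 c) = r • (M.res le_top f * s.1 c)
    rw [mul_smul_comm])

end Density

/-- A (real-)linear operator on densities of weight `w`. -/
abbrev Operator (M : Supermanifold.{u} p q) (w : ℝ) : Type u := M.Density w →ₗ[ℝ] M.Density w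

namespace Operator

variable {w : ℝ}

/-- `Δ` is odd: it exchanges even and odd densities. -/
def IsOdd (Δ : M.Operator w) : Prop := ∀ s, Δ (Density.parity s) = - Density.parity (Δ s)

/-- The supercommutator `[Δ, f]` of an operator with the multiplication by a function `f` of parity
`ε`. For `Δ` of parity `δ` it is `Δ ∘ f - (-1)^{δ ε} f ∘ Δ`; as conjugation with the parity
automorphism multiplies `Δ` by `(-1)^δ`, the formula below is the additive extension of this to
operators that are not necessarily homogeneous. -/
def superComm (Δ : M.Operator w) (ε : ZMod 2) (f : M.Fn) : M.Operator w :=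
  Δ ∘ₗ Density.mulFn f -
    Density.mulFn f ∘ₗ (if ε = 0 then Δ else Density.parity ∘ₗ Δ ∘ₗ Density.parity)

/-- Differential operators of order at most `n`: those of order at most `0` commute with functions,
and `Δ` has order at most `n + 1` if all `[Δ, f]` have order at most `n`. -/
def HasOrderLE : ℕ → M.Operator w → Prop
  | 0, Δ => ∀ (ε : ZMod 2) (f : M.Fn), SuperringedSpace.IsHomog ε f → superComm Δ ε f = 0
  | n + 1, Δ => ∀ (ε : ZMod 2) (f : M.Fn), SuperringedSpace.IsHomog ε f →
      HasOrderLE n (superComm Δ ε f)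

/-- Linear differential operators. -/
def IsDifferential (Δ : M.Operator w) : Prop := ∃ n, HasOrderLE n Δ

end Operator

variable (M) in
/-- A vector field of parity `ε`: a derivation of parity `ε` of the structure sheaf. -/
structure VectorField (ε : ZMod 2) where
  app : ∀ U : Opens M.body, M.Sec U →ₗ[ℝ] M.Sec U
  app_res : ∀ {U V : Opens M.body} (h : U ≤ V) (g : M.Sec V),
    app U (M.res h g) = M.res h (app V g)
  app_parity : ∀ (U : Opens M.body) (g : M.Sec U),
    M.parity U (app U g) = paritySign ε • app U (M.parity U g)
  app_mul : ∀ (U : Opens M.body) (δ : ZMod 2) (g h : M.Sec U), SuperringedSpace.IsHomog δ g →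
    app U (g * h) = app U g * h + paritySign (ε * δ) • (g * app U h)

namespace VectorField

variable {ε : ZMod 2}

/-- The coordinate divergence `∑ₐ (-1)^{a (ε + 1)} ∂X^a/∂x^a` of a vector field `X = X^a ∂/∂x^a` of
parity `ε` in a chart. -/
def coordDiv (X : M.VectorField ε) (c : M.Chart) : M.Sec c.source :=
  ∑ a, paritySign (indexParity a * (ε + 1)) • c.pderiv a (X.app c.source (c.coord a))

/-- `t` is the Lie derivative `L_X s` of the density `s` of weight `w`. In coordinates,
`L_X (s |Dx|^w) = (X s + w (div X) s) |Dx|^w`. -/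
def IsLieDeriv {w : ℝ} (X : M.VectorField ε) (s t : M.Density w) : Prop :=
  ∀ c : M.Chart, t.1 c = X.app c.source (s.1 c) + w • (X.coordDiv c * s.1 c)

end VectorField

/-! ### Odd Poisson structures -/

variable (M) in
/-- An odd Poisson (Schouten) structure: an odd bracket on the structure sheaf that is antisymmetric
(with respect to shifted parity), a derivation in each argument, and satisfies the Jacobi
identity. -/
structure OddPoisson where
  bracket : ∀ U : Opens M.body, M.Sec U →ₗ[ℝ] M.Sec U →ₗ[ℝ] M.Sec U
  bracket_res : ∀ {U V : Opens M.body} (h : U ≤ V) (f g : M.Sec V),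
    bracket U (M.res h f) (M.res h g) = M.res h (bracket V f g)
  bracket_parity : ∀ (U : Opens M.body) (f g : M.Sec U),
    M.parity U (bracket U f g) = - bracket U (M.parity U f) (M.parity U g)
  antisymm : ∀ (U : Opens M.body) (ε δ : ZMod 2) (f g : M.Sec U),
    SuperringedSpace.IsHomog ε f → SuperringedSpace.IsHomog δ g →
    bracket U f g = - paritySign ((ε + 1) * (δ + 1)) • bracket U g f
  leibniz : ∀ (U : Opens M.body) (ε δ : ZMod 2) (f g h : M.Sec U),
    SuperringedSpace.IsHomog ε f → SuperringedSpace.IsHomog δ g →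
    bracket U f (g * h) = bracket U f g * h + paritySign ((ε + 1) * δ) • (g * bracket U f h)
  jacobi : ∀ (U : Opens M.body) (ε δ : ZMod 2) (f g h : M.Sec U),
    SuperringedSpace.IsHomog ε f → SuperringedSpace.IsHomog δ g →
    bracket U f (bracket U g h) = bracket U (bracket U f g) h +
      paritySign ((ε + 1) * (δ + 1)) • bracket U g (bracket U f h)

theorem neg_paritySign (ε : ZMod 2) :
    - paritySign ε = paritySign (ε + 1) := by
  fin_cases ε
  · have h : ((0 : ZMod 2) + 1) ≠ 0 := by decide
    change - paritySign 0 = paritySign (0 + 1)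
    simp [paritySign]
  · have h : ((1 : ZMod 2) + 1) = 0 := by decide
    change - paritySign 1 = paritySign (1 + 1)
    simp [paritySign, h]

namespace OddPoisson

variable (P : M.OddPoisson)

/-- The Hamiltonian vector field `X_f = (-1)^{ε + 1} {f, ·}` of a function `f` of parity `ε`. -/
def hamiltonian {ε : ZMod 2} (f : M.Fn) (hf : SuperringedSpace.IsHomog ε f) :
    M.VectorField (ε + 1) where
  app U := paritySign (ε + 1) • P.bracket U (M.res le_top f)
  app_res {U V} h g := by
    simp only [LinearMap.smul_apply, map_smul, ← P.bracket_res, SuperringedSpace.res_res]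
  app_parity U g := by
    have h : M.parity U (M.res le_top f) = paritySign ε • M.res le_top f := hf.res le_top
    have h' := P.bracket_parity U (M.res le_top f) g
    rw [h, map_smul, LinearMap.smul_apply] at h'
    change M.parity U (paritySign (ε + 1) • P.bracket U (M.res le_top f) g) =
      paritySign (ε + 1) • paritySign (ε + 1) • P.bracket U (M.res le_top f) (M.parity U g)
    rw [map_smul, h', ← neg_smul, neg_paritySign]
  app_mul U δ g h hg := by
    simp only [LinearMap.smul_apply, P.leibniz U ε δ _ g h (hf.res le_top) hg, smul_add,
      smul_mul_assoc, mul_smul_comm]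
    rw [smul_comm]

/-- `[Δ, f] = 2 L_{X_f}` for all (homogeneous) functions `f`. -/
def CommutatorIdentity {w : ℝ} (Δ : M.Operator w) : Prop :=
  ∀ (ε : ZMod 2) (f : M.Fn) (hf : SuperringedSpace.IsHomog ε f) (s : M.Density w),
    ∃ t : M.Density w, (P.hamiltonian f hf).IsLieDeriv s t ∧ Operator.superComm Δ ε f s = (2 : ℝ) • t

/-- `g = Δ_ρ f`, where `Δ_ρ f = div_ρ X_f = (L_{X_f} ρ)/ρ` is the Laplace operator on functions that
is defined by the volume form `ρ`. -/
def IsLaplacian (ρ : M.Density 1) {ε : ZMod 2} (f : M.Fn) (hf : SuperringedSpace.IsHomog ε f)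
    (g : M.Fn) : Prop :=
  (P.hamiltonian f hf).IsLieDeriv ρ (g • ρ)

/-- The bracket of functions does not vanish identically. -/
def IsNonzero : Prop := ∃ f g : M.Fn, P.bracket ⊤ f g ≠ 0

end OddPoisson

/-- A basis volume form: even, with invertible coefficient in every chart. -/
def IsBasisVolumeForm (ρ : M.Density 1) : Prop :=
  Density.parity ρ = ρ ∧ ∀ c : M.Chart, IsUnit (ρ.1 c)

/-- `h` is the density `|ρ|^w` of weight `w`. -/
def IsAbsPower (ρ : M.Density 1) (w : ℝ) (h : M.Density w) : Prop :=
  ∀ (c : M.Chart) (z : chartImage c.φ c.source),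
    (c.isoSource (h.1 c)).1 z =
      Grassmann.absRpow w (Grassmann.evenPart ((c.isoSource (ρ.1 c)).1 z))

end Supermanifold

end

/-!
The idea is to trivialise all densities by one basis volume form and to reduce the claim to an
identity between operators on functions.

A basis volume form `ρ` exists (`exists_isBasisVolumeForm`): it is a locally finite sum of
densities `β |Dx|`, where `β` is a bump function on a coordinate ball. A section is invertible if
its body has no zeros, and since all summands have nonnegative body in every chart, so has their
sum, with a strictly positive value at every point. The density `|ρ|^w`
(`IsBasisVolumeForm.absPower`) has invertible coefficients, so that `g ↦ g |ρ|^w` identifies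
functions with densities of weight `w` (`trivialisation`). That `|ρ|^w` transforms correctly is
seen from the uniqueness principle `eq_of_logDer`: an even invertible element of a Grassmann
algebra is determined by its body and its logarithmic derivatives along the generators. The same
principle shows that the Berezinian is multiplicative (`ber_mul`) and that real powers are
multiplicative (`absRpow_mul`) and do not depend on the chart (`absPow_eq`).

The Laplace operator `Δ_ρ f`, the divergence of `X_f` with respect to `ρ`, is well defined because
the logarithmic derivative of the Berezinian of a coordinate change along a derivation is the
difference of the divergences of the derivation in the two coordinate systems (`der_ber_jac`,
`lap_congr`). This uses that a derivation is determined by its values on the coordinates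
(`der_eq_zero`), a consequence of Hadamard's lemma. The Leibniz rule for `X_{fg}` and the
antisymmetry of the bracket give `Δ_ρ (f g) = (Δ_ρ f) g + (-1)^f f Δ_ρ g + 2 X_f g` (`lap_mul`),
which says that `[Δ_ρ, f] = Δ_ρ f + 2 X_f` as operators on functions.

In the trivialisation, the Lie derivative is `L_f (g |ρ|^w) = (X_f g + w (Δ_ρ f) g) |ρ|^w`
(`isLieDeriv_smul_absPower`), since the logarithmic derivative of `|ρ|^w` is `w` times that of
`ρ`. Hence `Δ (g |ρ|^w) = (D g) |ρ|^w` satisfies the commutator identity if and only if `[D, f] g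
= 2 X_f g + 2 w (Δ_ρ f) g` for all `f` and `g`. For `g = 1` this gives `D = 2 w Δ_ρ + C` with `C =
D 1` (`eq_of_superBr`). Inserting this operator yields `(4 w - 2) X_f g = 0`: either the bracket
vanishes or `w = 1/2` (`ham_eq_zero`). For `w = 1/2` the solutions are exactly the operators `Δ_ρ
+ C` (`superBr_iff`), and they are of order two because `[D, f]` is the sum of a derivation and a
multiplication (`superBr_superBr_superBr`).
-/

/-! ### Supercommutative algebras -/

theorem paritySign_zero : paritySign 0 = 1 := by simp [paritySign]

theorem paritySign_one : paritySign 1 = -1 := by simp [paritySign]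

theorem ZMod.two_cases (ε : ZMod 2) : ε = 0 ∨ ε = 1 := by
  revert ε; decide

theorem paritySign_add (ε δ : ZMod 2) :
    paritySign (ε + δ) = paritySign ε * paritySign δ := by
  have h : (1 + 1 : ZMod 2) = 0 := by decide
  rcases ZMod.two_cases ε with rfl | rfl <;> rcases ZMod.two_cases δ with rfl | rfl <;>
    simp [paritySign_zero, paritySign_one, h]

theorem paritySign_mul_self (ε : ZMod 2) : paritySign ε * paritySign ε = 1 := by
  rcases ZMod.two_cases ε with rfl | rfl <;> simp [paritySign_zero, paritySign_one]

/-- A supercommutative real algebra. The grading is given by the parity automorphism `sigma`: its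
eigenspaces for `1` and `-1` are the even and the odd part. The two commutation laws say that even
elements are central and that moving an arbitrary element past an odd one applies `sigma` to it. -/
class SuperAlgebra (A : Type*) [Ring A] [Algebra ℝ A] where
  sigma : A →ₐ[ℝ] A
  sigma_sigma : ∀ a, sigma (sigma a) = a
  even_comm : ∀ a b, sigma a = a → b * a = a * b
  odd_comm : ∀ a b, sigma a = -a → b * a = a * sigma b

namespace SuperAlgebra

variable {A : Type*} [Ring A] [Algebra ℝ A] [SuperAlgebra A]

/-- `a` is homogeneous of parity `ε`. -/
def Homog (ε : ZMod 2) (a : A) : Prop := sigma a = paritySign ε • a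

/-- The `ε`-th power of the parity automorphism. -/
def twist (ε : ZMod 2) : A →ₐ[ℝ] A := if ε = 0 then AlgHom.id ℝ A else sigma

theorem twist_zero (a : A) : twist 0 a = a := by simp [twist]

theorem twist_one (a : A) : twist 1 a = sigma a := by simp [twist]

theorem homog_zero_iff {a : A} : Homog 0 a ↔ sigma a = a := by simp [Homog, paritySign_zero]

theorem homog_one_iff {a : A} : Homog 1 a ↔ sigma a = -a := by simp [Homog, paritySign_one]

theorem Homog.comm {ε : ZMod 2} {a : A} (ha : Homog ε a) (b : A) : b * a = a * twist ε b := by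
  rcases ZMod.two_cases ε with rfl | rfl
  · rw [twist_zero, even_comm a b (homog_zero_iff.1 ha)]
  · rw [twist_one, odd_comm a b (homog_one_iff.1 ha)]

theorem Homog.twist {ε : ZMod 2} {a : A} (ha : Homog ε a) (δ : ZMod 2) :
    twist δ a = paritySign (δ * ε) • a := by
  rcases ZMod.two_cases δ with rfl | rfl
  · simp [twist_zero, paritySign_zero]
  · rw [twist_one, one_mul]; exact ha

theorem Homog.mul_comm {ε δ : ZMod 2} {a b : A} (ha : Homog ε a) (hb : Homog δ b) :
    a * b = paritySign (ε * δ) • (b * a) := by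
  rw [hb.comm, ha.twist, mul_smul_comm, _root_.mul_comm δ ε]

theorem Homog.mul {ε δ : ZMod 2} {a b : A} (ha : Homog ε a) (hb : Homog δ b) :
    Homog (ε + δ) (a * b) := by
  unfold Homog at *
  rw [map_mul, ha, hb, smul_mul_smul_comm, paritySign_add]

theorem Homog.add {ε : ZMod 2} {a b : A} (ha : Homog ε a) (hb : Homog ε b) : Homog ε (a + b) := by
  unfold Homog at *
  rw [map_add, ha, hb, smul_add]

theorem Homog.sub {ε : ZMod 2} {a b : A} (ha : Homog ε a) (hb : Homog ε b) : Homog ε (a - b) := by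
  unfold Homog at *
  rw [map_sub, ha, hb, smul_sub]

theorem Homog.smul {ε : ZMod 2} {a : A} (ha : Homog ε a) (r : ℝ) : Homog ε (r • a) := by
  unfold Homog at *
  rw [map_smul, ha, smul_comm]

theorem Homog.sum {ι : Type*} {ε : ZMod 2} {a : ι → A} (s : Finset ι)
    (h : ∀ i ∈ s, Homog ε (a i)) : Homog ε (∑ i ∈ s, a i) := by
  unfold Homog at *
  rw [map_sum, Finset.smul_sum]
  exact Finset.sum_congr rfl h

theorem twist_twist (ε : ZMod 2) (a : A) : twist ε (twist ε a) = a := by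
  rcases ZMod.two_cases ε with rfl | rfl
  · simp [twist_zero]
  · simp [twist_one, sigma_sigma]

/-- Every element is the sum of an even and an odd one. -/
theorem exists_homog_add (a : A) : ∃ b c : A, Homog 0 b ∧ Homog 1 c ∧ a = b + c := by
  refine ⟨(1 / 2 : ℝ) • (a + sigma a), (1 / 2 : ℝ) • (a - sigma a), ?_, ?_, ?_⟩
  · rw [homog_zero_iff, map_smul, map_add, sigma_sigma, add_comm]
  · rw [homog_one_iff, map_smul, map_sub, sigma_sigma, ← smul_neg, neg_sub]
  · rw [← smul_add, add_add_sub_cancel, ← two_smul ℝ a, smul_smul]; norm_num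

/-- Two linear maps that agree on homogeneous elements are equal. -/
theorem linearMap_ext {B : Type*} [AddCommGroup B] [Module ℝ B] {f g : A →ₗ[ℝ] B}
    (h : ∀ (ε : ZMod 2) (a : A), Homog ε a → f a = g a) : f = g := by
  ext a
  obtain ⟨b, c, hb, hc, rfl⟩ := exists_homog_add a
  rw [map_add, map_add, h 0 b hb, h 1 c hc]

/-- `D` is a derivation of parity `ε`. -/
structure IsDer (ε : ZMod 2) (D : A →ₗ[ℝ] A) : Prop where
  mul : ∀ a b, D (a * b) = D a * b + twist ε a * D b
  par : ∀ a, sigma (D a) = paritySign ε • D (sigma a)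

namespace IsDer

variable {ε δ : ZMod 2} {D E : A →ₗ[ℝ] A}

theorem map_one (hD : IsDer ε D) : D 1 = 0 := by
  have h := hD.mul 1 1
  simpa using h

theorem mul_homog (hD : IsDer ε D) {a : A} (ha : Homog δ a) (b : A) :
    D (a * b) = D a * b + paritySign (ε * δ) • (a * D b) := by
  rw [hD.mul, ha.twist, smul_mul_assoc]

theorem homog (hD : IsDer ε D) {a : A} (ha : Homog δ a) : Homog (ε + δ) (D a) := by
  unfold Homog at *
  rw [hD.par, ha, map_smul, smul_smul, paritySign_add]

theorem twist (hD : IsDer ε D) (δ : ZMod 2) (a : A) :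
    SuperAlgebra.twist δ (D a) = paritySign (δ * ε) • D (SuperAlgebra.twist δ a) := by
  rcases ZMod.two_cases δ with rfl | rfl
  · simp [twist_zero, paritySign_zero]
  · rw [twist_one, twist_one, one_mul, hD.par]

/-- A derivation is determined by its values on homogeneous products. -/
theorem of_homog (hm : ∀ (δ : ZMod 2) (a b : A), Homog δ a →
      D (a * b) = D a * b + paritySign (ε * δ) • (a * D b))
    (hp : ∀ a, sigma (D a) = paritySign ε • D (sigma a)) : IsDer ε D := by
  refine ⟨fun a b => ?_, hp⟩
  obtain ⟨c, d, hc, hd, rfl⟩ := exists_homog_add a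
  rw [add_mul, map_add, hm 0 c b hc, hm 1 d b hd, map_add, map_add, hc.twist, hd.twist]
  simp only [add_mul, smul_mul_assoc]
  abel

theorem add (hD : IsDer ε D) (hE : IsDer ε E) : IsDer ε (D + E) := by
  refine ⟨fun a b => ?_, fun a => ?_⟩
  · simp only [LinearMap.add_apply, hD.mul, hE.mul, add_mul, mul_add]; abel
  · simp only [LinearMap.add_apply, map_add, hD.par, hE.par, smul_add]

theorem zero : IsDer ε (0 : A →ₗ[ℝ] A) := ⟨by simp, by simp⟩

theorem smul (hD : IsDer ε D) (r : ℝ) : IsDer ε (r • D) := by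
  refine ⟨fun a b => ?_, fun a => ?_⟩
  · simp only [LinearMap.smul_apply, hD.mul, smul_add, smul_mul_assoc, mul_smul_comm]
  · simp only [LinearMap.smul_apply, map_smul, hD.par, smul_comm r]

theorem sub (hD : IsDer ε D) (hE : IsDer ε E) : IsDer ε (D - E) := by
  have := hD.add (hE.smul (-1))
  rwa [neg_one_smul ℝ E, ← sub_eq_add_neg] at this

theorem sum {ι : Type*} (s : Finset ι) {D : ι → A →ₗ[ℝ] A} (h : ∀ i ∈ s, IsDer ε (D i)) :
    IsDer ε (∑ i ∈ s, D i) := by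
  classical
  induction s using Finset.induction_on with
  | empty => simpa using zero
  | insert a s ha ih =>
    rw [Finset.sum_insert ha]
    exact (h a (by simp)).add (ih fun i hi => h i (by simp [hi]))

/-- The product of a homogeneous element with a derivation. -/
theorem mulLeft (hD : IsDer ε D) {u : A} (hu : Homog δ u) :
    IsDer (δ + ε) (LinearMap.mulLeft ℝ u ∘ₗ D) := by
  refine of_homog (fun γ a b ha => ?_) (fun a => ?_)
  · simp only [LinearMap.comp_apply, LinearMap.mulLeft_apply, hD.mul_homog ha, mul_add,
      mul_smul_comm, ← mul_assoc]
    rw [ha.mul_comm hu]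
    simp only [smul_mul_assoc, smul_smul]
    rw [show γ * δ = δ * γ from _root_.mul_comm _ _, ← paritySign_add,
      show (δ + ε) * γ + δ * γ = ε * γ by rw [add_mul, add_right_comm, CharTwo.add_self_eq_zero,
        zero_add]]
  · simp only [LinearMap.comp_apply, LinearMap.mulLeft_apply, map_mul, hD.par]
    rw [show sigma u = paritySign δ • u from hu, smul_mul_smul_comm, paritySign_add]

/-- The supercommutator of two derivations is a derivation. -/
theorem comm (hD : IsDer ε D) (hE : IsDer δ E) :
    IsDer (ε + δ) (D ∘ₗ E - paritySign (ε * δ) • (E ∘ₗ D)) := by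
  refine of_homog (fun γ a b ha => ?_) (fun a => ?_)
  · have h1 := hD.homog ha
    have h2 := hE.homog ha
    simp only [LinearMap.sub_apply, LinearMap.smul_apply, LinearMap.comp_apply,
      hE.mul_homog ha, hD.mul_homog ha, map_add, map_smul, hD.mul_homog h2, hE.mul_homog h1]
    simp only [smul_add, smul_smul, sub_mul, mul_sub, smul_sub, smul_mul_assoc, mul_smul_comm,
      ← paritySign_add]
    rw [show ε * δ + δ * (ε + γ) = δ * γ by rw [mul_add, mul_comm δ ε, ← add_assoc,
        CharTwo.add_self_eq_zero, zero_add],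
      show ε * (δ + γ) = ε * δ + ε * γ by ring,
      show δ * γ + ε * γ = (ε + δ) * γ by ring,
      show ε * δ + (ε * γ + δ * γ) = (ε + δ) * γ + ε * δ by ring]
    abel
  · simp only [LinearMap.sub_apply, LinearMap.smul_apply, LinearMap.comp_apply, map_sub, map_smul,
      hD.par, hE.par, smul_sub, smul_smul, ← paritySign_add]
    congr 2
    rw [show ε * δ + (δ + ε) = ε + δ + ε * δ by ring]

/-- A derivation of an even inverse. -/
theorem inv (hD : IsDer ε D) {u v : A} (hu : Homog 0 u) (huv : u * v = 1) (hvu : v * u = 1) :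
    D v = - (v * D u * v) := by
  have h := hD.mul_homog hu v
  rw [huv, hD.map_one, mul_zero, paritySign_zero, one_smul] at h
  calc D v = v * (u * D v) := by rw [← mul_assoc, hvu, one_mul]
    _ = - (v * D u * v) := by
      rw [eq_neg_of_add_eq_zero_right h.symm, mul_neg, mul_assoc]

end IsDer

/-! ### Coordinate systems -/

/-- A system of coordinates on a superalgebra: homogeneous elements `x a`, and derivations `d a`
with `d a (x b) = δ_{ab}`, such that every derivation is determined by its values on the
coordinates. -/
structure CoordSys (A : Type*) [Ring A] [Algebra ℝ A] [SuperAlgebra A] (p q : ℕ) where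
  x : Fin p ⊕ Fin q → A
  d : Fin p ⊕ Fin q → A →ₗ[ℝ] A
  homog : ∀ a, Homog (indexParity a) (x a)
  der : ∀ a, IsDer (indexParity a) (d a)
  d_x : ∀ a b, d a (x b) = if a = b then 1 else 0
  rigid : ∀ (ε : ZMod 2) (D : A →ₗ[ℝ] A), IsDer ε D → (∀ a, D (x a) = 0) → D = 0

theorem CharTwo.add_add_self (ε δ : ZMod 2) : ε + δ + δ = ε := by
  revert ε δ; decide

namespace CoordSys

variable {p q : ℕ} (S T U : CoordSys A p q) {ε : ZMod 2} {D : A →ₗ[ℝ] A}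

/-- A derivation is a combination of the partial derivatives. -/
theorem expand (hD : IsDer ε D) (g : A) : D g = ∑ a, D (S.x a) * S.d a g := by
  have h : IsDer ε (D - ∑ a, LinearMap.mulLeft ℝ (D (S.x a)) ∘ₗ S.d a) := by
    refine hD.sub (IsDer.sum _ fun a _ => ?_)
    have := (S.der a).mulLeft (hD.homog (S.homog a))
    rwa [CharTwo.add_add_self] at this
  have h0 := S.rigid ε _ h fun b => by
    simp [LinearMap.sum_apply, S.d_x, -Fintype.sum_sum_type]
  have h1 := congrArg (fun L : A →ₗ[ℝ] A => L g) h0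
  simp only [LinearMap.sub_apply, LinearMap.sum_apply, LinearMap.comp_apply,
    LinearMap.mulLeft_apply, LinearMap.zero_apply] at h1
  exact sub_eq_zero.1 h1

/-- The commutation rule of a derivation and a partial derivative. -/
theorem d_comm (hD : IsDer ε D) (a : Fin p ⊕ Fin q) (g : A) :
    S.d a (D g) = paritySign (indexParity a * ε) • D (S.d a g) +
      ∑ b, S.d a (D (S.x b)) * S.d b g := by
  have h := S.expand ((S.der a).comm hD) g
  have h0 : ∀ b, D (S.d a (S.x b)) = 0 := fun b => by
    rw [S.d_x]; split_ifs
    · exact hD.map_one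
    · exact map_zero D
  simp only [LinearMap.sub_apply, LinearMap.comp_apply, LinearMap.smul_apply, h0, smul_zero,
    sub_zero] at h
  rw [← h]; abel

/-- The divergence of a derivation of parity `ε` in a coordinate system. -/
def div (ε : ZMod 2) (D : A →ₗ[ℝ] A) : A :=
  ∑ a, paritySign (indexParity a * (ε + 1)) • S.d a (D (S.x a))

/-- The divergence of the product of an element and a derivation. -/
theorem div_mulLeft {δ : ZMod 2} {u : A} (hu : Homog δ u) (hD : IsDer ε D) :
    S.div (δ + ε) (LinearMap.mulLeft ℝ u ∘ₗ D) =
      u * S.div ε D + paritySign (δ * ε) • D u := by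
  rw [S.expand hD u, div, div, Finset.mul_sum, Finset.smul_sum, ← Finset.sum_add_distrib]
  refine Finset.sum_congr rfl fun a _ => ?_
  rw [LinearMap.comp_apply, LinearMap.mulLeft_apply, (S.der a).mul_homog hu,
    ((S.der a).homog hu).mul_comm (hD.homog (S.homog a)), smul_add, smul_smul, smul_smul,
    ← paritySign_add, ← paritySign_add, mul_smul_comm, add_comm]
  congr 3
  · rw [show indexParity a * (δ + ε + 1) + indexParity a * δ
      = indexParity a * (ε + 1) + (indexParity a * δ + indexParity a * δ) by ring,
      CharTwo.add_self_eq_zero, add_zero]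
  · have key : ∀ α δ ε : ZMod 2, α * (δ + ε + 1) + (α + δ) * (ε + α) = δ * ε := by decide
    exact key _ _ _

/-- The Jacobi matrix of two coordinate systems. -/
def jac : Matrix (Fin p ⊕ Fin q) (Fin p ⊕ Fin q) A := fun a b => S.d a (T.x b)

theorem jac_mul : S.jac T * T.jac U = S.jac U := by
  ext a b
  rw [Matrix.mul_apply]
  exact (T.expand (S.der a) (U.x b)).symm

theorem jac_self : S.jac S = 1 := by
  ext a b
  rw [jac, S.d_x, Matrix.one_apply]

end CoordSys

/-! ### The Berezinian of an even supermatrix -/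

variable (A) in
/-- The subalgebra of even elements. -/
def evenSub : Subalgebra ℝ A := AlgHom.equalizer (sigma : A →ₐ[ℝ] A) (AlgHom.id ℝ A)

theorem mem_evenSub {a : A} : a ∈ evenSub A ↔ sigma a = a := Iff.rfl

instance : CommRing (evenSub A) :=
  { (inferInstance : Ring (evenSub A)) with
    mul_comm := fun a b => Subtype.ext (even_comm b.1 a.1 b.2) }

theorem homog_coe (a : evenSub A) : Homog 0 (a : A) := homog_zero_iff.2 a.2

/-- The even part of an element. -/
noncomputable def evenPart (a : A) : evenSub A :=
  ⟨(1 / 2 : ℝ) • (a + sigma a), by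
    rw [mem_evenSub, map_smul, map_add, sigma_sigma, add_comm]⟩

theorem evenPart_coe_of_homog {a : A} (ha : Homog 0 a) : (evenPart a : A) = a := by
  change (1 / 2 : ℝ) • (a + sigma a) = a
  rw [homog_zero_iff.1 ha, ← two_smul ℝ a, smul_smul]; norm_num

section Matrices

variable {m n : ℕ}

/-- A supermatrix with entries of parity `a + b + ε` in row `a` and column `b`. -/
def IsSuperMat (ε : ZMod 2) (J : Matrix (Fin m ⊕ Fin n) (Fin m ⊕ Fin n) A) : Prop :=
  ∀ a b, Homog (indexParity a + indexParity b + ε) (J a b)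

/-- The supertrace. -/
def str (L : Matrix (Fin m ⊕ Fin n) (Fin m ⊕ Fin n) A) : A :=
  ∑ a, paritySign (indexParity a) • L a a

/-- The supertrace is cyclic. -/
theorem str_mul_comm {ε : ZMod 2} {G N : Matrix (Fin m ⊕ Fin n) (Fin m ⊕ Fin n) A}
    (hG : IsSuperMat ε G) (hN : IsSuperMat 0 N) :
    str (G * N) = str (N.map (twist ε) * G) := by
  simp only [str, Matrix.mul_apply, Finset.smul_sum]
  rw [Finset.sum_comm]
  refine Finset.sum_congr rfl fun b _ => Finset.sum_congr rfl fun a _ => ?_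
  rw [(hG a b).mul_comm (hN b a), Matrix.map_apply, (hN b a).twist, smul_mul_assoc, smul_smul,
    smul_smul, ← paritySign_add, ← paritySign_add]
  congr 2
  have key : ∀ α β ε : ZMod 2, α + (α + β + ε) * (β + α + 0) = β + ε * (β + α + 0) := by decide
  exact key _ _ _

theorem map_twist_mul (ε : ZMod 2) {k l r : Type*} [Fintype l] (G : Matrix k l A)
    (N : Matrix l r A) :
    (G * N).map (twist ε) = G.map (twist ε) * N.map (twist ε) :=
  Matrix.map_mul

/-- A derivation of a determinant with even entries. -/
theorem IsDer.det {ε : ZMod 2} {D : A →ₗ[ℝ] A} (hD : IsDer ε D) {k : Type*} [Fintype k]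
    [DecidableEq k] (M : Matrix k k (evenSub A)) :
    D (M.det : A) = ∑ i, ∑ j, (M.adjugate i j : A) * D (M j i : A) := by
  have hmul (a b : evenSub A) : D (a * b : evenSub A) = (a : A) * D b + (b : A) * D a := by
    rw [Subalgebra.coe_mul, hD.mul_homog (homog_coe a), mul_zero, paritySign_zero, one_smul,
      even_comm (b : A) (D a) b.2, add_comm]
  have hprod (s : Finset k) (f : k → evenSub A) :
      D ((∏ i ∈ s, f i : evenSub A) : A) =
        ∑ i ∈ s, ((∏ j ∈ s.erase i, f j : evenSub A) : A) * D (f i) := by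
    induction s using Finset.induction_on with
    | empty => simpa using hD.map_one
    | insert a s ha ih =>
      rw [Finset.prod_insert ha, hmul, ih, Finset.sum_insert ha, Finset.erase_insert ha, add_comm,
        Finset.mul_sum]
      congr 1
      refine Finset.sum_congr rfl fun i hi => ?_
      have hai : a ≠ i := fun h => ha (h ▸ hi)
      rw [Finset.erase_insert_of_ne hai, Finset.prod_insert (by simp [ha]), Subalgebra.coe_mul,
        mul_assoc]
  have hadj (i j : k) : M.adjugate i j =
      ∑ s : Equiv.Perm k, if s i = j then
        (Equiv.Perm.sign s : ℤ) • ∏ l ∈ Finset.univ.erase i, M (s l) l else 0 := by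
    rw [Matrix.adjugate_apply, Matrix.det_apply]
    refine Finset.sum_congr rfl fun s _ => ?_
    split_ifs with hs
    · rw [← Finset.mul_prod_erase _ _ (Finset.mem_univ i), hs, Matrix.updateRow_self,
        Pi.single_eq_same, one_mul]
      refine congrArg _ (Finset.prod_congr rfl fun l hl => ?_)
      rw [Matrix.updateRow_ne]
      rw [← hs]
      exact fun h => (Finset.mem_erase.1 hl).1 (s.injective h)
    · rw [Finset.prod_eq_zero (Finset.mem_univ (s.symm j)), smul_zero]
      rw [Equiv.apply_symm_apply, Matrix.updateRow_self, Pi.single_eq_of_ne]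
      rintro rfl
      exact hs (s.apply_symm_apply j)
  simp only [hadj, Matrix.det_apply, AddSubmonoidClass.coe_finsetSum, map_sum, Finset.sum_mul]
  rw [Finset.sum_congr rfl fun i _ => Finset.sum_comm, Finset.sum_comm]
  refine Finset.sum_congr rfl fun s _ => ?_
  have h1 : D ((Equiv.Perm.sign s • ∏ i, M (s i) i : evenSub A) : A) =
      (Equiv.Perm.sign s : ℤ) • D ((∏ i, M (s i) i : evenSub A) : A) := by
    rw [← map_zsmul]; rfl
  rw [h1, hprod, Finset.smul_sum]
  refine Finset.sum_congr rfl fun i _ => ?_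
  rw [Finset.sum_eq_single (s i)]
  · rw [if_pos rfl, ← smul_mul_assoc]; rfl
  · intro j _ hj
    rw [if_neg (Ne.symm hj)]; simp
  · simp

/-- The derivative of a determinant, given the logarithmic derivative of the matrix. -/
theorem IsDer.det_of_mul {ε : ZMod 2} {D : A →ₗ[ℝ] A} (hD : IsDer ε D) {k : Type*} [Fintype k]
    [DecidableEq k] (M : Matrix k k (evenSub A)) (N : Matrix k k A)
    (h : (M.map Subtype.val).map D = M.map Subtype.val * N) :
    D (M.det : A) = (M.det : A) * N.trace := by
  rw [hD.det]
  have h' (i j : k) : D (M j i : A) = ∑ l, (M j l : A) * N l i := by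
    have := congrFun (congrFun h j) i
    simpa [Matrix.mul_apply] using this
  simp only [h', Finset.mul_sum, ← mul_assoc]
  rw [Matrix.trace, Finset.mul_sum]
  refine Finset.sum_congr rfl fun i _ => ?_
  rw [Finset.sum_comm]
  have h2 (l : k) : ∑ j, (M.adjugate i j : A) * (M j l : A) = if i = l then (M.det : A) else 0 := by
    have := congrArg Subtype.val (congrFun (congrFun M.adjugate_mul i) l)
    rw [Matrix.mul_apply, Matrix.smul_apply, Matrix.one_apply] at this
    rw [AddSubmonoidClass.coe_finsetSum] at this
    simpa [apply_ite] using this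
  simp only [← Finset.sum_mul, h2]
  simp

end Matrices

end SuperAlgebra

namespace SuperAlgebra
variable {A : Type*} [Ring A] [Algebra ℝ A] [SuperAlgebra A]

section Berezinian

variable {m n : ℕ}

theorem IsSuperMat.mul {ε δ : ZMod 2} {G N : Matrix (Fin m ⊕ Fin n) (Fin m ⊕ Fin n) A}
    (hG : IsSuperMat ε G) (hN : IsSuperMat δ N) : IsSuperMat (ε + δ) (G * N) := by
  intro a c
  rw [Matrix.mul_apply]
  refine Homog.sum _ fun b _ => ?_
  have h := (hG a b).mul (hN b c)
  have key : ∀ α β γ ε δ : ZMod 2, α + β + ε + (β + γ + δ) = α + γ + (ε + δ) := by decide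
  rwa [key] at h

theorem IsSuperMat.sub {ε : ZMod 2} {G N : Matrix (Fin m ⊕ Fin n) (Fin m ⊕ Fin n) A}
    (hG : IsSuperMat ε G) (hN : IsSuperMat ε N) : IsSuperMat ε (G - N) :=
  fun a b => (hG a b).sub (hN a b)

theorem IsSuperMat.twist {ε : ZMod 2} {G : Matrix (Fin m ⊕ Fin n) (Fin m ⊕ Fin n) A}
    (hG : IsSuperMat ε G) (δ : ZMod 2) : IsSuperMat ε (G.map (twist δ)) := by
  intro a b
  rw [Matrix.map_apply, (hG a b).twist]
  exact (hG a b).smul _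

/-- The lower right block of an even supermatrix. -/
noncomputable def berD (J : Matrix (Fin m ⊕ Fin n) (Fin m ⊕ Fin n) A) :
    Matrix (Fin n) (Fin n) (evenSub A) :=
  J.toBlocks₂₂.map evenPart

/-- The Schur complement of the lower right block of an even supermatrix. -/
noncomputable def berS (J : Matrix (Fin m ⊕ Fin n) (Fin m ⊕ Fin n) A) :
    Matrix (Fin m) (Fin m) (evenSub A) :=
  (J.toBlocks₁₁ - J.toBlocks₁₂ * (berD J)⁻¹.map Subtype.val * J.toBlocks₂₁).map evenPart

/-- The Berezinian of an even supermatrix over a supercommutative algebra. -/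
noncomputable def ber (J : Matrix (Fin m ⊕ Fin n) (Fin m ⊕ Fin n) A) : evenSub A :=
  (berS J).det * Ring.inverse (berD J).det

theorem map_val_mul {k l r : Type*} [Fintype l] (G : Matrix k l (evenSub A))
    (N : Matrix l r (evenSub A)) :
    (G * N).map Subtype.val = G.map Subtype.val * N.map (Subtype.val : evenSub A → A) :=
  Matrix.map_mul (f := (evenSub A).val)

theorem map_val_one {k : Type*} [DecidableEq k] :
    (1 : Matrix k k (evenSub A)).map Subtype.val = (1 : Matrix k k A) :=
  Matrix.map_one Subtype.val rfl rfl

/-- Modulo the nilradical, the matrix is the identity. -/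
theorem isUnit_of_isNilpotent_sub_one {R : Type*} [CommRing R] {k : Type*} [Fintype k]
    [DecidableEq k] (N : Matrix k k R) (h : ∀ i j, IsNilpotent (N i j)) :
    IsUnit (1 - N).det := by
  have h1 : (Ideal.Quotient.mk (nilradical R)) (1 - N).det = 1 := by
    rw [RingHom.map_det, map_sub, map_one]
    have : (Ideal.Quotient.mk (nilradical R)).mapMatrix N = 0 := by
      ext i j
      rw [RingHom.mapMatrix_apply, Matrix.map_apply, Matrix.zero_apply,
        Ideal.Quotient.eq_zero_iff_mem]
      exact mem_nilradical.2 (h i j)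
    rw [this, sub_zero, Matrix.det_one]
  have h2 : (1 - N).det - 1 ∈ nilradical R := by
    rw [← Ideal.Quotient.eq_zero_iff_mem, map_sub, h1, map_one, sub_self]
  have h3 := (mem_nilradical.1 h2).isUnit_one_add
  rwa [add_sub_cancel] at h3

theorem Homog.mul_self_odd {a : A} (ha : Homog 1 a) : a * a = 0 := by
  have h := ha.mul_comm ha
  rw [one_mul, paritySign_one, neg_one_smul] at h
  have h2 : (2 : ℝ) • (a * a) = 0 := by
    rw [two_smul]; nth_rewrite 1 [h]; exact neg_add_cancel _
  exact (smul_eq_zero.1 h2).resolve_left two_ne_zero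

section

variable {J K : Matrix (Fin m ⊕ Fin n) (Fin m ⊕ Fin n) A}

theorem homog_toBlocks₁₁ {ε : ZMod 2} (hJ : IsSuperMat ε J) (i j : Fin m) :
    Homog ε (J.toBlocks₁₁ i j) := by
  have := hJ (Sum.inl i) (Sum.inl j)
  rwa [show indexParity (Sum.inl i : Fin m ⊕ Fin n) = 0 from rfl,
    show indexParity (Sum.inl j : Fin m ⊕ Fin n) = 0 from rfl, zero_add, zero_add] at this

theorem homog_toBlocks₂₂ {ε : ZMod 2} (hJ : IsSuperMat ε J) (i j : Fin n) :
    Homog ε (J.toBlocks₂₂ i j) := by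
  have := hJ (Sum.inr i) (Sum.inr j)
  rwa [show indexParity (Sum.inr i : Fin m ⊕ Fin n) = 1 from rfl,
    show indexParity (Sum.inr j : Fin m ⊕ Fin n) = 1 from rfl, CharTwo.add_self_eq_zero,
    zero_add] at this

theorem berD_map (hJ : IsSuperMat 0 J) : (berD J).map Subtype.val = J.toBlocks₂₂ := by
  ext i j
  exact evenPart_coe_of_homog (homog_toBlocks₂₂ hJ i j)

theorem homog_toBlocks₁₂ {ε : ZMod 2} (hJ : IsSuperMat ε J) (i : Fin m) (j : Fin n) :
    Homog (1 + ε) (J.toBlocks₁₂ i j) := by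
  have := hJ (Sum.inl i) (Sum.inr j)
  rwa [show indexParity (Sum.inl i : Fin m ⊕ Fin n) = 0 from rfl, zero_add] at this

theorem homog_toBlocks₂₁ {ε : ZMod 2} (hJ : IsSuperMat ε J) (i : Fin n) (j : Fin m) :
    Homog (1 + ε) (J.toBlocks₂₁ i j) := by
  have := hJ (Sum.inr i) (Sum.inl j)
  rwa [show indexParity (Sum.inl j : Fin m ⊕ Fin n) = 0 from rfl, add_zero] at this

theorem mul_blocks {B : Type*} [Ring B] (J K : Matrix (Fin m ⊕ Fin n) (Fin m ⊕ Fin n) B) :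
    (J * K).toBlocks₁₁ = J.toBlocks₁₁ * K.toBlocks₁₁ + J.toBlocks₁₂ * K.toBlocks₂₁ ∧
    (J * K).toBlocks₁₂ = J.toBlocks₁₁ * K.toBlocks₁₂ + J.toBlocks₁₂ * K.toBlocks₂₂ ∧
    (J * K).toBlocks₂₁ = J.toBlocks₂₁ * K.toBlocks₁₁ + J.toBlocks₂₂ * K.toBlocks₂₁ ∧
    (J * K).toBlocks₂₂ = J.toBlocks₂₁ * K.toBlocks₁₂ + J.toBlocks₂₂ * K.toBlocks₂₂ := by
  refine ⟨?_, ?_, ?_, ?_⟩ <;>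
  · ext i j
    simp [Matrix.mul_apply, Matrix.toBlocks₁₁, Matrix.toBlocks₁₂, Matrix.toBlocks₂₁,
      Matrix.toBlocks₂₂]

/-- The lower right block of an invertible even supermatrix is invertible, because the
off-diagonal blocks are nilpotent. -/
theorem isUnit_det_berD (hJ : IsSuperMat 0 J) (hK : IsSuperMat 0 K) (h : J * K = 1) :
    IsUnit (berD J).det := by
  have hC := homog_toBlocks₂₁ hJ
  have hB := homog_toBlocks₁₂ hK
  rw [add_zero] at hC hB
  -- `J K = 1` gives `J₂₂ K₂₂ = 1 - J₂₁ K₁₂`; the entries of `J₂₁ K₁₂` are sums of products of two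
  -- odd elements, and such a product squares to zero
  let N : Matrix (Fin n) (Fin n) (evenSub A) := (J.toBlocks₂₁ * K.toBlocks₁₂).map evenPart
  have hbc (i j k) : Homog 0 (J.toBlocks₂₁ i k * K.toBlocks₁₂ k j) := (hC i k).mul (hB k j)
  have hN : N.map Subtype.val = J.toBlocks₂₁ * K.toBlocks₁₂ := by
    ext i j
    refine evenPart_coe_of_homog ?_
    rw [Matrix.mul_apply]
    exact Homog.sum _ fun k _ => hbc i j k
  have hNil (i j) : IsNilpotent (N i j) := by
    have e : N i j = ∑ k, evenPart (J.toBlocks₂₁ i k * K.toBlocks₁₂ k j) := by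
      apply Subtype.ext
      have := congrFun (congrFun hN i) j
      rw [Matrix.map_apply] at this
      rw [this, Matrix.mul_apply, AddSubmonoidClass.coe_finsetSum]
      exact Finset.sum_congr rfl fun k _ => (evenPart_coe_of_homog (hbc i j k)).symm
    rw [e]
    refine isNilpotent_sum fun k _ => ⟨2, Subtype.ext ?_⟩
    rw [pow_two, Subalgebra.coe_mul, evenPart_coe_of_homog (hbc i j k)]
    have : K.toBlocks₁₂ k j * J.toBlocks₂₁ i k = - (J.toBlocks₂₁ i k * K.toBlocks₁₂ k j) := by
      rw [(hB k j).mul_comm (hC i k), one_mul, paritySign_one, neg_one_smul]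
    calc J.toBlocks₂₁ i k * K.toBlocks₁₂ k j * (J.toBlocks₂₁ i k * K.toBlocks₁₂ k j)
        = J.toBlocks₂₁ i k * (K.toBlocks₁₂ k j * J.toBlocks₂₁ i k) * K.toBlocks₁₂ k j := by
          simp only [mul_assoc]
      _ = 0 := by
          rw [this, mul_neg, ← mul_assoc, (hC i k).mul_self_odd]; simp
  have e : berD J * berD K = 1 - N := by
    apply Matrix.map_injective (f := (Subtype.val : evenSub A → A)) Subtype.val_injective
    change (berD J * berD K).map Subtype.val = (1 - N).map Subtype.val
    rw [map_val_mul, berD_map hJ, berD_map hK]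
    have h22 := (mul_blocks J K).2.2.2
    rw [h, ← hN] at h22
    have h1 : (1 : Matrix (Fin m ⊕ Fin n) (Fin m ⊕ Fin n) A).toBlocks₂₂ = 1 := by
      ext i j; simp [Matrix.toBlocks₂₂, Matrix.one_apply]
    rw [h1] at h22
    rw [eq_sub_of_add_eq' h22.symm, ← map_val_one]
    rfl
  have h2 := isUnit_of_isNilpotent_sub_one N hNil
  rw [← e, Matrix.det_mul] at h2
  exact isUnit_of_mul_isUnit_left h2

theorem berD_mul_inv (hJ : IsSuperMat 0 J) (hu : IsUnit (berD J).det) :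
    J.toBlocks₂₂ * (berD J)⁻¹.map Subtype.val = 1 := by
  rw [← berD_map hJ, ← map_val_mul, Matrix.mul_nonsing_inv _ hu, map_val_one]

theorem berD_inv_mul (hJ : IsSuperMat 0 J) (hu : IsUnit (berD J).det) :
    (berD J)⁻¹.map Subtype.val * J.toBlocks₂₂ = 1 := by
  rw [← berD_map hJ, ← map_val_mul, Matrix.nonsing_inv_mul _ hu, map_val_one]

theorem berS_map (hJ : IsSuperMat 0 J) : (berS J).map Subtype.val =
    J.toBlocks₁₁ - J.toBlocks₁₂ * (berD J)⁻¹.map Subtype.val * J.toBlocks₂₁ := by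
  ext i j
  refine evenPart_coe_of_homog ?_
  have hB := homog_toBlocks₁₂ hJ
  have hC := homog_toBlocks₂₁ hJ
  rw [add_zero] at hB hC
  refine (homog_toBlocks₁₁ hJ i j).sub ?_
  rw [Matrix.mul_apply]
  refine Homog.sum _ fun k _ => ?_
  rw [Matrix.mul_apply]
  have h1 : Homog 1 (∑ l, J.toBlocks₁₂ i l * (berD J)⁻¹.map Subtype.val l k) := by
    refine Homog.sum _ fun l _ => ?_
    have := (hB i l).mul (homog_coe ((berD J)⁻¹ l k))
    rwa [add_zero] at this
  exact h1.mul (hC k j)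

theorem isUnit_det_berS (hJ : IsSuperMat 0 J) (hK : IsSuperMat 0 K) (h : J * K = 1) :
    IsUnit (berS J).det := by
  have hu := isUnit_det_berD hJ hK h
  obtain ⟨h11, -, h21, -⟩ := mul_blocks J K
  have e11 : (1 : Matrix (Fin m ⊕ Fin n) (Fin m ⊕ Fin n) A).toBlocks₁₁ = 1 := by
    ext i j; simp [Matrix.toBlocks₁₁, Matrix.one_apply]
  have e21 : (1 : Matrix (Fin m ⊕ Fin n) (Fin m ⊕ Fin n) A).toBlocks₂₁ = 0 := by
    ext i j; simp [Matrix.toBlocks₂₁]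
  rw [h, e11] at h11
  rw [h, e21] at h21
  have hK1 : K.toBlocks₂₁ = - ((berD J)⁻¹.map Subtype.val * (J.toBlocks₂₁ * K.toBlocks₁₁)) := by
    have h3 := congrArg (fun Z => (berD J)⁻¹.map Subtype.val * Z) h21
    simp only [Matrix.mul_zero, Matrix.mul_add] at h3
    rw [← Matrix.mul_assoc _ J.toBlocks₂₂, berD_inv_mul hJ hu, Matrix.one_mul] at h3
    exact eq_neg_of_add_eq_zero_right h3.symm
  let A' : Matrix (Fin m) (Fin m) (evenSub A) := K.toBlocks₁₁.map evenPart
  have hA' : A'.map Subtype.val = K.toBlocks₁₁ := by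
    ext i j
    exact evenPart_coe_of_homog (homog_toBlocks₁₁ hK i j)
  have e : berS J * A' = 1 := by
    apply Matrix.map_injective (f := (Subtype.val : evenSub A → A)) Subtype.val_injective
    change (berS J * A').map Subtype.val = (1 : Matrix (Fin m) (Fin m) (evenSub A)).map Subtype.val
    rw [map_val_mul, berS_map hJ, hA', map_val_one, h11, hK1]
    rw [Matrix.sub_mul, Matrix.mul_neg, sub_eq_add_neg]
    simp only [Matrix.mul_assoc]
  have h2 := congrArg Matrix.det e
  rw [Matrix.det_mul, Matrix.det_one] at h2
  exact IsUnit.of_mul_eq_one _ h2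

theorem isUnit_ber (hJ : IsSuperMat 0 J) (hK : IsSuperMat 0 K) (h : J * K = 1) :
    IsUnit (ber J) :=
  (isUnit_det_berS hJ hK h).mul (isUnit_det_berD hJ hK h).ringInverse

end

theorem IsDer.map_matrix_mul {ε : ZMod 2} {D : A →ₗ[ℝ] A} (hD : IsDer ε D) {k l r : Type*}
    [Fintype l] (G : Matrix k l A) (N : Matrix l r A) :
    (G * N).map D = G.map D * N + G.map (SuperAlgebra.twist ε) * N.map D := by
  ext i j
  simp only [Matrix.map_apply, Matrix.mul_apply, map_sum, hD.mul, Finset.sum_add_distrib,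
    Matrix.add_apply]

theorem twist_map_of_homog {k l : Type*} {δ : ZMod 2} {G : Matrix k l A}
    (h : ∀ i j, Homog δ (G i j)) (ε : ZMod 2) :
    G.map (twist ε) = paritySign (ε * δ) • G := by
  ext i j
  exact (h i j).twist ε

/-- The logarithmic derivative of the Berezinian is a supertrace. With `L` in blocks `a, b, c, d`,
the logarithmic derivatives of the Schur complement and of the lower right block `D` are
`a - b D⁻¹ C` and `D⁻¹ (± C b) + d`; in the difference of their traces the terms with `b` cancel,
because `b` and `D⁻¹ C` have entries of parity `ε + 1` and `1`. -/
theorem IsDer.ber {ε : ZMod 2} {X : A →ₗ[ℝ] A} (hX : IsDer ε X)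
    {J K L : Matrix (Fin m ⊕ Fin n) (Fin m ⊕ Fin n) A} (hJ : IsSuperMat 0 J) (hK : IsSuperMat 0 K)
    (h : J * K = 1) (hL : IsSuperMat ε L) (hXJ : J.map X = J.map (SuperAlgebra.twist ε) * L) :
    X (SuperAlgebra.ber J : A) = (SuperAlgebra.ber J : A) * str L := by
  have hu := isUnit_det_berD hJ hK h
  have hDD := berD_mul_inv hJ hu
  have hDD' := berD_inv_mul hJ hu
  have hB := homog_toBlocks₁₂ hJ
  have hC := homog_toBlocks₂₁ hJ
  have hb := homog_toBlocks₁₂ hL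
  rw [add_zero] at hB hC
  have hA := homog_toBlocks₁₁ hJ
  have hD := homog_toBlocks₂₂ hJ
  obtain ⟨h11, h12, h21, h22⟩ := mul_blocks (J.map (SuperAlgebra.twist ε)) L
  rw [← hXJ] at h11 h12 h21 h22
  -- the twist is trivial on the diagonal blocks and the sign `(-1)^ε` on the off-diagonal ones
  have tA : (J.map (SuperAlgebra.twist ε)).toBlocks₁₁ = J.toBlocks₁₁ := by
    have := twist_map_of_homog hA ε
    rw [mul_zero, paritySign_zero, one_smul] at this
    exact this
  have tD : (J.map (SuperAlgebra.twist ε)).toBlocks₂₂ = J.toBlocks₂₂ := by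
    have := twist_map_of_homog hD ε
    rw [mul_zero, paritySign_zero, one_smul] at this
    exact this
  have tB' := twist_map_of_homog hB ε
  have tC' := twist_map_of_homog hC ε
  rw [mul_one] at tB' tC'
  have tB : (J.map (SuperAlgebra.twist ε)).toBlocks₁₂ = paritySign ε • J.toBlocks₁₂ := tB'
  have tC : (J.map (SuperAlgebra.twist ε)).toBlocks₂₁ = paritySign ε • J.toBlocks₂₁ := tC'
  rw [tA, tB] at h11 h12
  rw [tC, tD] at h21 h22
  have eD := berD_map hJ
  have eS := berS_map hJ
  set Di : Matrix (Fin n) (Fin n) A := (berD J)⁻¹.map Subtype.val with hDi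
  set a := L.toBlocks₁₁
  set b := L.toBlocks₁₂
  set c := L.toBlocks₂₁
  set d := L.toBlocks₂₂
  set s := paritySign ε with hs
  have hss : s * s = 1 := paritySign_mul_self ε
  change J.toBlocks₁₁.map X = _ at h11
  change J.toBlocks₁₂.map X = _ at h12
  change J.toBlocks₂₁.map X = _ at h21
  change J.toBlocks₂₂.map X = _ at h22
  set JA := J.toBlocks₁₁
  set JB := J.toBlocks₁₂
  set JC := J.toBlocks₂₁
  set JD := J.toBlocks₂₂
  have hDiE : ∀ i j, Homog 0 (Di i j) := fun i j => homog_coe ((berD J)⁻¹ i j)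
  have tDi : Di.map (SuperAlgebra.twist ε) = Di := by
    have := twist_map_of_homog hDiE ε
    rwa [mul_zero, paritySign_zero, one_smul] at this
  have cancel {r : ℕ} (Z : Matrix (Fin n) (Fin r) A) : Di * (JD * Z) = Z := by
    rw [← Matrix.mul_assoc, hDD', Matrix.one_mul]
  have XDi : Di.map X = - (Di * (JD.map X * Di)) := by
    have h0 : (JD * Di).map X = 0 := by
      rw [hDD]
      ext i j
      rw [Matrix.map_apply, Matrix.one_apply]
      split_ifs
      · exact hX.map_one
      · exact map_zero X
    rw [hX.map_matrix_mul, show JD.map (SuperAlgebra.twist ε) = JD from tD] at h0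
    have h3 := congrArg (fun Z => Di * Z) h0
    simp only [Matrix.mul_zero, Matrix.mul_add, cancel] at h3
    exact eq_neg_of_add_eq_zero_right h3
  have XS : ((berS J).map Subtype.val).map X = (berS J).map Subtype.val * (a - b * Di * JC) := by
    have e1 : (JA - JB * Di * JC).map X = JA.map X - (JB * (Di * JC)).map X := by
      rw [Matrix.mul_assoc]
      ext i j; simp
    rw [eS, e1, hX.map_matrix_mul, hX.map_matrix_mul, tDi, XDi, h11, h12, h21, h22,
      show JB.map (SuperAlgebra.twist ε) = s • JB from tB]
    simp only [Matrix.mul_add, Matrix.add_mul, Matrix.mul_sub, Matrix.sub_mul, Matrix.neg_mul,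
      Matrix.mul_neg, Matrix.smul_mul, Matrix.mul_smul, Matrix.mul_assoc, cancel, smul_smul, hss,
      one_smul]
    abel
  have XD : ((berD J).map Subtype.val).map X =
      (berD J).map Subtype.val * (Di * (s • JC * b) + d) := by
    rw [eD, h22, Matrix.mul_add, ← Matrix.mul_assoc JD, hDD, Matrix.one_mul]
  have dS := hX.det_of_mul _ _ XS
  have dD := hX.det_of_mul _ _ XD
  -- for odd factors the trace is cyclic only up to a sign, which is opposite to the sign `s`
  have htr : (b * Di * JC).trace + (Di * (s • JC * b)).trace = 0 := by
    rw [Matrix.mul_assoc, ← Matrix.mul_assoc Di]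
    have hG : ∀ i j, Homog 1 ((Di * JC) i j) := fun i j => by
      rw [Matrix.mul_apply]
      refine Homog.sum _ fun k _ => ?_
      have := (hDiE i k).mul (hC k j)
      rwa [zero_add] at this
    rw [Matrix.mul_smul, Matrix.smul_mul, Matrix.trace_smul]
    have : (b * (Di * JC)).trace = - s • ((Di * JC) * b).trace := by
      simp only [Matrix.trace, Matrix.diag_apply, Matrix.mul_apply, Finset.smul_sum]
      rw [Finset.sum_comm]
      refine Finset.sum_congr rfl fun i _ => Finset.sum_congr rfl fun j _ => ?_
      have := (hb j i).mul_comm (hG i j)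
      rw [mul_one, paritySign_add, paritySign_one, neg_one_mul] at this
      simpa only [Matrix.mul_apply] using this
    rw [this, neg_smul, neg_add_cancel]
  have hstr : str L = a.trace - d.trace := by
    simp only [str, Fintype.sum_sum_type, Matrix.trace, sub_eq_add_neg, ← Finset.sum_neg_distrib]
    congr 1
    · refine Finset.sum_congr rfl fun i _ => ?_
      rw [show indexParity (Sum.inl i : Fin m ⊕ Fin n) = 0 from rfl, paritySign_zero, one_smul]
      rfl
    · refine Finset.sum_congr rfl fun i _ => ?_
      rw [show indexParity (Sum.inr i : Fin m ⊕ Fin n) = 1 from rfl, paritySign_one, neg_one_smul]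
      rfl
  have hv : ((berD J).det : A) * (Ring.inverse (berD J).det : evenSub A) = 1 := by
    rw [← Subalgebra.coe_mul, Ring.mul_inverse_cancel _ hu]; rfl
  have hv' : ((Ring.inverse (berD J).det : evenSub A) : A) * ((berD J).det : A) = 1 := by
    rw [← Subalgebra.coe_mul, Ring.inverse_mul_cancel _ hu]; rfl
  have dv := hX.inv (homog_coe _) hv hv'
  set v := ((Ring.inverse (berD J).det : evenSub A) : A) with hvdef
  have hvE : ∀ z : A, z * v = v * z := fun z => even_comm _ _ (Ring.inverse (berD J).det).2
  have hber : (SuperAlgebra.ber J : A) = ((berS J).det : A) * v := rfl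
  rw [hber, hX.mul_homog (homog_coe _), mul_zero, paritySign_zero, one_smul, dS, dv, dD, hstr]
  rw [← mul_assoc v, hv', one_mul, mul_assoc _ (a - b * Di * JC).trace v,
    hvE (a - b * Di * JC).trace, hvE (Di * (s • JC * b) + d).trace, mul_neg, ← sub_eq_add_neg,
    ← mul_assoc, ← mul_assoc, ← mul_sub]
  rw [Matrix.trace_sub, Matrix.trace_add]
  congr 1
  rw [eq_neg_of_add_eq_zero_left htr]
  abel

theorem IsSuperMat.map_der {ε δ : ZMod 2} {X : A →ₗ[ℝ] A} (hX : IsDer ε X)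
    {J : Matrix (Fin m ⊕ Fin n) (Fin m ⊕ Fin n) A} (hJ : IsSuperMat δ J) :
    IsSuperMat (δ + ε) (J.map X) := fun a b => by
  have := hX.homog (hJ a b)
  rwa [show ε + (indexParity a + indexParity b + δ) = indexParity a + indexParity b + (δ + ε) by
    ring] at this

theorem map_twist_mul_map_twist {ε : ZMod 2} {J K : Matrix (Fin m ⊕ Fin n) (Fin m ⊕ Fin n) A}
    (h : J * K = 1) : J.map (twist ε) * K.map (twist ε) = 1 := by
  rw [← map_twist_mul, h, Matrix.map_one _ (map_zero _) (map_one _)]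

/-- The logarithmic derivative of the Berezinian is the supertrace of `J⁻¹ X J`, with `J⁻¹` twisted
by the parity of `X`. -/
theorem IsDer.ber_eq_str {ε : ZMod 2} {X : A →ₗ[ℝ] A} (hX : IsDer ε X)
    {J K : Matrix (Fin m ⊕ Fin n) (Fin m ⊕ Fin n) A} (hJ : IsSuperMat 0 J) (hK : IsSuperMat 0 K)
    (h : J * K = 1) :
    X (SuperAlgebra.ber J : A) =
      (SuperAlgebra.ber J : A) * str (K.map (SuperAlgebra.twist ε) * J.map X) := by
  have hL := (hK.twist ε).mul (hJ.map_der hX)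
  rw [zero_add, zero_add] at hL
  refine hX.ber hJ hK h hL ?_
  rw [← Matrix.mul_assoc, map_twist_mul_map_twist h, Matrix.one_mul]

/-- The logarithmic derivative of the Berezinian of a product. -/
theorem IsDer.ber_mul {ε : ZMod 2} {X : A →ₗ[ℝ] A} (hX : IsDer ε X)
    {J K N P : Matrix (Fin m ⊕ Fin n) (Fin m ⊕ Fin n) A} (hJ : IsSuperMat 0 J) (hK : IsSuperMat 0 K)
    (h : J * K = 1) (hKJ : K * J = 1) (hN : IsSuperMat 0 N) (hP : IsSuperMat 0 P) (h1 : N * P = 1) :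
    X (SuperAlgebra.ber (J * N) : A) = (SuperAlgebra.ber (J * N) : A) *
      (str (K.map (SuperAlgebra.twist ε) * J.map X) +
        str (P.map (SuperAlgebra.twist ε) * N.map X)) := by
  have hJN := hJ.mul hN
  have hPK := hP.mul hK
  rw [add_zero] at hJN hPK
  have h3 : J * N * (P * K) = 1 := by
    rw [Matrix.mul_assoc, ← Matrix.mul_assoc N, h1, Matrix.one_mul, h]
  have hG := ((hK.twist ε).mul (hJ.map_der hX)).mul hN
  rw [zero_add, zero_add, add_zero] at hG
  rw [hX.ber_eq_str hJN hPK h3, hX.map_matrix_mul, map_twist_mul]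
  congr 1
  have e1 : str (P.map (SuperAlgebra.twist ε) * (K.map (SuperAlgebra.twist ε) * J.map X * N)) =
      str (K.map (SuperAlgebra.twist ε) * J.map X) := by
    rw [← str_mul_comm hG hP, Matrix.mul_assoc, h1, Matrix.mul_one]
  have e2 : P.map (SuperAlgebra.twist ε) * K.map (SuperAlgebra.twist ε) *
      (J.map X * N + J.map (SuperAlgebra.twist ε) * N.map X) =
      P.map (SuperAlgebra.twist ε) * (K.map (SuperAlgebra.twist ε) * J.map X * N) +
      P.map (SuperAlgebra.twist ε) * N.map X := by
    rw [Matrix.mul_add]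
    congr 1
    · simp only [Matrix.mul_assoc]
    · rw [Matrix.mul_assoc, ← Matrix.mul_assoc (K.map _), map_twist_mul_map_twist hKJ,
        Matrix.one_mul]
  rw [e2, ← e1]
  simp only [str, Matrix.add_apply, smul_add, Finset.sum_add_distrib]

/-- The Berezinian is natural with respect to ring homomorphisms from the even part to a commutative
ring, which need not come from homomorphisms of superalgebras: the body map and the passage between
two descriptions of the even part are of this kind. -/
theorem coe_ber_natural {R : Type*} [CommRing R] (φ : evenSub A →+* R)
    {J : Matrix (Fin m ⊕ Fin n) (Fin m ⊕ Fin n) A} (hu : IsUnit (berD J).det)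
    {D S : Matrix _ _ R} (hD : D = (berD J).map φ)
    (hS : S = (berS J).map φ) : φ (ber J) = S.det * Ring.inverse D.det := by
  have hDd : D.det = φ (berD J).det := by rw [hD, RingHom.map_det]; rfl
  have hSd : S.det = φ (berS J).det := by rw [hS, RingHom.map_det]; rfl
  rw [ber, map_mul, hSd, hDd]
  congr 1
  obtain ⟨u, hu⟩ := hu
  rw [← hu, Ring.inverse_unit, show φ u = (Units.map φ.toMonoidHom u : Rˣ) from rfl,
    Ring.inverse_unit]
  rfl

theorem map_nonsing_inv_of_isUnit {R R' : Type*} [CommRing R] [CommRing R'] (φ : R →+* R')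
    {k : Type*} [Fintype k] [DecidableEq k] {D : Matrix k k R} (hu : IsUnit D.det) :
    (D.map φ)⁻¹ = D⁻¹.map φ := by
  refine Matrix.inv_eq_right_inv ?_
  rw [← Matrix.map_mul, Matrix.mul_nonsing_inv _ hu, Matrix.map_one _ (map_zero _) (map_one _)]

/-- The map on even parts induced by a homomorphism of superalgebras. -/
def evenMap {B : Type*} [Ring B] [Algebra ℝ B] [SuperAlgebra B] (φ : A →ₐ[ℝ] B)
    (hφ : ∀ a, φ (sigma a) = sigma (φ a)) : evenSub A →+* evenSub B :=
  ((φ.comp (evenSub A).val).codRestrict (evenSub B) fun a => by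
    change sigma (φ a) = φ a
    rw [← hφ, a.2]; rfl : evenSub A →ₐ[ℝ] evenSub B)

/-- The Berezinian is natural with respect to homomorphisms of superalgebras. -/
theorem ber_map {B : Type*} [Ring B] [Algebra ℝ B] [SuperAlgebra B] (φ : A →ₐ[ℝ] B)
    (hφ : ∀ a, φ (sigma a) = sigma (φ a)) {J : Matrix (Fin m ⊕ Fin n) (Fin m ⊕ Fin n) A}
    (hu : IsUnit (berD J).det) : φ (ber J : A) = (ber (J.map φ) : B) := by
  have hev (a : A) : evenMap φ hφ (evenPart a) = evenPart (φ a) := by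
    apply Subtype.ext
    change φ ((1 / 2 : ℝ) • (a + sigma a)) = (1 / 2 : ℝ) • (φ a + sigma (φ a))
    rw [map_smul, map_add, hφ]
  have hD : berD (J.map φ) = (berD J).map (evenMap φ hφ) := by
    ext i j : 1
    exact (hev _).symm
  have hS : berS (J.map φ) = (berS J).map (evenMap φ hφ) := by
    rw [berS, berS, hD, map_nonsing_inv_of_isUnit _ hu]
    have e : (J.map φ).toBlocks₁₁ - (J.map φ).toBlocks₁₂ *
          ((berD J)⁻¹.map (evenMap φ hφ)).map Subtype.val * (J.map φ).toBlocks₂₁ =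
        (J.toBlocks₁₁ - J.toBlocks₁₂ * (berD J)⁻¹.map Subtype.val * J.toBlocks₂₁).map φ := by
      rw [Matrix.map_sub _ (map_sub φ), Matrix.map_mul, Matrix.map_mul]
      rfl
    rw [e]
    ext i j : 1
    exact (hev _).symm
  have := coe_ber_natural (evenMap φ hφ) hu hD hS
  exact congrArg Subtype.val this

end Berezinian

namespace CoordSys

variable {p q : ℕ} (S T U : CoordSys A p q) {ε : ZMod 2} {X : A →ₗ[ℝ] A}

theorem isSuperMat_jac : IsSuperMat 0 (S.jac T) := fun a b => by
  rw [add_zero]; exact (S.der a).homog (T.homog b)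

theorem jac_mul_jac : S.jac T * T.jac S = 1 := by rw [jac_mul, jac_self]

/-- The logarithmic derivative of the Berezinian of a change of coordinates along a derivation is
the difference of the divergences of the derivation. -/
theorem der_ber_jac (hX : IsDer ε X) :
    X (ber (S.jac T) : A) = (ber (S.jac T) : A) * (T.div ε X - S.div ε X) := by
  let G (R : CoordSys A p q) : Matrix (Fin p ⊕ Fin q) (Fin p ⊕ Fin q) A :=
    fun a b => paritySign (indexParity a * ε) • R.d a (X (R.x b))
  have hG (R : CoordSys A p q) : IsSuperMat ε (G R) := fun a b => by
    have := (R.der a).homog (hX.homog (R.homog b))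
    rw [show indexParity a + (ε + indexParity b) = indexParity a + indexParity b + ε by ring]
      at this
    exact this.smul _
  have hdiv (R : CoordSys A p q) : str (G R) = R.div ε X := by
    refine Finset.sum_congr rfl fun a _ => ?_
    rw [smul_smul, ← paritySign_add, mul_add, mul_one, add_comm]
  -- the commutator of `X` with `∂_a`, applied to the coordinates of `T`
  have hXJ : (S.jac T).map X = (S.jac T).map (twist ε) * G T - G S * S.jac T := by
    ext a b
    rw [Matrix.map_apply, Matrix.sub_apply, Matrix.mul_apply, Matrix.mul_apply]
    have h1 := S.d_comm hX a (T.x b)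
    have h2 := T.expand (S.der a) (X (T.x b))
    have h3 : X (S.d a (T.x b)) = paritySign (indexParity a * ε) • (S.d a (X (T.x b)) -
        ∑ c, S.d a (X (S.x c)) * S.d c (T.x b)) := by
      rw [h1, add_sub_cancel_right, smul_smul, paritySign_mul_self, one_smul]
    change X (S.d a (T.x b)) = _
    rw [h3, h2, smul_sub, Finset.smul_sum, Finset.smul_sum]
    congr 1
    · refine Finset.sum_congr rfl fun c _ => ?_
      rw [Matrix.map_apply, (S.isSuperMat_jac T a c).twist, smul_mul_smul_comm, ← paritySign_add]
      congr 2
      have key : ∀ α γ ε : ZMod 2, α * ε = ε * (α + γ + 0) + γ * ε := by decide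
      exact key _ _ _
    · refine Finset.sum_congr rfl fun c _ => ?_
      rw [← smul_mul_assoc]; rfl
  have hJ := S.isSuperMat_jac T
  have hK := T.isSuperMat_jac S
  have hGJ := (hG S).mul hJ
  rw [add_zero] at hGJ
  have hKGJ := (hK.twist ε).mul hGJ
  rw [zero_add] at hKGJ
  have hL := (hG T).sub hKGJ
  have hJK := S.jac_mul_jac T
  rw [hX.ber hJ hK hJK hL, ← hdiv T, ← hdiv S]
  · have h1 : str ((T.jac S).map (twist ε) * (G S * S.jac T)) = str (G S) := by
      rw [← str_mul_comm hGJ hK, Matrix.mul_assoc, hJK, Matrix.mul_one]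
    rw [← h1]
    simp only [str, Matrix.sub_apply, smul_sub, Finset.sum_sub_distrib]
  · rw [hXJ, Matrix.mul_sub, ← Matrix.mul_assoc, ← map_twist_mul, hJK,
      Matrix.map_one _ (map_zero _) (map_one _), Matrix.one_mul]

end CoordSys

end SuperAlgebra

namespace SuperAlgebra
variable {A : Type*} [Ring A] [Algebra ℝ A] [SuperAlgebra A]

/-! ### Derivatives of power series in a nilpotent element -/

theorem IsDer.coe_mul {ε : ZMod 2} {X : A →ₗ[ℝ] A} (hX : IsDer ε X) (a b : evenSub A) :
    X ((a * b : evenSub A) : A) = (a : A) * X b + (b : A) * X a := by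
  rw [Subalgebra.coe_mul, hX.mul_homog (homog_coe a), mul_zero, paritySign_zero, one_smul,
    even_comm (b : A) (X a) b.2, add_comm]

theorem IsDer.coe_pow_succ {ε : ZMod 2} {X : A →ₗ[ℝ] A} (hX : IsDer ε X) (a : evenSub A) (k : ℕ) :
    X ((a ^ (k + 1) : evenSub A) : A) = ((k + 1 : ℝ) • (a ^ k : evenSub A) : A) * X a := by
  induction k with
  | zero => simp
  | succ k ih =>
    rw [pow_succ, hX.coe_mul, ih, ← mul_assoc, mul_smul_comm, ← Subalgebra.coe_mul,
      _root_.mul_comm a, ← pow_succ, ← add_mul]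
    congr 1
    push_cast
    module

/-- The differential equation of the binomial series: if the coefficients `s k` behave like the
Taylor coefficients `f^(k)(b) / k!` of a function with `t f'(t) = w f(t)`, and `n` is nilpotent,
then the sum `P = ∑ s k n^k` satisfies `(b + n) X P = w P X (b + n)`. -/
theorem IsDer.binomial {ε : ZMod 2} {X : A →ₗ[ℝ] A} (hX : IsDer ε X) (w : ℝ) (N : ℕ)
    (s : ℕ → evenSub A) (b n : evenSub A) (hn : n ^ (N + 1) = 0)
    (hs : ∀ k, X (s k) = ((k + 1 : ℝ) • (s (k + 1) : A)) * X b)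
    (hb : ∀ k : ℕ, (k + 1 : ℝ) • (s (k + 1) * b) = (w - k) • s k) :
    ((b + n : evenSub A) : A) * X ((∑ k ∈ Finset.range (N + 1), s k * n ^ k : evenSub A) : A) =
      w • (((∑ k ∈ Finset.range (N + 1), s k * n ^ k : evenSub A) : A) *
        X ((b + n : evenSub A) : A)) := by
  -- `G` is the derivative of the series, so that `X P = G X (b + n)` and `(b + n) G = w P`
  let G : evenSub A := ∑ k ∈ Finset.range (N + 1), (k + 1 : ℝ) • (s (k + 1) * n ^ k)
  have hG : X ((∑ k ∈ Finset.range (N + 1), s k * n ^ k : evenSub A) : A) =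
      (G : A) * X ((b + n : evenSub A) : A) := by
    have h1 : X ((∑ k ∈ Finset.range (N + 1), s k * n ^ k : evenSub A) : A) =
        (G : A) * X b + ∑ k ∈ Finset.range (N + 1), (s k : A) * X ((n ^ k : evenSub A) : A) := by
      rw [AddSubmonoidClass.coe_finsetSum, map_sum, AddSubmonoidClass.coe_finsetSum,
        Finset.sum_mul, ← Finset.sum_add_distrib]
      refine Finset.sum_congr rfl fun k _ => ?_
      rw [hX.coe_mul, add_comm, hs, ← mul_assoc]
      congr 2
      rw [← Subalgebra.coe_smul, ← Subalgebra.coe_mul]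
      congr 1
      rw [mul_smul_comm, _root_.mul_comm]
    have h2 : ∑ k ∈ Finset.range (N + 1), (s k : A) * X ((n ^ k : evenSub A) : A) =
        (G : A) * X n := by
      rw [Finset.sum_range_succ', AddSubmonoidClass.coe_finsetSum, Finset.sum_range_succ,
        add_mul, Finset.sum_mul]
      congr 1
      · refine Finset.sum_congr rfl fun k _ => ?_
        rw [hX.coe_pow_succ, ← mul_assoc, ← Subalgebra.coe_smul, ← Subalgebra.coe_mul,
          mul_smul_comm]
      · have h3 := hX.coe_pow_succ n N
        rw [hn, Subalgebra.coe_zero, map_zero] at h3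
        rw [pow_zero, Subalgebra.coe_one, hX.map_one, mul_zero, ← mul_smul_comm,
          Subalgebra.coe_mul, Subalgebra.coe_smul, mul_assoc, ← h3, mul_zero]
    rw [h1, h2, ← mul_add, ← map_add]; rfl
  have hw : (b + n) * G = w • ∑ k ∈ Finset.range (N + 1), s k * n ^ k := by
    have h1 : b * G = ∑ k ∈ Finset.range (N + 1), (w - k) • (s k * n ^ k) := by
      rw [Finset.mul_sum]
      refine Finset.sum_congr rfl fun k _ => ?_
      rw [← smul_mul_assoc (w - k), ← hb, mul_smul_comm, smul_mul_assoc,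
        _root_.mul_comm (s (k + 1)) b, mul_assoc]
    have h2 : n * G = ∑ k ∈ Finset.range (N + 1), (k : ℝ) • (s k * n ^ k) := by
      rw [Finset.mul_sum, Finset.sum_range_succ, Finset.sum_range_succ' (n := N)]
      have h3 : n * ((N + 1 : ℝ) • (s (N + 1) * n ^ N)) = 0 := by
        rw [mul_smul_comm, mul_left_comm, ← pow_succ', hn, mul_zero, smul_zero]
      rw [h3]
      simp only [Nat.cast_zero, zero_smul]
      congr 1
      refine Finset.sum_congr rfl fun k _ => ?_
      rw [mul_smul_comm, mul_left_comm, ← pow_succ']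
      push_cast; rfl
    rw [add_mul, h1, h2, ← Finset.sum_add_distrib, Finset.smul_sum]
    refine Finset.sum_congr rfl fun k _ => ?_
    rw [← add_smul, sub_add_cancel]
  rw [hG, ← mul_assoc, ← Subalgebra.coe_mul, hw, Subalgebra.coe_smul, smul_mul_assoc]

end SuperAlgebra

namespace Grassmann

open SuperAlgebra

variable {q : ℕ}

/-! ### The Grassmann algebra as a superalgebra -/

theorem eq_zero_of_eq_neg {V : Type*} [AddCommGroup V] [Module ℝ V] {c : V} (h : c = -c) :
    c = 0 := by
  have h2 : (2 : ℝ) • c = 0 := by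
    rw [two_smul]; nth_rewrite 2 [h]; exact add_neg_cancel c
  exact (smul_eq_zero.1 h2).resolve_left two_ne_zero

theorem mem_even_iff {a : Grassmann q} : a ∈ even q ↔ parity q a = a := by
  constructor
  · exact fun h => CliffordAlgebra.involute_eq_of_mem_even h
  · intro h
    have hc := CliffordAlgebra.evenOdd_isCompl (0 : QuadraticForm ℝ (Fin q → ℝ))
    obtain ⟨b, hb, c, hc, rfl⟩ := Submodule.mem_sup.1
      (hc.sup_eq_top ▸ Submodule.mem_top :
        a ∈ CliffordAlgebra.evenOdd 0 0 ⊔ CliffordAlgebra.evenOdd 0 1)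
    have h1 : parity q (b + c) = b + -c := by
      rw [map_add]
      exact congrArg₂ _ (CliffordAlgebra.involute_eq_of_mem_even hb)
        (CliffordAlgebra.involute_eq_of_mem_odd hc)
    rw [h1] at h
    have h2 : c = 0 := eq_zero_of_eq_neg (add_left_cancel h).symm
    rw [h2, add_zero]
    exact hb

theorem mem_odd {a : Grassmann q} (h : parity q a = -a) :
    a ∈ CliffordAlgebra.evenOdd (0 : QuadraticForm ℝ (Fin q → ℝ)) 1 := by
  have hc := CliffordAlgebra.evenOdd_isCompl (0 : QuadraticForm ℝ (Fin q → ℝ))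
  obtain ⟨b, hb, c, hc, rfl⟩ := Submodule.mem_sup.1
    (hc.sup_eq_top ▸ Submodule.mem_top :
        a ∈ CliffordAlgebra.evenOdd 0 0 ⊔ CliffordAlgebra.evenOdd 0 1)
  have h1 : parity q (b + c) = b + -c := by
    rw [map_add]
    exact congrArg₂ _ (CliffordAlgebra.involute_eq_of_mem_even hb)
      (CliffordAlgebra.involute_eq_of_mem_odd hc)
  rw [h1, neg_add] at h
  have h2 : b = 0 := eq_zero_of_eq_neg (add_right_cancel h)
  rw [h2, zero_add]
  exact hc

theorem mul_ι (b : Grassmann q) (v : Fin q → ℝ) :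
    b * ExteriorAlgebra.ι ℝ v = ExteriorAlgebra.ι ℝ v * parity q b := by
  induction b using ExteriorAlgebra.induction with
  | algebraMap r => rw [AlgHom.commutes, Algebra.commutes]
  | ι z =>
    have : parity q (ExteriorAlgebra.ι ℝ z) = - ExteriorAlgebra.ι ℝ z :=
      CliffordAlgebra.involute_ι z
    rw [this, mul_neg]
    exact eq_neg_of_add_eq_zero_left (ExteriorAlgebra.ι_add_mul_swap z v)
  | mul x y hx hy => rw [mul_assoc, hy, ← mul_assoc, hx, mul_assoc, map_mul]
  | add x y hx hy => rw [add_mul, hx, hy, map_add, mul_add]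

instance (q : ℕ) : SuperAlgebra (Grassmann q) where
  sigma := parity q
  sigma_sigma := CliffordAlgebra.involute_involute
  even_comm a b h := ((even_commute a (mem_even_iff.2 h) b).eq).symm
  odd_comm a b h := by
    have ha := mem_odd h
    clear h
    induction a, ha using CliffordAlgebra.odd_induction with
    | ι v => exact mul_ι b v
    | add x y hx hy ihx ihy => rw [mul_add, add_mul, ihx, ihy]
    | ι_mul_ι_mul m₁ m₂ x hx ih =>
      have hev : CliffordAlgebra.ι (0 : QuadraticForm ℝ (Fin q → ℝ)) m₁ *
          CliffordAlgebra.ι (0 : QuadraticForm ℝ (Fin q → ℝ)) m₂ ∈ even q :=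
        CliffordAlgebra.ι_mul_ι_mem_evenOdd_zero _ m₁ m₂
      have h1 := (even_commute _ hev b).eq
      rw [← mul_assoc, ← h1, mul_assoc, ih]
      simp only [mul_assoc]

theorem even_eq_evenSub : even q = evenSub (Grassmann q) :=
  Subalgebra.ext fun _ => mem_even_iff

/-- The contraction with the `j`-th coordinate functional, i.e. the derivative with respect to the
`j`-th generator. -/
def contr (j : Fin q) : Grassmann q →ₗ[ℝ] Grassmann q :=
  CliffordAlgebra.contractLeft (Q := (0 : QuadraticForm ℝ (Fin q → ℝ))) (LinearMap.proj j)

theorem contr_ι_mul (j : Fin q) (v : Fin q → ℝ) (b : Grassmann q) :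
    contr j (ExteriorAlgebra.ι ℝ v * b) = v j • b - ExteriorAlgebra.ι ℝ v * contr j b :=
  CliffordAlgebra.contractLeft_ι_mul _ v b

theorem contr_algebraMap (j : Fin q) (r : ℝ) : contr j (algebraMap ℝ (Grassmann q) r) = 0 :=
  CliffordAlgebra.contractLeft_algebraMap _ _ r

theorem contr_ι (j : Fin q) (v : Fin q → ℝ) :
    contr j (ExteriorAlgebra.ι ℝ v) = algebraMap ℝ (Grassmann q) (v j) :=
  CliffordAlgebra.contractLeft_ι _ _ v

theorem isDer_contr (j : Fin q) : IsDer 1 (contr j) where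
  mul a b := by
    rw [twist_one]
    change contr j (a * b) = contr j a * b + parity q a * contr j b
    induction a using ExteriorAlgebra.induction generalizing b with
    | algebraMap r =>
      rw [contr_algebraMap, AlgHom.commutes, zero_mul, zero_add, ← Algebra.smul_def, map_smul,
        Algebra.smul_def]
    | ι v =>
      have : parity q (ExteriorAlgebra.ι ℝ v) = - ExteriorAlgebra.ι ℝ v :=
        CliffordAlgebra.involute_ι v
      rw [contr_ι_mul, contr_ι, this, Algebra.smul_def, neg_mul, sub_eq_add_neg]
    | mul x y hx hy =>
      rw [mul_assoc, hx, hy, hx y, map_mul]; noncomm_ring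
    | add x y hx hy => rw [add_mul, map_add, hx, hy, map_add, map_add]; noncomm_ring
  par a := by
    rw [paritySign_one, neg_one_smul]
    change parity q (contr j a) = - contr j (parity q a)
    induction a using CliffordAlgebra.left_induction with
    | algebraMap r =>
      rw [AlgHom.commutes]
      erw [contr_algebraMap]
      simp
    | add x y hx hy => rw [map_add, map_add, hx, hy, map_add, map_add, neg_add]
    | ι_mul x v hx =>
      have : parity q (ExteriorAlgebra.ι ℝ v) = - ExteriorAlgebra.ι ℝ v :=
        CliffordAlgebra.involute_ι v
      change parity q (contr j (ExteriorAlgebra.ι ℝ v * x)) =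
        - contr j (parity q (ExteriorAlgebra.ι ℝ v * x))
      rw [contr_ι_mul, map_sub, map_smul, map_mul, map_mul, this, hx]
      have e : contr j (-ExteriorAlgebra.ι ℝ v * parity q x) =
          - (v j • parity q x - ExteriorAlgebra.ι ℝ v * contr j (parity q x)) := by
        rw [← contr_ι_mul, neg_mul, LinearMap.map_neg]
      rw [e]
      simp

/-- The body, as an algebra homomorphism on the whole Grassmann algebra. -/
noncomputable def bodyHom (q : ℕ) : Grassmann q →ₐ[ℝ] ℝ := ExteriorAlgebra.algebraMapInv

/-- The Euler operator. -/
noncomputable def euler (q : ℕ) : Grassmann q →ₗ[ℝ] Grassmann q :=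
  ∑ j, LinearMap.mulLeft ℝ (ExteriorAlgebra.ι ℝ (Pi.single j 1)) ∘ₗ contr j

theorem homog_ι (v : Fin q → ℝ) : Homog 1 (ExteriorAlgebra.ι ℝ v : Grassmann q) :=
  homog_one_iff.2 (CliffordAlgebra.involute_ι v)

theorem isDer_euler (q : ℕ) : IsDer 0 (euler q) := by
  have : IsDer (1 + 1) (euler q) := IsDer.sum _ fun j _ => (isDer_contr j).mulLeft (homog_ι _)
  rwa [CharTwo.add_self_eq_zero] at this

theorem euler_ι (v : Fin q → ℝ) :
    euler q (ExteriorAlgebra.ι ℝ v) = ExteriorAlgebra.ι ℝ v := by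
  simp only [euler, LinearMap.sum_apply, LinearMap.comp_apply, LinearMap.mulLeft_apply, contr_ι]
  simp only [← Algebra.commutes, ← Algebra.smul_def]
  simp only [← map_smul, ← map_sum]
  congr 1
  ext i
  simp [Finset.sum_apply, Pi.single_apply]

theorem euler_of_mem {n : ℕ} {a : Grassmann q} (ha : a ∈ ⋀[ℝ]^n (Fin q → ℝ)) :
    euler q a = (n : ℝ) • a := by
  induction n generalizing a with
  | zero =>
    change a ∈ LinearMap.range (ExteriorAlgebra.ι ℝ (M := Fin q → ℝ)) ^ 0 at ha
    rw [pow_zero] at ha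
    obtain ⟨r, rfl⟩ := Submodule.mem_one.1 ha
    rw [Algebra.algebraMap_eq_smul_one, map_smul, (isDer_euler q).map_one]; simp
  | succ n ih =>
    change a ∈ LinearMap.range (ExteriorAlgebra.ι ℝ (M := Fin q → ℝ)) ^ (n + 1) at ha
    rw [pow_succ'] at ha
    induction ha using Submodule.mul_induction_on' with
    | mem_mul_mem m hm b hb =>
      obtain ⟨v, rfl⟩ := hm
      rw [(isDer_euler q).mul, twist_zero, ih hb, euler_ι]
      push_cast
      rw [add_smul, one_smul, mul_smul_comm, add_comm]
    | add x _ y _ hx hy => rw [map_add, hx, hy, smul_add]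

/-- An element that is killed by all contractions is a scalar. -/
theorem eq_algebraMap_of_contr_eq_zero {a : Grassmann q} (h : ∀ j, contr j a = 0) :
    a = algebraMap ℝ _ (bodyHom q a) := by
  have h0 : euler q a = 0 := by simp [euler, LinearMap.sum_apply, h]
  -- the Euler operator multiplies the component of degree `n` by `n`
  have hd : ∀ b : Grassmann q, ∀ n : ℕ,
      (DirectSum.decompose (fun i : ℕ => ⋀[ℝ]^i (Fin q → ℝ)) (euler q b) n : Grassmann q) =
      (n : ℝ) • (DirectSum.decompose (fun i : ℕ => ⋀[ℝ]^i (Fin q → ℝ)) b n : Grassmann q) := by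
    intro b n
    induction b using DirectSum.Decomposition.inductionOn (fun i : ℕ => ⋀[ℝ]^i (Fin q → ℝ)) with
    | zero => simp
    | homogeneous m =>
      rename_i i
      rw [euler_of_mem m.2, DirectSum.decompose_smul, DirectSum.decompose_coe]
      change ((i : ℝ) • (DirectSum.of (fun i => ⋀[ℝ]^i (Fin q → ℝ)) i m n) : Grassmann q) = _
      by_cases hin : i = n
      · subst hin; simp
      · rw [DirectSum.of_eq_of_ne _ _ _ (Ne.symm hin)]; simp
    | add x y hx hy =>
      rw [map_add, DirectSum.decompose_add, DirectSum.decompose_add, DirectSum.add_apply,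
        DirectSum.add_apply, Submodule.coe_add, Submodule.coe_add, hx, hy, smul_add]
  have hz : ∀ n : ℕ, n ≠ 0 →
      (DirectSum.decompose (fun i : ℕ => ⋀[ℝ]^i (Fin q → ℝ)) a n : Grassmann q) = 0 := by
    intro n hn
    have := hd a n
    rw [h0] at this
    simp only [DirectSum.decompose_zero, DirectSum.zero_apply, ZeroMemClass.coe_zero] at this
    exact (smul_eq_zero.1 this.symm).resolve_left (Nat.cast_ne_zero.2 hn)
  classical
  have ha : a = (DirectSum.decompose (fun i : ℕ => ⋀[ℝ]^i (Fin q → ℝ)) a 0 : Grassmann q) := by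
    conv_lhs => rw [← DirectSum.sum_support_decompose (fun i : ℕ => ⋀[ℝ]^i (Fin q → ℝ)) a]
    rw [Finset.sum_eq_single 0]
    · intro n _ hn; exact hz n hn
    · intro h; simpa using h
  have hmem := (DirectSum.decompose (fun i : ℕ => ⋀[ℝ]^i (Fin q → ℝ)) a 0).2
  rw [← ha] at hmem
  change a ∈ LinearMap.range (ExteriorAlgebra.ι ℝ (M := Fin q → ℝ)) ^ 0 at hmem
  rw [pow_zero] at hmem
  obtain ⟨r, rfl⟩ := Submodule.mem_one.1 hmem
  rw [AlgHom.commutes]; rfl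

theorem sub_body_mem (a : Grassmann q) : a - algebraMap ℝ _ (bodyHom q a) ∈
    (LinearMap.range (ExteriorAlgebra.ι ℝ (M := Fin q → ℝ)) * ⊤ : Submodule ℝ (Grassmann q)) := by
  induction a using ExteriorAlgebra.induction with
  | algebraMap r => rw [AlgHom.commutes]; simp
  | ι v =>
    have : bodyHom q (ExteriorAlgebra.ι ℝ v) = 0 := by
      simp [bodyHom, ExteriorAlgebra.algebraMapInv]
    rw [this, map_zero, sub_zero, ← mul_one (ExteriorAlgebra.ι ℝ v)]
    exact Submodule.mul_mem_mul ⟨v, rfl⟩ Submodule.mem_top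
  | mul x y hx hy =>
    have e : x * y - algebraMap ℝ _ (bodyHom q (x * y)) =
        (x - algebraMap ℝ _ (bodyHom q x)) * y +
          bodyHom q x • (y - algebraMap ℝ _ (bodyHom q y)) := by
      rw [map_mul, map_mul, Algebra.smul_def]; noncomm_ring
    rw [e]
    refine Submodule.add_mem _ ?_ (Submodule.smul_mem _ _ hy)
    have := Submodule.mul_mem_mul hx (Submodule.mem_top (x := y))
    rw [mul_assoc] at this
    have h2 : (LinearMap.range (ExteriorAlgebra.ι ℝ (M := Fin q → ℝ)) * (⊤ * ⊤) :
        Submodule ℝ (Grassmann q)) ≤ LinearMap.range (ExteriorAlgebra.ι ℝ) * ⊤ := by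
      gcongr; exact le_top
    exact h2 this
  | add x y hx hy =>
    have := Submodule.add_mem _ hx hy
    rw [map_add, map_add]
    rwa [add_sub_add_comm]

/-- An element without body lies in the ideal `V ∧ Λ` generated by `V = ℝ^q`, whose power of
exponent `q + 1` vanishes. -/
theorem nilpotent_of_body_eq_zero {n : Grassmann q} (hn : bodyHom q n = 0) :
    n ^ (q + 1) = 0 := by
  set V : Submodule ℝ (Grassmann q) := LinearMap.range (ExteriorAlgebra.ι ℝ (M := Fin q → ℝ))
    with hV
  have h1 : n ∈ V * ⊤ := by
    have := sub_body_mem n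
    rwa [hn, map_zero, sub_zero] at this
  have hcomm : (⊤ : Submodule ℝ (Grassmann q)) * V ≤ V * ⊤ := by
    rw [Submodule.mul_le]
    rintro b _ _ ⟨v, rfl⟩
    rw [mul_ι]
    exact Submodule.mul_mem_mul ⟨v, rfl⟩ Submodule.mem_top
  have hpow : ∀ k : ℕ, n ^ k ∈ V ^ k * ⊤ := by
    intro k
    induction k with
    | zero => simp
    | succ k ih =>
      have h2 := Submodule.mul_mem_mul ih h1
      rw [← pow_succ] at h2
      have h3 : V ^ k * ⊤ * (V * ⊤) ≤ V ^ (k + 1) * ⊤ := by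
        calc V ^ k * ⊤ * (V * ⊤) = V ^ k * (⊤ * V) * ⊤ := by simp only [mul_assoc]
          _ ≤ V ^ k * (V * ⊤) * ⊤ := by gcongr
          _ = V ^ (k + 1) * (⊤ * ⊤) := by rw [pow_succ]; simp only [mul_assoc]
          _ ≤ V ^ (k + 1) * ⊤ := by gcongr; exact le_top
      exact h3 h2
  have hbot : V ^ (q + 1) = ⊥ := by
    have : Module.finrank ℝ (⋀[ℝ]^(q + 1) (Fin q → ℝ)) = 0 := by
      rw [exteriorPower.finrank_eq, Module.finrank_fin_fun, Nat.choose_succ_self]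
    have h3 := Submodule.finrank_eq_zero.1 this
    exact h3
  have := hpow (q + 1)
  rw [hbot, Submodule.bot_mul] at this
  simpa using this

end Grassmann

namespace Grassmann

open SuperAlgebra

variable {q : ℕ}

/-! ### Units and real powers in the Grassmann algebra -/

/-- The two descriptions of the even part of the Grassmann algebra agree. -/
def toEven (q : ℕ) : even q ≃ₐ[ℝ] evenSub (Grassmann q) :=
  Subalgebra.equivOfEq _ _ even_eq_evenSub

theorem parity_coe (a : even q) : parity q (a : Grassmann q) = a := mem_even_iff.1 a.2

theorem homog_coe_even (a : even q) : Homog 0 (a : Grassmann q) := homog_zero_iff.2 (parity_coe a)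

theorem body_eq (a : even q) : body a = bodyHom q a := rfl

theorem bodyHom_of_odd {a : Grassmann q} (h : Homog 1 a) : bodyHom q a = 0 := by
  have h1 : bodyHom q (parity q a) = bodyHom q a := by
    have : (bodyHom q).comp (parity q) = bodyHom q := by
      refine ExteriorAlgebra.hom_ext (LinearMap.ext fun v => ?_)
      have : parity q (ExteriorAlgebra.ι ℝ v) = - ExteriorAlgebra.ι ℝ v :=
        CliffordAlgebra.involute_ι v
      simp [this, bodyHom, ExteriorAlgebra.algebraMapInv]
    exact DFunLike.congr_fun this a
  rw [show parity q a = -a from homog_one_iff.1 h, map_neg] at h1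
  linarith

theorem isUnit_of_body_ne_zero {a : even q} (h : body a ≠ 0) : IsUnit a := by
  have h1 : IsNilpotent (a - algebraMap ℝ (even q) (body a)) := by
    refine ⟨q + 1, Subtype.ext ?_⟩
    have : bodyHom q ((a : Grassmann q) - algebraMap ℝ _ (body a)) = 0 := by
      rw [map_sub, AlgHom.commutes, body_eq]; simp
    exact nilpotent_of_body_eq_zero this
  have h2 : IsUnit (algebraMap ℝ (even q) (body a)) := (isUnit_iff_ne_zero.2 h).map _
  have := h1.isUnit_add_left_of_commute h2 (Commute.all _ _)
  rwa [add_sub_cancel] at this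

/-- An even element with nonzero body is determined by its body and its logarithmic derivatives
along the generators. -/
theorem eq_of_logDer {u v : Grassmann q} (hu : Homog 0 u) (hv : Homog 0 v)
    (hv0 : bodyHom q v ≠ 0) (hb : bodyHom q u = bodyHom q v) (l : Fin q → Grassmann q)
    (hul : ∀ j, contr j u = u * l j) (hvl : ∀ j, contr j v = v * l j) : u = v := by
  obtain ⟨V, hV⟩ := isUnit_of_body_ne_zero (a := ⟨v, mem_even_iff.2 (homog_zero_iff.1 hv)⟩) hv0
  set v' : Grassmann q := (((V⁻¹ : (even q)ˣ) : even q) : Grassmann q) with hv'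
  have hv'0 : Homog 0 v' := homog_coe_even _
  have e1 : v * v' = 1 := by
    have := congrArg Subtype.val V.mul_inv
    rw [Subalgebra.coe_mul, hV] at this; exact this
  have e2 : v' * v = 1 := by
    have := congrArg Subtype.val V.inv_mul
    rw [Subalgebra.coe_mul, hV] at this; exact this
  -- `v⁻¹ u` is killed by all contractions, hence it is a scalar, and its body is `1`
  have h0 : ∀ j, contr j (v' * u) = 0 := by
    intro j
    have h1 := (isDer_contr j).inv hv e1 e2
    rw [(isDer_contr j).mul_homog hv'0, h1, hvl, hul, mul_zero, paritySign_zero, one_smul,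
      ← mul_assoc v', e2, one_mul, neg_mul, mul_assoc, ← mul_assoc v' u]
    have h2 := (hv'0.mul hu).comm (l j)
    rw [add_zero, twist_zero] at h2
    rw [← h2, neg_add_cancel]
  have h1 := eq_algebraMap_of_contr_eq_zero h0
  have h2 : bodyHom q (v' * u) = 1 := by
    rw [map_mul, hb, ← map_mul, e2, map_one]
  rw [h2, map_one] at h1
  calc u = v * (v' * u) := by rw [← mul_assoc, e1, one_mul]
    _ = v := by rw [h1, mul_one]

/-- The coefficients of the binomial series. -/
noncomputable def binomCoeff (w t : ℝ) (k : ℕ) : ℝ := Ring.choose w k * |t| ^ w * (t⁻¹) ^ k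

theorem choose_succ_mul (w : ℝ) (k : ℕ) :
    (k + 1 : ℝ) * Ring.choose w (k + 1) = (w - k) * Ring.choose w k := by
  rw [Ring.choose_eq_smul, Ring.choose_eq_smul, descPochhammer_succ_right, Polynomial.smeval_mul,
    Nat.factorial_succ]
  have : Polynomial.smeval (Polynomial.X - (k : Polynomial ℤ)) w = w - k := by
    rw [Polynomial.smeval_sub, Polynomial.smeval_X, pow_one, Polynomial.smeval_natCast]
    simp
  rw [this]
  have : (k.factorial : ℝ) ≠ 0 := Nat.cast_ne_zero.2 k.factorial_ne_zero
  simp only [smul_eq_mul]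
  push_cast
  field_simp

theorem binomCoeff_succ_mul (w : ℝ) {t : ℝ} (ht : t ≠ 0) (k : ℕ) :
    (k + 1 : ℝ) * (binomCoeff w t (k + 1) * t) = (w - k) * binomCoeff w t k := by
  have h := choose_succ_mul w k
  have : (k + 1 : ℝ) * (binomCoeff w t (k + 1) * t) =
      ((k + 1 : ℝ) * Ring.choose w (k + 1)) * |t| ^ w * (t⁻¹) ^ k * (t⁻¹ * t) := by
    rw [binomCoeff, pow_succ]; ring
  rw [this, h, inv_mul_cancel₀ ht, binomCoeff]; ring

theorem absRpow_eq (w : ℝ) (a : even q) : absRpow w a = ∑ k ∈ Finset.range (q + 1),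
    algebraMap ℝ (even q) (binomCoeff w (body a) k) *
      (a - algebraMap ℝ (even q) (body a)) ^ k := by
  refine Finset.sum_congr rfl fun k _ => ?_
  rw [← Algebra.smul_def]; rfl

theorem body_sub_body (a : even q) :
    bodyHom q (a - algebraMap ℝ (even q) (body a) : even q) = 0 := by
  change bodyHom q ((a : Grassmann q) - algebraMap ℝ _ (body a)) = 0
  rw [map_sub, AlgHom.commutes, body_eq]; simp

theorem body_absRpow (w : ℝ) (a : even q) : body (absRpow w a) = |body a| ^ w := by
  have h := congrArg ((bodyHom q).comp (even q).val) (absRpow_eq w a)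
  rw [map_sum, Finset.sum_eq_single 0] at h
  · refine h.trans ?_
    rw [pow_zero, mul_one, AlgHom.commutes, binomCoeff, Ring.choose_zero_right]
    simp
  · intro k _ hk
    rw [map_mul, map_pow]
    have : ((bodyHom q).comp (even q).val) (a - algebraMap ℝ (even q) (body a)) = 0 :=
      body_sub_body a
    rw [this, zero_pow hk, mul_zero]
  · simp

theorem body_absRpow_pos (w : ℝ) {a : even q} (h : body a ≠ 0) : 0 < body (absRpow w a) := by
  rw [body_absRpow]; exact Real.rpow_pos_of_pos (abs_pos.2 h) _

theorem sub_body_pow (a : even q) : (a - algebraMap ℝ (even q) (body a)) ^ (q + 1) = 0 :=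
  Subtype.ext (nilpotent_of_body_eq_zero (body_sub_body a))

/-- The differential equation of the real power, along a contraction. -/
theorem contr_absRpow (w : ℝ) {a : even q} (h : body a ≠ 0) (j : Fin q) :
    (a : Grassmann q) * contr j (absRpow w a) = w • (absRpow w a * contr j a) := by
  have := (isDer_contr j).binomial w q
    (fun k => algebraMap ℝ (evenSub (Grassmann q)) (binomCoeff w (body a) k))
    (algebraMap ℝ _ (body a)) (toEven q (a - algebraMap ℝ (even q) (body a)))
    (by rw [← map_pow, sub_body_pow, map_zero])
    (fun k => by
      have h1 : contr j ((algebraMap ℝ (evenSub (Grassmann q)) (body a) : evenSub _) :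
          Grassmann q) = 0 := contr_algebraMap j _
      rw [h1, mul_zero]
      exact contr_algebraMap j _)
    (fun k => by
      rw [← map_mul, Algebra.smul_def, Algebra.smul_def, ← map_mul, ← map_mul,
        binomCoeff_succ_mul w h])
  have e : ∑ k ∈ Finset.range (q + 1),
      algebraMap ℝ (evenSub (Grassmann q)) (binomCoeff w (body a) k) *
        toEven q (a - algebraMap ℝ (even q) (body a)) ^ k = toEven q (absRpow w a) := by
    rw [absRpow_eq, map_sum]
    refine Finset.sum_congr rfl fun k _ => ?_
    rw [map_mul, map_pow, AlgEquiv.commutes]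
  have e2 : algebraMap ℝ (evenSub (Grassmann q)) (body a) +
      toEven q (a - algebraMap ℝ (even q) (body a)) = toEven q a := by
    rw [map_sub, AlgEquiv.commutes, add_sub_cancel]
  rw [e, e2] at this
  exact this

theorem contr_absRpow_eq_mul (w : ℝ) {a : even q} (h : body a ≠ 0) (j : Fin q) :
    contr j (absRpow w a) =
      (absRpow w a : Grassmann q) * (w • ((Ring.inverse a : even q) * contr j a)) := by
  have h1 := contr_absRpow w h j
  have e : ((Ring.inverse a : even q) : Grassmann q) * a = 1 := by
    rw [← Subalgebra.coe_mul, Ring.inverse_mul_cancel _ (isUnit_of_body_ne_zero h)]; rfl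
  calc contr j (absRpow w a) = (Ring.inverse a : even q) * ((a : Grassmann q) *
        contr j (absRpow w a)) := by rw [← mul_assoc, e, one_mul]
    _ = _ := by
      rw [h1, mul_smul_comm, mul_smul_comm, ← mul_assoc, ← mul_assoc, ← Subalgebra.coe_mul,
        _root_.mul_comm, Subalgebra.coe_mul]

/-- The real power is multiplicative. Both sides have the same body and the same logarithmic
derivatives along the generators. -/
theorem absRpow_mul (w : ℝ) {a b : even q} (ha : body a ≠ 0) (hb : body b ≠ 0) :
    absRpow w (a * b) = absRpow w a * absRpow w b := by
  have hab : body (a * b) = body a * body b := by simp [body_eq]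
  have hab0 : body (a * b) ≠ 0 := by rw [hab]; exact mul_ne_zero ha hb
  apply Subtype.ext
  refine eq_of_logDer (homog_coe_even _) (homog_coe_even _) ?_ ?_
    (fun j => w • ((Ring.inverse (a * b) : even q) * contr j (a * b : even q)))
    (fun j => contr_absRpow_eq_mul w hab0 j) (fun j => ?_)
  · rw [Subalgebra.coe_mul, map_mul]
    exact mul_ne_zero (body_absRpow_pos w ha).ne' (body_absRpow_pos w hb).ne'
  · rw [Subalgebra.coe_mul, map_mul, ← body_eq, ← body_eq, ← body_eq, body_absRpow, body_absRpow,
      body_absRpow, hab, abs_mul, Real.mul_rpow (abs_nonneg _) (abs_nonneg _)]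
  · have e : contr j ((a * b : even q) : Grassmann q) = a * contr j b + b * contr j a :=
      (isDer_contr j).coe_mul (toEven q a) (toEven q b)
    have e' : contr j ((absRpow w a * absRpow w b : even q) : Grassmann q) =
        absRpow w a * contr j (absRpow w b) + absRpow w b * contr j (absRpow w a) :=
      (isDer_contr j).coe_mul (toEven q _) (toEven q _)
    rw [e', e, contr_absRpow_eq_mul w ha, contr_absRpow_eq_mul w hb, Ring.mul_inverse_rev,
      mul_add, smul_add, mul_add]
    have ia := Ring.inverse_mul_cancel _ (isUnit_of_body_ne_zero ha)
    have ib := Ring.inverse_mul_cancel _ (isUnit_of_body_ne_zero hb)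
    congr 1
    · rw [← mul_assoc, ← mul_assoc, ← Subalgebra.coe_mul, ← Subalgebra.coe_mul, mul_assoc _ _ a, ia,
        mul_one]
    · rw [← mul_assoc, ← mul_assoc, ← Subalgebra.coe_mul, ← Subalgebra.coe_mul,
        mul_right_comm _ _ b, ib, one_mul, _root_.mul_comm (absRpow w b)]

theorem absRpow_absRpow_one (w : ℝ) {a : even q} (ha : body a ≠ 0) :
    absRpow w (absRpow 1 a) = absRpow w a := by
  have h1 : body (absRpow 1 a) ≠ 0 := (body_absRpow_pos 1 ha).ne'
  apply Subtype.ext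
  refine eq_of_logDer (homog_coe_even _) (homog_coe_even _) (body_absRpow_pos w ha).ne' ?_
    (fun j => w • ((Ring.inverse a : even q) * contr j (a : even q)))
    (fun j => ?_) (fun j => contr_absRpow_eq_mul w ha j)
  · rw [← body_eq, ← body_eq, body_absRpow, body_absRpow, body_absRpow, Real.rpow_one, abs_abs]
  · rw [contr_absRpow_eq_mul w h1, contr_absRpow_eq_mul 1 ha, one_smul,
      ← mul_assoc (Ring.inverse _ : even q).1, ← Subalgebra.coe_mul,
      Ring.inverse_mul_cancel _ (isUnit_of_body_ne_zero h1)]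
    simp

/-! ### The Berezinian over the Grassmann algebra -/

variable {m n : ℕ} {J K N P : Matrix (Fin m ⊕ Fin n) (Fin m ⊕ Fin n) (Grassmann q)}

theorem coe_evenPart_of_homog {a : Grassmann q} (h : Homog 0 a) :
    (evenPart a : Grassmann q) = a :=
  DirectSum.decompose_of_mem_same _ (mem_even_iff.2 (homog_zero_iff.1 h))

theorem toEven_symm_evenPart {a : Grassmann q} (h : Homog 0 a) :
    (toEven q).symm (SuperAlgebra.evenPart a) = evenPart a :=
  Subtype.ext ((evenPart_coe_of_homog h).trans (coe_evenPart_of_homog h).symm)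

/-- The function `berezinian` of an invertible even matrix is the Berezinian over the superalgebra
`Λ_q`. -/
theorem coe_berezinian (hJ : IsSuperMat 0 J) (hK : IsSuperMat 0 K) (h : J * K = 1) :
    berezinian J = (toEven q).symm (ber J) := by
  have hu := isUnit_det_berD hJ hK h
  have hD : J.toBlocks₂₂.map evenPart = (berD J).map ((toEven q).symm : _ →+* even q) := by
    ext i j : 1
    exact (toEven_symm_evenPart (homog_toBlocks₂₂ hJ i j)).symm
  refine (coe_ber_natural ((toEven q).symm : _ →+* even q) hu hD ?_).symm
  rw [hD, map_nonsing_inv_of_isUnit _ hu]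
  have e : ((berD J)⁻¹.map ((toEven q).symm : _ →+* even q)).map Subtype.val =
    (berD J)⁻¹.map (Subtype.val : _ → Grassmann q) := rfl
  rw [e, ← berS_map hJ]
  ext i j : 1
  apply Subtype.ext
  exact coe_evenPart_of_homog (homog_coe _)

/-- The body of the Berezinian. -/
theorem body_ber (hJ : IsSuperMat 0 J) (hK : IsSuperMat 0 K) (h : J * K = 1) :
    bodyHom q (ber J : Grassmann q) = (J.toBlocks₁₁.map (bodyHom q)).det *
      ((J.toBlocks₂₂.map (bodyHom q)).det)⁻¹ := by
  have hu := isUnit_det_berD hJ hK h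
  rw [← Ring.inverse_eq_inv']
  refine coe_ber_natural (((bodyHom q).comp (evenSub (Grassmann q)).val : _ →ₐ[ℝ] ℝ) : _ →+* ℝ) hu
    ?_ ?_
  · rw [← berD_map hJ]; rfl
  · have e : (berS J).map (((bodyHom q).comp (evenSub (Grassmann q)).val : _ →ₐ[ℝ] ℝ) : _ →+* ℝ) =
        ((berS J).map Subtype.val).map (bodyHom q) := rfl
    rw [e, berS_map hJ, Matrix.map_sub _ (map_sub _), Matrix.map_mul]
    have e2 : J.toBlocks₂₁.map (bodyHom q) = 0 := by
      ext i j
      have := homog_toBlocks₂₁ hJ i j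
      rw [add_zero] at this
      exact bodyHom_of_odd this
    rw [e2, Matrix.mul_zero, sub_zero]

theorem body_blocks_mul (hJ : IsSuperMat 0 J) :
    (J * N).toBlocks₁₁.map (bodyHom q) =
      J.toBlocks₁₁.map (bodyHom q) * N.toBlocks₁₁.map (bodyHom q) ∧
    (J * N).toBlocks₂₂.map (bodyHom q) =
      J.toBlocks₂₂.map (bodyHom q) * N.toBlocks₂₂.map (bodyHom q) := by
  obtain ⟨h11, -, -, h22⟩ := mul_blocks J N
  have e1 : J.toBlocks₁₂.map (bodyHom q) = 0 := by
    ext i j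
    have := homog_toBlocks₁₂ hJ i j
    rw [add_zero] at this
    exact bodyHom_of_odd this
  have e2 : J.toBlocks₂₁.map (bodyHom q) = 0 := by
    ext i j
    have := homog_toBlocks₂₁ hJ i j
    rw [add_zero] at this
    exact bodyHom_of_odd this
  rw [h11, h22, Matrix.map_add _ (map_add _), Matrix.map_add _ (map_add _), Matrix.map_mul,
    Matrix.map_mul, Matrix.map_mul, Matrix.map_mul, e1, e2]
  simp

/-- The Berezinian is multiplicative. Both sides have the same body and the same logarithmic
derivatives along the generators of `Λ_q`. -/
theorem ber_mul (hJ : IsSuperMat 0 J) (hK : IsSuperMat 0 K) (h : J * K = 1) (hKJ : K * J = 1)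
    (hN : IsSuperMat 0 N) (hP : IsSuperMat 0 P) (h1 : N * P = 1) :
    ber (J * N) = ber J * ber N := by
  have hJN := hJ.mul hN
  have hPK := hP.mul hK
  rw [add_zero] at hJN hPK
  have h3 : J * N * (P * K) = 1 := by
    rw [Matrix.mul_assoc, ← Matrix.mul_assoc N, h1, Matrix.one_mul, h]
  have b0 : ∀ {J K : Matrix (Fin m ⊕ Fin n) (Fin m ⊕ Fin n) (Grassmann q)}, IsSuperMat 0 J →
      IsSuperMat 0 K → J * K = 1 → bodyHom q (ber J : Grassmann q) ≠ 0 := by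
    intro J K hJ hK h
    have := (isUnit_ber hJ hK h).map ((bodyHom q).comp (evenSub (Grassmann q)).val)
    exact this.ne_zero
  apply Subtype.ext
  refine eq_of_logDer (homog_coe _) (homog_coe _) ?_ ?_ _
    (fun j => (isDer_contr j).ber_mul hJ hK h hKJ hN hP h1) (fun j => ?_)
  · rw [Subalgebra.coe_mul, map_mul]
    exact mul_ne_zero (b0 hJ hK h) (b0 hN hP h1)
  · obtain ⟨e1, e2⟩ := body_blocks_mul (N := N) hJ
    rw [Subalgebra.coe_mul, map_mul, body_ber hJ hK h, body_ber hN hP h1, body_ber hJN hPK h3,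
      e1, e2, Matrix.det_mul, Matrix.det_mul, mul_inv]
    ring
  · rw [(isDer_contr j).coe_mul, (isDer_contr j).ber_eq_str hJ hK h,
      (isDer_contr j).ber_eq_str hN hP h1, Subalgebra.coe_mul, mul_add, mul_assoc, add_comm]
    congr 1
    · rw [← mul_assoc, ← Subalgebra.coe_mul, _root_.mul_comm (ber N), Subalgebra.coe_mul, mul_assoc]
    · rw [mul_assoc]

end Grassmann

/-! ### Hadamard's lemma -/

section Hadamard

open MeasureTheory Set

variable {E : Type} [NormedAddCommGroup E] [NormedSpace ℝ E] [FiniteDimensional ℝ E]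

theorem hasFDerivAt_integral_param {G : Type} [NormedAddCommGroup G] [NormedSpace ℝ G]
    {F : E × ℝ → G} (hF : ContDiff ℝ ∞ F) (x₀ : E) :
    HasFDerivAt (fun x => ∫ t in (0 : ℝ)..1, F (x, t))
      (∫ t in (0 : ℝ)..1, (fderiv ℝ F (x₀, t)).comp (ContinuousLinearMap.inl ℝ E ℝ)) x₀ := by
  have hF1 : Continuous (fderiv ℝ F) := hF.continuous_fderiv (by simp)
  have hF' : Continuous fun z : E × ℝ => (fderiv ℝ F z).comp (ContinuousLinearMap.inl ℝ E ℝ) := by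
    fun_prop
  obtain ⟨C, hC⟩ :=
    ((isCompact_closedBall x₀ 1).prod (isCompact_Icc (a := (0 : ℝ)) (b := 1)))
      |>.exists_bound_of_continuousOn hF'.continuousOn
  refine intervalIntegral.hasFDerivAt_integral_of_dominated_of_fderiv_le
    (F := fun x t => F (x, t))
    (F' := fun x t => (fderiv ℝ F (x, t)).comp (ContinuousLinearMap.inl ℝ E ℝ))
    (bound := fun _ => C) (Metric.closedBall_mem_nhds x₀ one_pos) ?_ ?_ ?_ ?_ ?_ ?_
  · exact Filter.Eventually.of_forall fun x =>
      (hF.continuous.comp (by fun_prop)).aestronglyMeasurable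
  · exact (hF.continuous.comp (by fun_prop :
      Continuous fun t : ℝ => (x₀, t))).intervalIntegrable _ _
  · exact (hF'.comp (by fun_prop : Continuous fun t : ℝ => (x₀, t))).aestronglyMeasurable
  · refine Filter.Eventually.of_forall fun t ht x hx => hC (x, t) ⟨hx, ?_⟩
    rw [uIoc_of_le zero_le_one] at ht
    exact ⟨ht.1.le, ht.2⟩
  · exact intervalIntegrable_const
  · refine Filter.Eventually.of_forall fun t _ x _ => ?_
    have h1 : HasFDerivAt F (fderiv ℝ F (x, t)) (x, t) :=
      (hF.differentiable (by simp) _).hasFDerivAt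
    exact h1.comp x (hasFDerivAt_prodMk_left x t)

/-- The integral over `[0, 1]` of a smooth function depends smoothly on parameters. -/
theorem contDiff_integral_param (n : ℕ) : ∀ {G : Type} [NormedAddCommGroup G] [NormedSpace ℝ G]
    {F : E × ℝ → G}, ContDiff ℝ ∞ F → ContDiff ℝ n (fun x => ∫ t in (0 : ℝ)..1, F (x, t)) := by
  induction n with
  | zero =>
    intro G _ _ F hF
    refine contDiff_zero.2 ?_
    have hd : Differentiable ℝ fun x => ∫ t in (0 : ℝ)..1, F (x, t) := fun x =>
      (hasFDerivAt_integral_param hF x).differentiableAt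
    exact hd.continuous
  | succ n ih =>
    intro G _ _ F hF
    push_cast
    refine contDiff_succ_iff_hasFDerivAt.2 ⟨fun x₀ => ∫ t in (0 : ℝ)..1,
      (fderiv ℝ F (x₀, t)).comp (ContinuousLinearMap.inl ℝ E ℝ), ?_,
      fun x => hasFDerivAt_integral_param hF x⟩
    refine ih (F := fun z => (fderiv ℝ F z).comp (ContinuousLinearMap.inl ℝ E ℝ)) ?_
    exact (hF.fderiv_right (m := ∞) (by simp)).clm_comp contDiff_const

variable {p : ℕ}

/-- Hadamard's lemma: a smooth function minus its value at `x₀` lies in the ideal generated by the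
functions `x i - x₀ i`. The coefficients are the averages of the partial derivatives over the
segments from `x₀`. -/
theorem exists_hadamard {k : EuclideanSpace ℝ (Fin p) → ℝ} (hk : ContDiff ℝ ∞ k)
    (x₀ : EuclideanSpace ℝ (Fin p)) :
    ∃ h : Fin p → EuclideanSpace ℝ (Fin p) → ℝ, (∀ i, ContDiff ℝ ∞ (h i)) ∧
      ∀ x, k x = k x₀ + ∑ i, (x i - x₀ i) * h i x := by
  let F (i : Fin p) (z : EuclideanSpace ℝ (Fin p) × ℝ) : ℝ :=
    fderiv ℝ k (x₀ + z.2 • (z.1 - x₀)) (EuclideanSpace.single i 1)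
  have hF (i) : ContDiff ℝ ∞ (F i) := by
    refine ContDiff.clm_apply ?_ contDiff_const
    exact (hk.fderiv_right (m := ∞) (by simp)).comp (by fun_prop)
  refine ⟨fun i x => ∫ t in (0 : ℝ)..1, F i (x, t),
    fun i => contDiff_infty.2 fun n => contDiff_integral_param n (hF i), fun x => ?_⟩
  have hd (t : ℝ) : HasDerivAt (fun t : ℝ => k (x₀ + t • (x - x₀)))
      (∑ i, (x i - x₀ i) * F i (x, t)) t := by
    have h1 : HasFDerivAt k (fderiv ℝ k (x₀ + t • (x - x₀))) (x₀ + t • (x - x₀)) :=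
      (hk.differentiable (by simp) _).hasFDerivAt
    have h2 : HasDerivAt (fun t : ℝ => x₀ + t • (x - x₀)) (x - x₀) t := by
      simpa using ((hasDerivAt_id t).smul_const (x - x₀)).const_add x₀
    have h3 := h1.comp_hasDerivAt t h2
    refine h3.congr_deriv ?_
    have h4 : x - x₀ = ∑ i, (x i - x₀ i) • EuclideanSpace.single i (1 : ℝ) := by
      ext j
      simp [Pi.single_apply]
    have h5 (L : EuclideanSpace ℝ (Fin p) →L[ℝ] ℝ) :
        L (x - x₀) = ∑ i, (x i - x₀ i) * L (EuclideanSpace.single i 1) := by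
      rw [h4]; simp only [map_sum, map_smul, smul_eq_mul]
    exact h5 _
  have h5 := intervalIntegral.integral_eq_sub_of_hasDerivAt (a := 0) (b := 1)
    (fun t _ => hd t) ?_
  · rw [intervalIntegral.integral_finsetSum] at h5
    · simp only [intervalIntegral.integral_const_mul] at h5
      simp only [one_smul, zero_smul, add_zero, add_sub_cancel] at h5
      rw [h5]; ring
    · intro i _
      exact (((hF i).continuous.comp (by fun_prop : Continuous fun t : ℝ => (x, t))).const_mul
        _).intervalIntegrable _ _
  · refine (continuous_finsetSum _ fun i _ => ?_).intervalIntegrable _ _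
    exact ((hF i).continuous.comp (by fun_prop : Continuous fun t : ℝ => (x, t))).const_mul _

end Hadamard

/-! ### Superdomains: coordinates and derivations -/

namespace superFun

open SuperAlgebra Grassmann

variable {p q : ℕ} {V : Opens (EuclideanSpace ℝ (Fin p))}

/-- The value of a superfunction at a point. -/
def ev (z : V) : superFun q V →ₐ[ℝ] Grassmann q :=
  (Pi.evalAlgHom ℝ _ z).comp (superFun q V).val

theorem ev_apply (z : V) (f : superFun q V) : ev z f = f.1 z := rfl

theorem ext_ev {f g : superFun q V} (h : ∀ z, ev z f = ev z g) : f = g :=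
  Subtype.ext (funext h)

theorem ev_parity (z : V) (f : superFun q V) : ev z (parity f) = Grassmann.parity q (ev z f) := rfl

instance : SuperAlgebra (superFun q V) where
  sigma :=
    { toFun := parity
      map_one' := ext_ev fun z => by rw [ev_parity, map_one, map_one]
      map_mul' := fun f g => ext_ev fun z => by
        rw [ev_parity, map_mul, map_mul, map_mul, ev_parity, ev_parity]
      map_zero' := ext_ev fun z => by rw [ev_parity, map_zero, map_zero]
      map_add' := fun f g => ext_ev fun z => by
        rw [ev_parity, map_add, map_add, map_add, ev_parity, ev_parity]
      commutes' := fun r => ext_ev fun z => by rw [ev_parity, AlgHom.commutes, AlgHom.commutes] }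
  sigma_sigma f := ext_ev fun z => sigma_sigma (ev z f)
  even_comm f g h := ext_ev fun z => by
    have := congrArg (ev z) h
    rw [map_mul, map_mul]
    exact SuperAlgebra.even_comm _ _ this
  odd_comm f g h := ext_ev fun z => by
    have := congrArg (ev z) h
    rw [map_neg] at this
    rw [map_mul, map_mul]
    exact SuperAlgebra.odd_comm _ _ this

theorem ev_sigma (z : V) (f : superFun q V) : ev z (sigma f) = sigma (ev z f) := rfl

theorem homog_iff {ε : ZMod 2} {f : superFun q V} : Homog ε f ↔ ∀ z, Homog ε (ev z f) := by
  constructor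
  · intro h z
    have := congrArg (ev z) h
    rwa [map_smul] at this
  · intro h
    refine ext_ev fun z => ?_
    rw [map_smul]; exact h z

theorem contDiffOn (f : superFun q V) : ContDiffOn ℝ ∞ (extendZero f.1) V := f.2

theorem differentiableAt (f : superFun q V) (z : V) :
    DifferentiableAt ℝ (extendZero f.1) z.1 :=
  ((contDiffOn f).contDiffAt (V.isOpen.mem_nhds z.2)).differentiableAt (by simp)

theorem ev_pderiv_inl (i : Fin p) (f : superFun q V) (z : V) :
    ev z (pderiv (.inl i) f) = fderiv ℝ (extendZero f.1) z.1 (EuclideanSpace.single i 1) := rfl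

theorem ev_pderiv_inr (j : Fin q) (f : superFun q V) (z : V) :
    ev z (pderiv (.inr j) f) = contr j (ev z f) := rfl

theorem extendZero_eventuallyEq {f : V → Grassmann q} {g : EuclideanSpace ℝ (Fin p) → Grassmann q}
    (h : ∀ z : V, f z = g z) (z : V) : extendZero f =ᶠ[nhds z.1] g := by
  filter_upwards [V.isOpen.mem_nhds z.2] with x hx
  rw [extendZero_apply f hx, h]

/-- The multiplication of `Λ_q` as a continuous bilinear map. -/
noncomputable def mulL (q : ℕ) : Grassmann q →L[ℝ] Grassmann q →L[ℝ] Grassmann q :=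
  LinearMap.toContinuousLinearMap
    ((LinearMap.toContinuousLinearMap (𝕜 := ℝ) (E := Grassmann q) (F' := Grassmann q)).toLinearMap
      ∘ₗ LinearMap.mul ℝ (Grassmann q))

theorem isDer_pderiv (a : Fin p ⊕ Fin q) :
    IsDer (indexParity a) (pderiv a : superFun q V →ₗ[ℝ] superFun q V) := by
  cases a with
  | inl i =>
    refine ⟨fun f g => ext_ev fun z => ?_, fun f => ext_ev fun z => ?_⟩
    · rw [show indexParity (Sum.inl i : Fin p ⊕ Fin q) = 0 from rfl, twist_zero, map_add,
        map_mul (ev z), map_mul (ev z), ev_pderiv_inl, ev_pderiv_inl, ev_pderiv_inl]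
      have e : extendZero (f * g).1 = fun x => mulL q (extendZero f.1 x) (extendZero g.1 x) := by
        funext x
        by_cases hx : x ∈ V
        · rw [extendZero_apply _ hx, extendZero_apply _ hx, extendZero_apply _ hx]; rfl
        · simp [extendZero, hx]
      rw [e, (mulL q).fderiv_of_bilinear (differentiableAt f z) (differentiableAt g z)]
      change extendZero f.1 z.1 * _ + _ * extendZero g.1 z.1 = _
      rw [extendZero_apply _ z.2, extendZero_apply _ z.2, add_comm]; rfl
    · rw [show indexParity (Sum.inl i : Fin p ⊕ Fin q) = 0 from rfl, paritySign_zero, one_smul,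
        ev_sigma, ev_pderiv_inl, ev_pderiv_inl]
      let L : Grassmann q →L[ℝ] Grassmann q :=
        LinearMap.toContinuousLinearMap (Grassmann.parity q).toLinearMap
      have e : extendZero (sigma f).1 = fun x => L (extendZero f.1 x) := by
        funext x
        by_cases hx : x ∈ V
        · rw [extendZero_apply _ hx, extendZero_apply _ hx]; rfl
        · simp [extendZero, hx]
      have h := L.hasFDerivAt.comp z.1 (differentiableAt f z).hasFDerivAt
      rw [e]
      have h2 := h.fderiv
      change fderiv ℝ (fun x => L (extendZero f.1 x)) z.1 = _ at h2
      rw [h2]; rfl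
  | inr j =>
    refine ⟨fun f g => ext_ev fun z => ?_, fun f => ext_ev fun z => ?_⟩
    · rw [map_add, map_mul (ev z), map_mul (ev z), ev_pderiv_inr, ev_pderiv_inr, ev_pderiv_inr,
        map_mul (ev z), (isDer_contr j).mul]
      rfl
    · rw [ev_sigma, ev_pderiv_inr, (isDer_contr j).par, map_smul, ev_pderiv_inr]
      rfl

theorem ev_coord_inl (i : Fin p) (z : V) :
    ev z (coord V (.inl i) : superFun q V) = algebraMap ℝ _ (z.1 i) := rfl

theorem ev_coord_inr (j : Fin q) (z : V) :
    ev z (coord V (.inr j) : superFun q V) = ExteriorAlgebra.ι ℝ (Pi.single j 1) := rfl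

theorem homog_coord (a : Fin p ⊕ Fin q) : Homog (indexParity a) (coord V a : superFun q V) := by
  rw [homog_iff]
  intro z
  cases a with
  | inl i =>
    exact homog_zero_iff.2 (AlgHom.commutes (Grassmann.parity q) _)
  | inr j => exact homog_ι _

theorem pderiv_coord (a b : Fin p ⊕ Fin q) :
    pderiv a (coord V b : superFun q V) = if a = b then 1 else 0 := by
  refine ext_ev fun z => ?_
  rw [apply_ite (ev z), map_one, map_zero]
  cases a with
  | inl i =>
    rw [ev_pderiv_inl]
    cases b with
    | inl k =>
      let L : EuclideanSpace ℝ (Fin p) →L[ℝ] Grassmann q := LinearMap.toContinuousLinearMap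
        ((Algebra.linearMap ℝ (Grassmann q)) ∘ₗ (EuclideanSpace.proj (𝕜 := ℝ) k).toLinearMap)
      have e := extendZero_eventuallyEq (f := (coord V (.inl k) : superFun q V).1) (g := L)
        (fun _ => rfl) z
      rw [e.fderiv_eq, L.fderiv]
      change algebraMap ℝ (Grassmann q) ((EuclideanSpace.single i (1 : ℝ) :
        EuclideanSpace ℝ (Fin p)) k) = _
      by_cases h : i = k
      · subst h; simp
      · simp [h]
    | inr k =>
      have e := extendZero_eventuallyEq (f := (coord V (.inr k) : superFun q V).1)
        (g := fun _ => ExteriorAlgebra.ι ℝ (Pi.single k 1)) (fun _ => rfl) z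
      rw [e.fderiv_eq]
      simp
  | inr j =>
    rw [ev_pderiv_inr]
    cases b with
    | inl k => rw [ev_coord_inl, contr_algebraMap]; simp
    | inr k =>
      rw [ev_coord_inr, contr_ι]
      by_cases h : j = k
      · subst h; simp
      · simp [h]

/-- A smooth real function, as a superfunction. -/
noncomputable def ofReal (g : EuclideanSpace ℝ (Fin p) → ℝ) (hg : ContDiffOn ℝ ∞ g V) :
    superFun q V :=
  ⟨fun z => algebraMap ℝ _ (g z.1), by
    let L : ℝ →L[ℝ] Grassmann q :=
      LinearMap.toContinuousLinearMap (Algebra.linearMap ℝ (Grassmann q))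
    refine (L.contDiff.comp_contDiffOn hg).congr fun x hx => ?_
    rw [extendZero_apply _ hx]; rfl⟩

theorem ev_ofReal (g : EuclideanSpace ℝ (Fin p) → ℝ) (hg : ContDiffOn ℝ ∞ g V) (z : V) :
    ev z (ofReal g hg : superFun q V) = algebraMap ℝ _ (g z.1) := rfl

theorem homog_ofReal (g : EuclideanSpace ℝ (Fin p) → ℝ) (hg : ContDiffOn ℝ ∞ g V) :
    Homog 0 (ofReal g hg : superFun q V) :=
  homog_iff.2 fun _ => homog_zero_iff.2 (AlgHom.commutes (Grassmann.parity q) _)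

/-- The constant superfunctions. -/
def const : Grassmann q →ₐ[ℝ] superFun q V where
  toFun a := ⟨fun _ => a, (contDiffOn_const (c := a)).congr fun x hx => by
    rw [extendZero_apply _ hx]⟩
  map_one' := rfl
  map_mul' _ _ := rfl
  map_zero' := rfl
  map_add' _ _ := rfl
  commutes' _ := rfl

theorem ev_const (a : Grassmann q) (z : V) : ev z (const a : superFun q V) = a := rfl

theorem eq_sum_coeff (f : superFun q V) (h : ∀ I, ContDiffOn ℝ ∞
      (fun x => Grassmann.coeff q (extendZero f.1 x) I) V) :
    f = ∑ I, ofReal (fun x => Grassmann.coeff q (extendZero f.1 x) I) (h I) *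
      const ((Grassmann.coeff q).symm (Pi.single I 1)) := by
  refine ext_ev fun z => ?_
  rw [map_sum]
  simp only [map_mul, ev_ofReal, ev_const, extendZero_apply _ z.2, ← Algebra.smul_def, ← map_smul,
    ← map_sum]
  rw [ev_apply]
  apply (Grassmann.coeff q).injective
  rw [LinearEquiv.apply_symm_apply]
  ext I
  simp [Finset.sum_apply, Pi.single_apply]

theorem contDiffOn_coeff (f : superFun q V) (I : Finset (Fin q)) :
    ContDiffOn ℝ ∞ (fun x => Grassmann.coeff q (extendZero f.1 x) I) V := by
  let L : Grassmann q →L[ℝ] ℝ := LinearMap.toContinuousLinearMap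
    (LinearMap.proj I ∘ₗ (Grassmann.coeff q).toLinearMap)
  exact L.contDiff.comp_contDiffOn (contDiffOn f)

section Rigid

variable {ε : ZMod 2} {Y : superFun q V →ₗ[ℝ] superFun q V}

theorem der_const_eq_zero (hY : IsDer ε Y) (h0 : ∀ a, Y (coord V a) = 0) (a : Grassmann q) :
    Y (const a) = 0 := by
  induction a using ExteriorAlgebra.induction with
  | algebraMap r =>
    rw [Algebra.algebraMap_eq_smul_one, map_smul, map_smul, map_one, hY.map_one, smul_zero]
  | ι v =>
    have hv : v = ∑ j, v j • (Pi.single j 1 : Fin q → ℝ) := by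
      ext j; simp [Finset.sum_apply, Pi.single_apply]
    rw [hv]
    simp only [map_sum, map_smul]
    refine Finset.sum_eq_zero fun j _ => ?_
    rw [show (const (ExteriorAlgebra.ι ℝ (Pi.single j 1)) : superFun q V) =
      coord V (.inr j) from rfl, h0, smul_zero]
  | mul x y hx hy => rw [map_mul, hY.mul, hx, hy, zero_mul, mul_zero, add_zero]
  | add x y hx hy => rw [map_add, map_add, hx, hy, add_zero]

/-- A derivation that kills the coordinates kills a globally smooth function. -/
theorem der_ofReal_global (hY : IsDer ε Y) (h0 : ∀ a, Y (coord V a) = 0)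
    {k : EuclideanSpace ℝ (Fin p) → ℝ} (hk : ContDiff ℝ ∞ k) :
    Y (ofReal k hk.contDiffOn) = 0 := by
  refine ext_ev fun z => ?_
  -- at the point `z`, Hadamard's lemma writes the function as a constant plus products of two
  -- factors, of which one vanishes at `z` and is killed by `Y`
  obtain ⟨h, hh, hkh⟩ := exists_hadamard hk z.1
  have e : (ofReal k hk.contDiffOn : superFun q V) = algebraMap ℝ _ (k z.1) +
      ∑ i, (coord V (.inl i) - algebraMap ℝ _ (z.1 i)) * ofReal (h i) (hh i).contDiffOn := by
    refine ext_ev fun y => ?_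
    rw [ev_ofReal, hkh, map_add, map_add, AlgHom.commutes, map_sum, map_sum]
    congr 1
    refine Finset.sum_congr rfl fun i _ => ?_
    rw [map_mul, map_mul, map_sub, map_sub, AlgHom.commutes, ev_coord_inl, ev_ofReal]
  have hc : ∀ r : ℝ, Y (algebraMap ℝ _ r) = 0 := fun r => by
    rw [Algebra.algebraMap_eq_smul_one, map_smul, hY.map_one, smul_zero]
  rw [e, map_add, hc, zero_add, map_sum, map_sum, map_zero]
  refine Finset.sum_eq_zero fun i _ => ?_
  have hhom : Homog 0 (coord V (.inl i) - algebraMap ℝ (superFun q V) (z.1 i)) :=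
    Homog.sub (homog_coord _) (homog_zero_iff.2 (AlgHom.commutes _ _))
  rw [hY.mul_homog hhom, map_sub, h0, hc, sub_zero, zero_mul, zero_add, map_smul, map_mul, map_sub,
    AlgHom.commutes, ev_coord_inl, sub_self, zero_mul, smul_zero]

/-- A derivation that kills the coordinates kills a smooth function: after multiplication with a
bump function, the function extends to the whole space. -/
theorem der_ofReal (hY : IsDer ε Y) (h0 : ∀ a, Y (coord V a) = 0)
    {g : EuclideanSpace ℝ (Fin p) → ℝ} (hg : ContDiffOn ℝ ∞ g V) :
    Y (ofReal g hg) = 0 := by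
  refine ext_ev fun z => ?_
  obtain ⟨r, hr, hrV⟩ := Metric.nhds_basis_closedBall.mem_iff.1 (V.isOpen.mem_nhds z.2)
  let χ : ContDiffBump z.1 := ⟨r / 2, r, half_pos hr, half_lt_self hr⟩
  have hχ : ContDiff ℝ ∞ (χ : EuclideanSpace ℝ (Fin p) → ℝ) := χ.contDiff
  have hk : ContDiff ℝ ∞ fun x => χ x * g x := by
    rw [contDiff_iff_contDiffAt]
    intro x
    by_cases hx : x ∈ V
    · exact hχ.contDiffAt.mul (hg.contDiffAt (V.isOpen.mem_nhds hx))
    · have hx' : x ∉ tsupport χ := by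
        rw [χ.tsupport_eq]
        exact fun h => hx (hrV h)
      have h1 : (fun x => χ x * g x) =ᶠ[nhds x] fun _ => 0 := by
        filter_upwards [notMem_tsupport_iff_eventuallyEq.1 hx'] with y hy
        rw [hy]; simp
      exact contDiffAt_const.congr_of_eventuallyEq h1
  have e : (ofReal _ hk.contDiffOn : superFun q V) = ofReal χ hχ.contDiffOn * ofReal g hg := by
    refine ext_ev fun y => ?_
    rw [map_mul, ev_ofReal, ev_ofReal, ev_ofReal, map_mul]
  have h1 := der_ofReal_global hY h0 hk
  rw [e, hY.mul_homog (homog_ofReal _ _), der_ofReal_global hY h0 hχ, zero_mul, zero_add,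
    mul_zero, paritySign_zero, one_smul] at h1
  have h2 := congrArg (ev z) h1
  rwa [map_mul, ev_ofReal, χ.one_of_mem_closedBall (by simpa using χ.rIn_pos.le), map_one, one_mul,
    map_zero] at h2

/-- A derivation of the algebra of superfunctions that kills the coordinates is zero. -/
theorem der_eq_zero (hY : IsDer ε Y) (h0 : ∀ a, Y (coord V a) = 0) : Y = 0 := by
  ext f : 1
  rw [eq_sum_coeff f (contDiffOn_coeff f), map_sum]
  refine Finset.sum_eq_zero fun I _ => ?_
  rw [hY.mul, der_ofReal hY h0, der_const_eq_zero hY h0, zero_mul, mul_zero, add_zero]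

end Rigid

/-- The standard coordinates of a superdomain. -/
noncomputable def coordSys : CoordSys (superFun q V) p q where
  x := coord V
  d := pderiv
  homog := homog_coord
  der := isDer_pderiv
  d_x := pderiv_coord
  rigid _ _ hD h := der_eq_zero hD h

end superFun

namespace superFun

open SuperAlgebra Grassmann

variable {p q : ℕ} {V : Opens (EuclideanSpace ℝ (Fin p))}

/-! ### Superdomains: units and real powers -/

/-- The body of a superfunction at a point. -/
noncomputable def bodyAt (z : V) : superFun q V →ₐ[ℝ] ℝ := (bodyHom q).comp (ev z)

theorem bodyAt_ofReal (g : EuclideanSpace ℝ (Fin p) → ℝ) (hg : ContDiffOn ℝ ∞ g V) (z : V) :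
    bodyAt z (ofReal g hg : superFun q V) = g z.1 :=
  AlgHom.commutes (bodyHom q) _

/-- The body of a superfunction, as a real function (zero outside the domain). -/
noncomputable def bodyFun (f : superFun q V) : EuclideanSpace ℝ (Fin p) → ℝ :=
  fun x => bodyHom q (extendZero f.1 x)

theorem bodyFun_apply (f : superFun q V) (z : V) : bodyFun f z.1 = bodyAt z f := by
  rw [bodyFun, extendZero_apply _ z.2]; rfl

theorem contDiffOn_bodyFun (f : superFun q V) : ContDiffOn ℝ ∞ (bodyFun f) V := by
  let L : Grassmann q →L[ℝ] ℝ := LinearMap.toContinuousLinearMap (bodyHom q).toLinearMap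
  exact L.contDiff.comp_contDiffOn (contDiffOn f)

theorem binomCoeff_eq (w : ℝ) {t : ℝ} (ht : t ≠ 0) (k : ℕ) :
    binomCoeff w t k = Ring.choose w k * Real.exp (Real.log t * w) * (t⁻¹) ^ k := by
  rw [binomCoeff, Real.rpow_def_of_pos (abs_pos.2 ht), Real.log_abs]

theorem hasDerivAt_binomCoeff (w : ℝ) {t : ℝ} (ht : t ≠ 0) (k : ℕ) :
    HasDerivAt (fun t => binomCoeff w t k) ((k + 1) * binomCoeff w t (k + 1)) t := by
  have h1 : (fun t => Ring.choose w k * Real.exp (Real.log t * w) * (t⁻¹) ^ k) =ᶠ[nhds t]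
      fun t => binomCoeff w t k := by
    filter_upwards [isOpen_ne.mem_nhds ht] with s hs
    exact (binomCoeff_eq w hs k).symm
  have h2 := ((((Real.hasDerivAt_log ht).mul_const w).exp.const_mul (Ring.choose w k)).mul
    ((hasDerivAt_inv ht).pow k)).congr_of_eventuallyEq h1.symm
  refine h2.congr_deriv ?_
  have h3 := choose_succ_mul w k
  have e : (k + 1) * binomCoeff w t (k + 1) =
      ((k + 1) * Ring.choose w (k + 1)) * Real.exp (Real.log t * w) * t⁻¹ ^ (k + 1) := by
    rw [binomCoeff_eq w ht]; ring
  rw [e, h3]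
  cases k with
  | zero => simp; field_simp
  | succ k =>
    simp only [Nat.add_sub_cancel, Pi.pow_apply]
    push_cast
    ring

theorem contDiffOn_binomCoeff (w : ℝ) (k : ℕ) {b : EuclideanSpace ℝ (Fin p) → ℝ}
    (hb : ContDiffOn ℝ ∞ b V) (h0 : ∀ x ∈ V, b x ≠ 0) :
    ContDiffOn ℝ ∞ (fun x => binomCoeff w (b x) k) V := by
  have h : ContDiffOn ℝ ∞ (fun x => Ring.choose w k * Real.exp (Real.log (b x) * w) *
      ((b x)⁻¹) ^ k) V :=
    (contDiffOn_const.mul ((hb.log h0).mul contDiffOn_const).exp).mul ((hb.inv h0).pow k)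
  exact h.congr fun x hx => binomCoeff_eq w (h0 x hx) k

theorem bodyFun_ne_zero {f : superFun q V} (h : ∀ z, bodyAt z f ≠ 0) :
    ∀ x ∈ V, bodyFun f x ≠ 0 := fun x hx => by
  rw [bodyFun_apply f ⟨x, hx⟩]; exact h _

/-- The nilpotent part of an even superfunction. -/
noncomputable def nilPart (f : evenSub (superFun q V)) : evenSub (superFun q V) :=
  f - ⟨ofReal (bodyFun f.1) (contDiffOn_bodyFun f.1), homog_zero_iff.1 (homog_ofReal _ _)⟩

theorem nilPart_pow (f : evenSub (superFun q V)) : nilPart f ^ (q + 1) = 0 := by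
  refine Subtype.ext (ext_ev fun z => ?_)
  rw [Subalgebra.coe_pow, map_pow]
  refine nilpotent_of_body_eq_zero ?_
  change bodyHom q (ev z (f.1 - ofReal (bodyFun f.1) (contDiffOn_bodyFun f.1))) = 0
  rw [map_sub, ev_ofReal, map_sub, AlgHom.commutes, bodyFun_apply]
  exact sub_self _

theorem isUnit_of_bodyAt_ne_zero {f : superFun q V} (hf : Homog 0 f)
    (h : ∀ z, bodyAt z f ≠ 0) : IsUnit f := by
  let f' : evenSub (superFun q V) := ⟨f, homog_zero_iff.1 hf⟩
  have h0 := bodyFun_ne_zero h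
  have h1 : IsUnit (ofReal (bodyFun f) (contDiffOn_bodyFun f) : superFun q V) := by
    have e : ∀ g g' : EuclideanSpace ℝ (Fin p) → ℝ, ∀ hg : ContDiffOn ℝ ∞ g V,
        ∀ hg' : ContDiffOn ℝ ∞ g' V, (∀ x ∈ V, g x * g' x = 1) →
        (ofReal g hg * ofReal g' hg' : superFun q V) = 1 := fun g g' hg hg' h => by
      refine ext_ev fun z => ?_
      rw [map_mul, ev_ofReal, ev_ofReal, ← map_mul, h z.1 z.2, map_one, map_one]
    exact isUnit_iff_exists.2 ⟨ofReal (fun x => (bodyFun f x)⁻¹)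
      ((contDiffOn_bodyFun f).inv h0), e _ _ _ _ fun x hx => mul_inv_cancel₀ (h0 x hx),
      e _ _ _ _ fun x hx => inv_mul_cancel₀ (h0 x hx)⟩
  have h2 : IsNilpotent (nilPart f' : superFun q V) :=
    ⟨q + 1, by rw [← Subalgebra.coe_pow, nilPart_pow]; rfl⟩
  have h3 := h2.isUnit_add_left_of_commute h1 (even_comm _ _ (homog_zero_iff.1 (homog_ofReal _ _)))
  have e : ofReal (bodyFun f) (contDiffOn_bodyFun f) + (nilPart f' : superFun q V) = f :=
    add_sub_cancel _ _
  rwa [e] at h3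

/-- The real power `|f|^w` of a superfunction with nonvanishing body. -/
noncomputable def absPow (w : ℝ) (f : superFun q V) (h : ∀ z, bodyAt z f ≠ 0) : superFun q V :=
  ((∑ k ∈ Finset.range (q + 1),
    ⟨ofReal _ (contDiffOn_binomCoeff w k (contDiffOn_bodyFun (SuperAlgebra.evenPart f).1)
      (bodyFun_ne_zero fun z => by
        have e : bodyAt z (SuperAlgebra.evenPart f).1 = bodyAt z f := by
          change bodyHom q (ev z ((1 / 2 : ℝ) • (f + sigma f))) = bodyHom q (ev z f)
          have e2 : bodyHom q (sigma (ev z f)) = bodyHom q (ev z f) := by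
            obtain ⟨b, c, hb, hc, e⟩ := exists_homog_add (ev z f)
            rw [e, map_add, map_add, map_add, homog_zero_iff.1 hb, homog_one_iff.1 hc, map_neg,
              bodyHom_of_odd hc, neg_zero]
          rw [map_smul, map_add, ev_sigma, map_smul, map_add, e2, smul_eq_mul]
          ring
        rw [e]; exact h z)), homog_zero_iff.1 (homog_ofReal _ _)⟩ *
      nilPart (SuperAlgebra.evenPart f) ^ k : evenSub (superFun q V)) : superFun q V)

theorem homog_absPow (w : ℝ) (f : superFun q V) (h : ∀ z, bodyAt z f ≠ 0) :
    Homog 0 (absPow w f h) := homog_coe _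

theorem ev_absPow (w : ℝ) {f : superFun q V} (hf : Homog 0 f) (h : ∀ z, bodyAt z f ≠ 0) (z : V) :
    ev z (absPow w f h) = absRpow w (Grassmann.evenPart (ev z f)) := by
  have e1 : (SuperAlgebra.evenPart f : superFun q V) = f := evenPart_coe_of_homog hf
  have e2 : (Grassmann.evenPart (ev z f) : Grassmann q) = ev z f :=
    coe_evenPart_of_homog (homog_iff.1 hf z)
  have e3 : Grassmann.body (Grassmann.evenPart (ev z f)) = bodyFun f z.1 := by
    rw [bodyFun_apply, body_eq, e2]; rfl
  rw [absRpow_eq, absPow, AddSubmonoidClass.coe_finsetSum, AddSubmonoidClass.coe_finsetSum, map_sum]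
  refine Finset.sum_congr rfl fun k _ => ?_
  rw [Subalgebra.coe_mul, Subalgebra.coe_mul, map_mul, Subalgebra.coe_pow, Subalgebra.coe_pow,
    map_pow, e3]
  have e4 : ev z (nilPart (SuperAlgebra.evenPart f) : superFun q V) =
      ((Grassmann.evenPart (ev z f) - algebraMap ℝ (even q) (bodyFun f z.1) : even q) :
        Grassmann q) := by
    change ev z ((SuperAlgebra.evenPart f).1 - ofReal (bodyFun (SuperAlgebra.evenPart f).1)
        (contDiffOn_bodyFun _)) =
      (Grassmann.evenPart (ev z f) : Grassmann q) - algebraMap ℝ (Grassmann q) (bodyFun f z.1)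
    rw [map_sub, ev_ofReal, e1, e2]
  rw [e4]
  congr 1
  change algebraMap ℝ (Grassmann q) (binomCoeff w (bodyFun (SuperAlgebra.evenPart f).1 z.1) k) =
    algebraMap ℝ (Grassmann q) _
  rw [e1]

/-- The chain rule for real functions. -/
theorem der_comp {ε : ZMod 2} {X : superFun q V →ₗ[ℝ] superFun q V} (hX : IsDer ε X)
    {φ φ' : ℝ → ℝ} {g : EuclideanSpace ℝ (Fin p) → ℝ} (hg : ContDiffOn ℝ ∞ g V)
    (hφg : ContDiffOn ℝ ∞ (fun x => φ (g x)) V) (hφ'g : ContDiffOn ℝ ∞ (fun x => φ' (g x)) V)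
    (hφ : ∀ x ∈ V, HasDerivAt φ (φ' (g x)) (g x)) :
    X (ofReal _ hφg) = ofReal _ hφ'g * X (ofReal g hg) := by
  have key : ∀ a, pderiv a (ofReal _ hφg : superFun q V) =
      ofReal _ hφ'g * pderiv a (ofReal g hg) := by
    intro a
    refine ext_ev fun z => ?_
    rw [map_mul]
    cases a with
    | inl i =>
      rw [ev_pderiv_inl, ev_pderiv_inl]
      let L : ℝ →L[ℝ] Grassmann q :=
        LinearMap.toContinuousLinearMap (Algebra.linearMap ℝ (Grassmann q))
      have hgz : HasFDerivAt g (fderiv ℝ g z.1) z.1 :=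
        (((hg.contDiffAt (V.isOpen.mem_nhds z.2))).differentiableAt (by simp)).hasFDerivAt
      have hr : ∀ (k : EuclideanSpace ℝ (Fin p) → ℝ) (k' : EuclideanSpace ℝ (Fin p) →L[ℝ] ℝ)
          (hk : ContDiffOn ℝ ∞ k V), HasFDerivAt k k' z.1 →
          fderiv ℝ (extendZero (ofReal k hk : superFun q V).1) z.1 = L.comp k' := by
        intro k k' hk h
        have e := extendZero_eventuallyEq (f := (ofReal k hk : superFun q V).1)
          (g := fun x => L (k x)) (fun _ => rfl) z
        rw [e.fderiv_eq]
        exact (L.hasFDerivAt.comp z.1 h).fderiv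
      rw [hr g _ hg hgz, hr _ _ hφg ((hφ z.1 z.2).comp_hasFDerivAt z.1 hgz), ev_ofReal]
      change algebraMap ℝ (Grassmann q) _ = algebraMap ℝ (Grassmann q) _ *
        algebraMap ℝ (Grassmann q) _
      rw [← map_mul]; rfl
    | inr j =>
      rw [ev_pderiv_inr, ev_pderiv_inr, ev_ofReal, ev_ofReal, ev_ofReal, contr_algebraMap,
        contr_algebraMap, mul_zero]
  rw [coordSys.expand hX, coordSys.expand hX (ofReal g hg), Finset.mul_sum]
  refine Finset.sum_congr rfl fun a _ => ?_
  change _ * pderiv a _ = _ * (_ * pderiv a _)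
  rw [key, ← mul_assoc, ← mul_assoc]
  congr 1
  exact even_comm _ _ (homog_zero_iff.1 (homog_ofReal _ _))

/-- The differential equation of the real power: `f X(|f|^w) = w |f|^w X f`. -/
theorem der_absPow {ε : ZMod 2} {X : superFun q V →ₗ[ℝ] superFun q V} (hX : IsDer ε X) (w : ℝ)
    {f : superFun q V} (hf : Homog 0 f) (h : ∀ z, bodyAt z f ≠ 0) :
    f * X (absPow w f h) = w • (absPow w f h * X f) := by
  have e1 : (SuperAlgebra.evenPart f : superFun q V) = f := evenPart_coe_of_homog hf
  have h' : ∀ z, bodyAt z (SuperAlgebra.evenPart f).1 ≠ 0 := by rwa [e1]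
  have h0 := bodyFun_ne_zero h'
  have hb := contDiffOn_bodyFun (SuperAlgebra.evenPart f).1
  have key := hX.binomial w q
    (fun k => ⟨ofReal _ (contDiffOn_binomCoeff w k hb h0), homog_zero_iff.1 (homog_ofReal _ _)⟩)
    ⟨ofReal _ hb, homog_zero_iff.1 (homog_ofReal _ _)⟩ (nilPart (SuperAlgebra.evenPart f))
    (nilPart_pow _)
    (fun k => by
      have hc : ContDiffOn ℝ ∞ (fun x => (k + 1 : ℝ) *
          binomCoeff w (bodyFun (SuperAlgebra.evenPart f).1 x) (k + 1)) V :=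
        contDiffOn_const.mul (contDiffOn_binomCoeff w (k + 1) hb h0)
      refine (der_comp hX (φ := fun t => binomCoeff w t k)
        (φ' := fun t => (k + 1 : ℝ) * binomCoeff w t (k + 1)) hb
        (contDiffOn_binomCoeff w k hb h0) hc fun x hx =>
          hasDerivAt_binomCoeff w (h0 x hx) k).trans ?_
      congr 1
      refine ext_ev fun z => ?_
      rw [map_smul, ev_ofReal, ev_ofReal, map_mul, ← Algebra.smul_def])
    (fun k => by
      refine Subtype.ext (ext_ev fun z => ?_)
      change ev z ((k + 1 : ℝ) • (ofReal _ (contDiffOn_binomCoeff w (k + 1) hb h0) *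
        ofReal _ hb)) = ev z ((w - k) • ofReal _ (contDiffOn_binomCoeff w k hb h0))
      rw [map_smul, map_smul, map_mul, ev_ofReal, ev_ofReal, ev_ofReal, Algebra.smul_def,
        Algebra.smul_def, ← map_mul, ← map_mul, ← map_mul, binomCoeff_succ_mul w (h0 z.1 z.2)])
  have e2 : (⟨ofReal _ hb, homog_zero_iff.1 (homog_ofReal _ _)⟩ : evenSub (superFun q V)) +
      nilPart (SuperAlgebra.evenPart f) = SuperAlgebra.evenPart f := add_sub_cancel _ _
  rw [e2] at key
  calc f * X (absPow w f h) = (SuperAlgebra.evenPart f).1 * X (absPow w f h) := by rw [e1]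
    _ = w • (absPow w f h * X (SuperAlgebra.evenPart f).1) := key
    _ = w • (absPow w f h * X f) := by rw [e1]

theorem absPow_mul (w : ℝ) {f g : superFun q V} (hf : Homog 0 f) (hg : Homog 0 g)
    (hf0 : ∀ z, bodyAt z f ≠ 0) (hg0 : ∀ z, bodyAt z g ≠ 0)
    (hfg : ∀ z, bodyAt z (f * g) ≠ 0) :
    absPow w (f * g) hfg = absPow w f hf0 * absPow w g hg0 := by
  refine ext_ev fun z => ?_
  have hfg' : Homog 0 (f * g) := by simpa using hf.mul hg
  have ef := coe_evenPart_of_homog (homog_iff.1 hf z)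
  have eg := coe_evenPart_of_homog (homog_iff.1 hg z)
  have e : Grassmann.evenPart (ev z (f * g)) =
      Grassmann.evenPart (ev z f) * Grassmann.evenPart (ev z g) := by
    apply Subtype.ext
    rw [coe_evenPart_of_homog (homog_iff.1 hfg' z), Subalgebra.coe_mul, ef, eg, map_mul]
  rw [map_mul, ev_absPow w hfg', ev_absPow w hf, ev_absPow w hg, e, absRpow_mul, Subalgebra.coe_mul]
  · rw [body_eq, ef]; exact hf0 z
  · rw [body_eq, eg]; exact hg0 z

theorem bodyAt_absPow (w : ℝ) {f : superFun q V} (hf : Homog 0 f) (h : ∀ z, bodyAt z f ≠ 0)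
    (z : V) :
    bodyAt z (absPow w f h) = |bodyAt z f| ^ w := by
  change bodyHom q (ev z _) = |bodyHom q (ev z f)| ^ w
  rw [ev_absPow w hf, ← body_eq, body_absRpow, body_eq, coe_evenPart_of_homog (homog_iff.1 hf z)]

theorem absPow_absPow_one (w : ℝ) {f : superFun q V} (hf : Homog 0 f) (h : ∀ z, bodyAt z f ≠ 0)
    (h1 : ∀ z, bodyAt z (absPow 1 f h) ≠ 0) : absPow w (absPow 1 f h) h1 = absPow w f h := by
  refine ext_ev fun z => ?_
  have ef := coe_evenPart_of_homog (homog_iff.1 hf z)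
  rw [ev_absPow w (homog_absPow _ _ _), ev_absPow w hf]
  have e : Grassmann.evenPart (ev z (absPow 1 f h)) =
      absRpow 1 (Grassmann.evenPart (ev z f)) := by
    apply Subtype.ext
    rw [coe_evenPart_of_homog (homog_iff.1 (homog_absPow _ _ _) z), ev_absPow 1 hf]
  rw [e, absRpow_absRpow_one]
  rw [body_eq, ef]; exact h z

/-- An even superfunction with nonvanishing body is determined by its body and its logarithmic
derivatives along the odd coordinates. -/
theorem eq_of_logDer {u v : superFun q V} (hu : Homog 0 u) (hv : Homog 0 v)
    (hv0 : ∀ z, bodyAt z v ≠ 0) (hb : ∀ z, bodyAt z u = bodyAt z v) (l : Fin q → superFun q V)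
    (hul : ∀ j, pderiv (.inr j) u = u * l j) (hvl : ∀ j, pderiv (.inr j) v = v * l j) : u = v := by
  refine ext_ev fun z => Grassmann.eq_of_logDer (homog_iff.1 hu z) (homog_iff.1 hv z) (hv0 z) (hb z)
    (fun j => ev z (l j)) (fun j => ?_) (fun j => ?_)
  · rw [← ev_pderiv_inr, hul, map_mul]
  · rw [← ev_pderiv_inr, hvl, map_mul]

section Berezinian

variable {m n : ℕ} {J K N P : Matrix (Fin m ⊕ Fin n) (Fin m ⊕ Fin n) (superFun q V)}

theorem isSuperMat_map_ev (hJ : IsSuperMat 0 J) (z : V) : IsSuperMat 0 (J.map (ev z)) :=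
  fun a b => homog_iff.1 (hJ a b) z

theorem map_ev_mul (h : J * K = 1) (z : V) : J.map (ev z) * K.map (ev z) = 1 := by
  rw [← Matrix.map_mul, h, Matrix.map_one _ (map_zero _) (map_one _)]

theorem ev_ber (hJ : IsSuperMat 0 J) (hK : IsSuperMat 0 K) (h : J * K = 1) (z : V) :
    ev z (ber J : superFun q V) = berezinian (J.map (ev z)) := by
  rw [coe_berezinian (isSuperMat_map_ev hJ z) (isSuperMat_map_ev hK z) (map_ev_mul h z)]
  exact ber_map (ev z) (ev_sigma z) (isUnit_det_berD hJ hK h)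

theorem ber_mul (hJ : IsSuperMat 0 J) (hK : IsSuperMat 0 K) (h : J * K = 1) (hKJ : K * J = 1)
    (hN : IsSuperMat 0 N) (hP : IsSuperMat 0 P) (h1 : N * P = 1) :
    ber (J * N) = ber J * ber N := by
  have hJN := hJ.mul hN
  have hPK := hP.mul hK
  rw [add_zero] at hJN hPK
  have h3 : J * N * (P * K) = 1 := by
    rw [Matrix.mul_assoc, ← Matrix.mul_assoc N, h1, Matrix.one_mul, h]
  refine Subtype.ext (ext_ev fun z => ?_)
  have e (J K : Matrix (Fin m ⊕ Fin n) (Fin m ⊕ Fin n) (superFun q V)) (hJ : IsSuperMat 0 J)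
      (hK : IsSuperMat 0 K) (h : J * K = 1) : ev z (ber J : superFun q V) =
        (ber (J.map (ev z)) : Grassmann q) :=
    ber_map (ev z) (ev_sigma z) (isUnit_det_berD hJ hK h)
  rw [Subalgebra.coe_mul, map_mul, e _ _ hJN hPK h3, e _ _ hJ hK h, e _ _ hN hP h1,
    Matrix.map_mul, Grassmann.ber_mul (isSuperMat_map_ev hJ z) (isSuperMat_map_ev hK z)
      (map_ev_mul h z) (map_ev_mul hKJ z) (isSuperMat_map_ev hN z) (isSuperMat_map_ev hP z)
      (map_ev_mul h1 z), Subalgebra.coe_mul]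

end Berezinian

end superFun

/-! ### Odd brackets and Laplace operators in coordinates -/

namespace SuperAlgebra

variable {A : Type*} [Ring A] [Algebra ℝ A] [SuperAlgebra A]

/-- An odd bracket that is antisymmetric with respect to shifted parity and a derivation in its
second argument. -/
structure IsOddBracket (br : A →ₗ[ℝ] A →ₗ[ℝ] A) : Prop where
  par : ∀ f g, sigma (br f g) = - br (sigma f) (sigma g)
  antisymm : ∀ {ε δ : ZMod 2} {f g : A}, Homog ε f → Homog δ g →
    br f g = - paritySign ((ε + 1) * (δ + 1)) • br g f
  leibniz : ∀ {ε δ : ZMod 2} {f g : A} (k : A), Homog ε f → Homog δ g →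
    br f (g * k) = br f g * k + paritySign ((ε + 1) * δ) • (g * br f k)

/-- The Hamiltonian derivation `X_f = (-1)^{ε + 1} {f, ·}`, for `f` of parity `ε`, extended linearly
to all `f`: `X_f = - {σ f, ·}` with the parity automorphism `σ`. -/
def ham (br : A →ₗ[ℝ] A →ₗ[ℝ] A) : A →ₗ[ℝ] A →ₗ[ℝ] A :=
  -(br ∘ₗ (sigma : A →ₐ[ℝ] A).toLinearMap)

variable {br : A →ₗ[ℝ] A →ₗ[ℝ] A} {ε δ : ZMod 2} {f g : A}

theorem ham_apply (f g : A) : ham br f g = - br (sigma f) g := rfl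

theorem ham_of_homog (hf : Homog ε f) : ham br f = paritySign (ε + 1) • br f := by
  ext g
  rw [ham_apply, show sigma f = paritySign ε • f from hf, ← Supermanifold.neg_paritySign, map_smul,
    LinearMap.smul_apply, LinearMap.smul_apply, neg_smul]

namespace IsOddBracket

theorem isDer_ham (hb : IsOddBracket br) (hf : Homog ε f) : IsDer (ε + 1) (ham br f) := by
  refine IsDer.of_homog (fun δ g k hg => ?_) (fun g => ?_)
  · rw [ham_of_homog hf]
    simp only [LinearMap.smul_apply, hb.leibniz k hf hg, smul_add, smul_mul_assoc, mul_smul_comm]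
    rw [smul_comm]
  · rw [ham_apply, ham_apply, map_neg, hb.par, sigma_sigma, show sigma f = paritySign ε • f from hf,
      map_smul, LinearMap.smul_apply, ← Supermanifold.neg_paritySign, smul_neg, neg_smul, neg_neg,
      smul_smul, paritySign_mul_self, one_smul, neg_neg]

theorem ham_symm (hb : IsOddBracket br) (hf : Homog ε f) (hg : Homog δ g) :
    ham br g f = paritySign (ε * δ) • ham br f g := by
  rw [ham_of_homog hf, ham_of_homog hg, LinearMap.smul_apply, LinearMap.smul_apply,
    hb.antisymm hg hf, Supermanifold.neg_paritySign, smul_smul, smul_smul, ← paritySign_add,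
    ← paritySign_add]
  have key : ∀ ε δ : ZMod 2, δ + 1 + ((δ + 1) * (ε + 1) + 1) = ε * δ + (ε + 1) := by decide
  rw [key]

/-- The bracket is a derivation in its first argument. -/
theorem mul_left (hb : IsOddBracket br) (hf : Homog ε f) (hg : Homog δ g) (k : A) :
    br (f * g) k = f * br g k + paritySign (ε * δ) • (g * br f k) := by
  refine congrArg (fun L : A →ₗ[ℝ] A => L k) (linearMap_ext (f := br (f * g))
    (g := LinearMap.mulLeft ℝ f ∘ₗ br g + paritySign (ε * δ) • (LinearMap.mulLeft ℝ g ∘ₗ br f))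
    fun γ k hk => ?_)
  have h1 : ∀ {ε δ : ZMod 2} {f g : A}, Homog ε f → Homog δ g → Homog (ε + 1 + δ) (br f g) := by
    intro ε δ f g hf hg
    have h := (hb.isDer_ham hf).homog hg
    rw [ham_of_homog hf] at h
    have h2 := h.smul (paritySign (ε + 1))
    rwa [LinearMap.smul_apply, smul_smul, paritySign_mul_self, one_smul] at h2
  simp only [LinearMap.add_apply, LinearMap.comp_apply, LinearMap.smul_apply,
    LinearMap.mulLeft_apply]
  rw [hb.antisymm (hf.mul hg) hk, hb.leibniz g hk hf, hb.antisymm hg hk, hb.antisymm hf hk,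
    (h1 hk hf).mul_comm hg, smul_add, mul_smul_comm, mul_smul_comm]
  simp only [Supermanifold.neg_paritySign, smul_smul, ← paritySign_add]
  have key1 : ∀ ε δ γ : ZMod 2, (ε + δ + 1) * (γ + 1) + 1 + (γ + 1 + ε) * δ =
    ε * δ + ((ε + 1) * (γ + 1) + 1) := by decide
  have key2 : ∀ ε δ γ : ZMod 2, (ε + δ + 1) * (γ + 1) + 1 + (γ + 1) * ε =
    (δ + 1) * (γ + 1) + 1 := by decide
  rw [key1, key2, add_comm]

theorem ham_mul (hb : IsOddBracket br) (hf : Homog ε f) (hg : Homog δ g) :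
    ham br (f * g) = paritySign ε • (LinearMap.mulLeft ℝ f ∘ₗ ham br g) +
      paritySign (δ + ε * δ) • (LinearMap.mulLeft ℝ g ∘ₗ ham br f) := by
  ext k
  rw [ham_of_homog (hf.mul hg), ham_of_homog hf, ham_of_homog hg]
  simp only [LinearMap.add_apply, LinearMap.comp_apply, LinearMap.smul_apply,
    LinearMap.mulLeft_apply, hb.mul_left hf hg, smul_add, mul_smul_comm, smul_smul,
    ← paritySign_add]
  have key : ∀ ε δ : ZMod 2, ε + δ + 1 + ε * δ = δ + ε * δ + (ε + 1) := by decide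
  rw [key, add_assoc]

end IsOddBracket

variable {p q : ℕ}

/-- The divergence of the Hamiltonian derivation of `f` with respect to the volume form with
coefficient `r` in the coordinates `S` (`r'` being the inverse of `r`), extended linearly to all
`f`. The sign `(-1)^{a ε}` in the coordinate divergence of a derivation of parity `ε + 1` is
absorbed by the twist of `f`. -/
def lap (S : CoordSys A p q) (br : A →ₗ[ℝ] A →ₗ[ℝ] A) (r r' : A) : A →ₗ[ℝ] A :=
  LinearMap.mulRight ℝ r' ∘ₗ (ham br).flip r +
    ∑ a, S.d a ∘ₗ (ham br).flip (S.x a) ∘ₗ (twist (indexParity a)).toLinearMap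

variable {S T : CoordSys A p q} {r r' : A}

theorem lap_of_homog (hf : Homog ε f) :
    lap S br r r' f = ham br f r * r' + S.div (ε + 1) (ham br f) := by
  have h : ∀ a, S.d a (ham br (twist (indexParity a) f) (S.x a)) =
      paritySign (indexParity a * (ε + 1 + 1)) • S.d a (ham br f (S.x a)) := fun a => by
    rw [hf.twist, map_smul, LinearMap.smul_apply, map_smul, CharTwo.add_add_self]
  simp only [lap, CoordSys.div, LinearMap.add_apply, LinearMap.comp_apply, LinearMap.sum_apply,
    LinearMap.flip_apply, AlgHom.toLinearMap_apply, h, LinearMap.mulRight_apply]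

theorem CoordSys.homog_div (S : CoordSys A p q) {D : A →ₗ[ℝ] A} (hD : IsDer ε D) :
    Homog ε (S.div ε D) := by
  refine Homog.sum _ fun a _ => Homog.smul ?_ _
  have h := (S.der a).homog (hD.homog (S.homog a))
  rwa [show indexParity a + (ε + indexParity a) = ε by
    rw [add_comm, CharTwo.add_add_self]] at h

theorem homog_lap (hb : IsOddBracket br) (hr : Homog 0 r) (hr' : Homog 0 r') (hf : Homog ε f) :
    Homog (ε + 1) (lap S br r r' f) := by
  rw [lap_of_homog hf]
  have h := ((hb.isDer_ham hf).homog hr).mul hr'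
  rw [add_zero, add_zero] at h
  exact h.add (S.homog_div (hb.isDer_ham hf))

/-- The Laplace operator is of second order: its deviation from the Leibniz rule is twice the
Hamiltonian derivation. One copy of `X_f g` comes from the divergence of `f X_g`, as `X_g f`, the
other one from the divergence of `g X_f`; they agree by the antisymmetry of the bracket. -/
theorem lap_mul (hb : IsOddBracket br) (hr : Homog 0 r) (hr' : Homog 0 r') (hf : Homog ε f)
    (g : A) :
    lap S br r r' (f * g) =
      lap S br r r' f * g + paritySign ε • (f * lap S br r r' g) + (2 : ℝ) • ham br f g := by
  refine congrArg (fun L : A →ₗ[ℝ] A => L g) (linearMap_ext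
    (f := lap S br r r' ∘ₗ LinearMap.mulLeft ℝ f)
    (g := LinearMap.mulLeft ℝ (lap S br r r' f) +
      paritySign ε • (LinearMap.mulLeft ℝ f ∘ₗ lap S br r r') + (2 : ℝ) • ham br f)
    fun δ g hg => ?_)
  simp only [LinearMap.add_apply, LinearMap.comp_apply, LinearMap.smul_apply,
    LinearMap.mulLeft_apply]
  have hdf := hb.isDer_ham hf
  have hdg := hb.isDer_ham hg
  have hdiv : S.div (ε + δ + 1) (ham br (f * g)) =
      paritySign ε • (f * S.div (δ + 1) (ham br g) + paritySign (ε * (δ + 1)) • ham br g f) +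
      paritySign (δ + ε * δ) •
        (g * S.div (ε + 1) (ham br f) + paritySign (δ * (ε + 1)) • ham br f g) := by
    rw [← S.div_mulLeft hf hdg, ← S.div_mulLeft hg hdf, hb.ham_mul hf hg, ← add_assoc,
      ← add_assoc, add_comm δ ε, CoordSys.div, CoordSys.div, CoordSys.div, Finset.smul_sum,
      Finset.smul_sum, ← Finset.sum_add_distrib]
    refine Finset.sum_congr rfl fun a _ => ?_
    simp only [LinearMap.add_apply, LinearMap.smul_apply, map_add, map_smul, smul_add, smul_smul,
      mul_comm]
  have hcomm := (homog_lap (S := S) hb hr hr' hf).mul_comm hg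
  rw [hcomm, lap_of_homog (hf.mul hg), hdiv, lap_of_homog hf, lap_of_homog hg, hb.ham_mul hf hg,
    hb.ham_symm hf hg]
  simp only [LinearMap.add_apply, LinearMap.comp_apply, LinearMap.smul_apply,
    LinearMap.mulLeft_apply, smul_add, smul_smul, ← paritySign_add, add_mul _ _ r', mul_add g,
    mul_add f, smul_mul_assoc, mul_assoc]
  have k1 : ∀ ε δ : ZMod 2, ε + (ε * (δ + 1) + ε * δ) = 0 := by decide
  have k2 : ∀ ε δ : ZMod 2, δ + ε * δ + δ * (ε + 1) = 0 := by decide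
  have k3 : ∀ ε δ : ZMod 2, δ + ε * δ = (ε + 1) * δ := by decide
  rw [k1, k2, k3, paritySign_zero, one_smul, two_smul]
  abel

/-- The Laplace operator does not depend on the coordinates: if the coefficients `r` and `s` of the
volume form differ by a factor `u` that satisfies the differential equation of the Berezinian of the
change of coordinates, then the derivative of `u` compensates the difference of the divergences. -/
theorem lap_congr (hb : IsOddBracket br) {u s s' : A} (hr : r = s * u) (hr' : r * r' = 1)
    (hr'e : Homog 0 r') (hs : Homog 0 s) (hs' : s * s' = 1)
    (h : ∀ (ε : ZMod 2) (X : A →ₗ[ℝ] A), IsDer ε X → X u = u * (T.div ε X - S.div ε X)) :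
    lap S br r r' = lap T br s s' := by
  refine linearMap_ext fun ε f hf => ?_
  have hd := hb.isDer_ham hf
  have e : u * r' = s' := by
    rw [hr, mul_assoc] at hr'
    have e2 : s' * s = 1 := by rw [even_comm s s' (homog_zero_iff.1 hs), hs']
    calc u * r' = s' * s * (u * r') := by rw [e2, one_mul]
      _ = s' := by rw [mul_assoc, hr', mul_one]
  rw [lap_of_homog hf, lap_of_homog hf, hr, hd.mul_homog hs, mul_zero, paritySign_zero, one_smul,
    h _ _ hd, add_mul, mul_assoc, e, mul_assoc s, mul_assoc u,
    even_comm r' _ (homog_zero_iff.1 hr'e), ← mul_assoc u, e, ← mul_assoc s, hs', one_mul,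
    add_assoc, sub_add_cancel]

end SuperAlgebra

/-! ### Operators with a prescribed supercommutator -/

namespace SuperAlgebra

variable {A : Type*} [Ring A] [Algebra ℝ A] [SuperAlgebra A]
variable {br : A →ₗ[ℝ] A →ₗ[ℝ] A} {L D : A →ₗ[ℝ] A} {ε δ : ZMod 2} {f g : A} {w : ℝ}

/-- The supercommutator of an operator and the multiplication by an element of parity `ε`. -/
def superBr (ε : ZMod 2) (D : A →ₗ[ℝ] A) (f : A) : A →ₗ[ℝ] A :=
  D ∘ₗ LinearMap.mulLeft ℝ f -
    LinearMap.mulLeft ℝ f ∘ₗ (twist ε).toLinearMap ∘ₗ D ∘ₗ (twist ε).toLinearMap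

theorem superBr_apply (ε : ZMod 2) (D : A →ₗ[ℝ] A) (f g : A) :
    superBr ε D f g = D (f * g) - f * twist ε (D (twist ε g)) := rfl

theorem superBr_add (ε : ZMod 2) (D E : A →ₗ[ℝ] A) (f : A) :
    superBr ε (D + E) f = superBr ε D f + superBr ε E f := by
  ext g
  simp only [superBr_apply, LinearMap.add_apply, map_add, mul_add]
  abel

theorem superBr_mulLeft (k : A) (hf : Homog ε f) :
    superBr ε (LinearMap.mulLeft ℝ k) f = 0 := by
  ext g
  rw [superBr_apply, LinearMap.mulLeft_apply, LinearMap.mulLeft_apply, map_mul, twist_twist,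
    ← mul_assoc, ← mul_assoc, hf.comm, sub_self, LinearMap.zero_apply]

theorem superBr_der {X : A →ₗ[ℝ] A} (hX : IsDer δ X) (hf : Homog ε f) :
    superBr ε X f = LinearMap.mulLeft ℝ (X f) := by
  ext g
  rw [superBr_apply, hX.mul_homog hf, hX.twist, twist_twist, mul_smul_comm, mul_comm ε δ,
    add_sub_cancel_right, LinearMap.mulLeft_apply]

/-- An odd operator whose deviation from the Leibniz rule is twice the bracket. -/
structure IsBVOperator (br : A →ₗ[ℝ] A →ₗ[ℝ] A) (L : A →ₗ[ℝ] A) : Prop where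
  par : ∀ f, sigma (L f) = - L (sigma f)
  mul : ∀ {ε : ZMod 2} {f : A} (g : A), Homog ε f →
    L (f * g) = L f * g + paritySign ε • (f * L g) + (2 : ℝ) • ham br f g

namespace IsBVOperator

theorem superBr_apply (hL : IsBVOperator br L) (hf : Homog ε f) (g : A) :
    superBr ε L f g = L f * g + (2 : ℝ) • ham br f g := by
  have h : twist ε (L (twist ε g)) = paritySign ε • L g := by
    rcases ZMod.two_cases ε with rfl | rfl
    · rw [twist_zero, twist_zero, paritySign_zero, one_smul]
    · rw [twist_one, twist_one, hL.par, sigma_sigma, paritySign_one, neg_one_smul]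
  rw [SuperAlgebra.superBr_apply, hL.mul g hf, h, mul_smul_comm, add_right_comm,
    add_sub_cancel_right]

/-- An operator on the coefficients of densities of weight `w` with the prescribed supercommutators
is `2 w L` up to a zeroth-order term, by evaluation at `1`. -/
theorem eq_of_superBr (hb : IsOddBracket br)
    (h : ∀ (ε : ZMod 2) (f g : A), Homog ε f →
      superBr ε D f g = (2 : ℝ) • (ham br f g + w • (L f * g))) :
    D = (2 * w) • L + LinearMap.mulLeft ℝ (D 1) := by
  refine linearMap_ext fun ε f hf => ?_
  have h1 := h ε f 1 hf
  rw [SuperAlgebra.superBr_apply, (hb.isDer_ham hf).map_one, map_one, mul_one, mul_one, zero_add,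
    smul_smul, sub_eq_iff_eq_add, ← hf.comm] at h1
  rw [h1]; rfl

/-- For `w ≠ 1/2` the bracket has to vanish. -/
theorem ham_eq_zero (hL : IsBVOperator br L) (hb : IsOddBracket br) (hw : w ≠ 1 / 2)
    (h : ∀ (ε : ZMod 2) (f g : A), Homog ε f →
      superBr ε D f g = (2 : ℝ) • (ham br f g + w • (L f * g))) : ham br = 0 := by
  refine linearMap_ext fun ε f hf => LinearMap.ext fun g => ?_
  have h1 := h ε f g hf
  have hs : superBr ε ((2 * w) • L) f g = (2 * w) • superBr ε L f g := by
    simp only [SuperAlgebra.superBr_apply, LinearMap.smul_apply, map_smul, smul_sub, mul_smul_comm]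
  rw [eq_of_superBr hb h, superBr_add, superBr_mulLeft _ hf, add_zero, hs,
    hL.superBr_apply hf] at h1
  have h2 : (4 * w - 2) • ham br f g = 0 := by
    have e : (4 * w - 2) • ham br f g = (2 * w) • (L f * g + (2 : ℝ) • ham br f g) -
      (2 : ℝ) • (ham br f g + w • (L f * g)) := by module
    rw [e, h1, sub_self]
  have h3 : 4 * w - 2 ≠ 0 := fun h => hw (by linarith)
  exact (smul_eq_zero.1 h2).resolve_left h3

/-- In weight `1/2`, the solutions are the operators `L + C`. -/
theorem superBr_iff (hL : IsBVOperator br L) (hb : IsOddBracket br) :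
    (∀ (ε : ZMod 2) (f g : A), Homog ε f →
      superBr ε D f g = (2 : ℝ) • (ham br f g + (1 / 2 : ℝ) • (L f * g))) ↔
    ∃ k, D = L + LinearMap.mulLeft ℝ k := by
  constructor
  · intro h
    have h1 := eq_of_superBr hb h
    rw [show (2 * (1 / 2) : ℝ) = 1 by norm_num, one_smul] at h1
    exact ⟨_, h1⟩
  · rintro ⟨k, rfl⟩ ε f g hf
    rw [superBr_add, superBr_mulLeft _ hf, add_zero, hL.superBr_apply hf]
    module

/-- The solutions are of order two. -/
theorem superBr_superBr_superBr (hL : IsBVOperator br L) (hb : IsOddBracket br) (k : A)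
    {γ : ZMod 2} {f' f'' : A} (hf : Homog ε f) (hf' : Homog δ f') (hf'' : Homog γ f'') :
    superBr γ (superBr δ (superBr ε (L + LinearMap.mulLeft ℝ k) f) f') f'' = 0 := by
  have e : superBr ε (L + LinearMap.mulLeft ℝ k) f =
      LinearMap.mulLeft ℝ (L f) + (2 : ℝ) • ham br f := by
    rw [superBr_add, superBr_mulLeft _ hf, add_zero]
    exact LinearMap.ext fun g => hL.superBr_apply hf g
  rw [e, superBr_add, superBr_mulLeft _ hf', zero_add, superBr_der ((hb.isDer_ham hf).smul 2) hf',
    superBr_mulLeft _ hf'']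

end IsBVOperator

end SuperAlgebra

/-! ### Sections of the structure sheaf -/

namespace SuperringedSpace

variable {X : SuperringedSpace.{u}}

/-- Sections that agree locally are equal. -/
theorem sec_ext {U : Opens X.body} {f g : X.Sec U}
    (h : ∀ x ∈ U, ∃ (V : Opens X.body) (hV : V ≤ U), x ∈ V ∧ X.res hV f = X.res hV g) : f = g := by
  choose V hV hx e using fun x : U => h x.1 x.2
  exact X.sheaf.eq_of_locally_eq' V U (fun x => homOfLE (hV x))
    (fun x hx' => Opens.mem_iSup.2 ⟨⟨x, hx'⟩, hx _⟩) f g (fun x => e x)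

/-- Gluing of sections. -/
theorem exists_glue {ι : Type*} (U : ι → Opens X.body) {V : Opens X.body} (hU : ∀ i, U i ≤ V)
    (hV : ∀ x ∈ V, ∃ i, x ∈ U i) (s : ∀ i, X.Sec (U i))
    (h : ∀ i j, X.res (inf_le_left : U i ⊓ U j ≤ U i) (s i) =
      X.res (inf_le_right : U i ⊓ U j ≤ U j) (s j)) :
    ∃ t : X.Sec V, ∀ i, X.res (hU i) t = s i := by
  obtain ⟨t, ht, -⟩ := X.sheaf.existsUnique_gluing' U V (fun i => homOfLE (hU i))
    (fun x hx => Opens.mem_iSup.2 (hV x hx)) s (fun i j => h i j)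
  exact ⟨t, fun i => ht i⟩

theorem parity_parity {U : Opens X.body} (f : X.Sec U) : X.parity U (X.parity U f) = f := by
  have h := congrArg (fun k => (k.1.app (op U)).hom f) X.parityHom_comp
  exact h

end SuperringedSpace

namespace SuperAlgebra

variable {A B : Type*} [Ring A] [Algebra ℝ A] [SuperAlgebra A] [Ring B] [Algebra ℝ B]
  [SuperAlgebra B] {ε : ZMod 2} {p q : ℕ}

theorem Homog.map {a : A} (ha : Homog ε a) {φ : A →ₐ[ℝ] B}
    (hφ : ∀ a, φ (sigma a) = sigma (φ a)) : Homog ε (φ a) := by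
  unfold Homog at *
  rw [← hφ, ha, map_smul]

theorem twist_map {φ : A →ₐ[ℝ] B} (hφ : ∀ a, φ (sigma a) = sigma (φ a)) (ε : ZMod 2) (a : A) :
    φ (twist ε a) = twist ε (φ a) := by
  rcases ZMod.two_cases ε with rfl | rfl
  · rw [twist_zero, twist_zero]
  · rw [twist_one, twist_one, hφ]

variable (e : A ≃ₐ[ℝ] B)

theorem symm_sigma (he : ∀ a, e (sigma a) = sigma (e a)) (b : B) :
    e.symm (sigma b) = sigma (e.symm b) := by
  apply e.injective
  rw [e.apply_symm_apply, he, e.apply_symm_apply]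

/-- Transport of derivations along an isomorphism. -/
theorem IsDer.conj (he : ∀ a, e (sigma a) = sigma (e a)) {D : B →ₗ[ℝ] B} (hD : IsDer ε D) :
    IsDer ε (e.symm.toLinearMap ∘ₗ D ∘ₗ e.toLinearMap) := by
  refine ⟨fun a b => ?_, fun a => ?_⟩
  · change e.symm (D (e (a * b))) = e.symm (D (e a)) * b + SuperAlgebra.twist ε a * e.symm (D (e b))
    have h : e.symm (SuperAlgebra.twist ε (e a)) = SuperAlgebra.twist ε (e.symm (e a)) :=
      twist_map (φ := (e.symm : B →ₐ[ℝ] A)) (symm_sigma e he) ε (e a)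
    rw [map_mul e, hD.mul, map_add e.symm, map_mul e.symm, map_mul e.symm, h, e.symm_apply_apply,
      e.symm_apply_apply]
  · change sigma (e.symm (D (e a))) = paritySign ε • e.symm (D (e (sigma a)))
    rw [← symm_sigma e he, hD.par, map_smul, he]

/-- Transport of coordinates along an isomorphism. -/
def CoordSys.transport (he : ∀ a, e (sigma a) = sigma (e a)) (S : CoordSys B p q) :
    CoordSys A p q where
  x a := e.symm (S.x a)
  d a := e.symm.toLinearMap ∘ₗ S.d a ∘ₗ e.toLinearMap
  homog a := (S.homog a).map (φ := (e.symm : B →ₐ[ℝ] A)) (symm_sigma e he)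
  der a := (S.der a).conj e he
  d_x a b := by
    change e.symm (S.d a (e (e.symm (S.x b)))) = _
    rw [e.apply_symm_apply, S.d_x, apply_ite e.symm, map_one, map_zero]
  rigid ε D hD h := by
    have h1 := S.rigid ε _ (hD.conj e.symm (symm_sigma e he)) fun a => by
      change e.symm.symm (D (e.symm (S.x a))) = 0
      rw [h, map_zero]
    ext a
    have h2 := congrArg (fun L : B →ₗ[ℝ] B => e.symm (L (e a))) h1
    change e.symm (e.symm.symm (D (e.symm (e a)))) = e.symm 0 at h2
    rwa [e.symm_apply_apply, map_zero, AlgEquiv.symm_symm, e.symm_apply_apply] at h2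

end SuperAlgebra

namespace superFun

variable {p q : ℕ} {V W : Opens (EuclideanSpace ℝ (Fin p))}

theorem ev_res (h : V ≤ W) (f : superFun q W) (z : V) : ev z (res h f) = ev ⟨z.1, h z.2⟩ f := rfl

theorem res_coord (h : V ≤ W) (a : Fin p ⊕ Fin q) :
    res h (coord W a : superFun q W) = coord V a := by
  cases a <;> rfl

theorem res_pderiv (h : V ≤ W) (a : Fin p ⊕ Fin q) (f : superFun q W) :
    res h (pderiv a f) = pderiv a (res h f) := by
  refine ext_ev fun z => ?_
  cases a with
  | inl i =>
    rw [ev_res, ev_pderiv_inl, ev_pderiv_inl]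
    have e : extendZero f.1 =ᶠ[nhds z.1] extendZero (res h f).1 := by
      filter_upwards [V.isOpen.mem_nhds z.2] with x hx
      rw [extendZero_apply _ hx, extendZero_apply _ (h hx)]; rfl
    rw [e.fderiv_eq]
  | inr j => rfl

end superFun

namespace SuperChart

variable {X : SuperringedSpace.{u}} {p q : ℕ} (c : SuperChart X p q) {U V : Opens X.body}

/-- The isomorphism of a chart on an open subset of its domain. -/
def isoOn (hU : U ≤ c.source) : X.Sec U ≃ₐ[ℝ] superFun q (chartImage c.φ U) := c.iso U hU

theorem isoOn_res (h : U ≤ V) (hV : V ≤ c.source) (f : X.Sec V) :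
    c.isoOn (h.trans hV) (X.res h f) = superFun.res (chartImage_mono c.φ h) (c.isoOn hV f) :=
  c.iso_res U V h (h.trans hV) hV f

theorem isoOn_parity (hU : U ≤ c.source) (f : X.Sec U) :
    c.isoOn hU (X.parity U f) = superFun.parity (c.isoOn hU f) := c.iso_parity U hU f

end SuperChart

namespace Supermanifold

open SuperAlgebra SuperringedSpace

variable {p q : ℕ} {M : Supermanifold.{u} p q} {U V : Opens M.body}

/-- An identity of sections may be checked in charts. -/
theorem ext_chart {f g : M.Sec U} (h : ∀ (c : M.Chart) (V : Opens M.body) (hV : V ≤ U),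
    V ≤ c.source → M.res hV f = M.res hV g) : f = g := by
  refine sec_ext fun x hx => ?_
  obtain ⟨c, hc⟩ := M.exists_chart x
  exact ⟨U ⊓ c.source, inf_le_left, ⟨hx, hc⟩, h c _ _ inf_le_right⟩

instance : SuperAlgebra (M.Sec U) where
  sigma := M.parity U
  sigma_sigma := parity_parity
  even_comm f g h := ext_chart fun c V hV hc => by
    apply (c.isoOn hc).injective
    have h' := congrArg (fun k => c.isoOn hc (M.res hV k)) h
    beta_reduce at h'
    rw [res_parity, c.isoOn_parity] at h'
    rw [map_mul, map_mul, map_mul, map_mul]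
    exact SuperAlgebra.even_comm _ _ h'
  odd_comm f g h := ext_chart fun c V hV hc => by
    apply (c.isoOn hc).injective
    have h' := congrArg (fun k => c.isoOn hc (M.res hV k)) h
    beta_reduce at h'
    rw [res_parity, c.isoOn_parity, map_neg, map_neg] at h'
    rw [map_mul, map_mul, map_mul, map_mul, res_parity, c.isoOn_parity]
    exact SuperAlgebra.odd_comm _ _ h'

theorem res_sigma (h : U ≤ V) (f : M.Sec V) : M.res h (sigma f) = sigma (M.res h f) :=
  res_parity h f

end Supermanifold

namespace SuperChart

open SuperAlgebra SuperringedSpace Supermanifold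

variable {p q : ℕ} {M : Supermanifold.{u} p q} (c c' : M.Chart) {U V : Opens M.body}

theorem isoOn_sigma (hU : U ≤ c.source) (f : M.Sec U) :
    c.isoOn hU (sigma f) = sigma (c.isoOn hU f) := c.isoOn_parity hU f

/-- The coordinates of a chart, on an open subset of its domain. -/
noncomputable def sys (hU : U ≤ c.source) : CoordSys (M.Sec U) p q :=
  superFun.coordSys.transport (c.isoOn hU) (c.isoOn_sigma hU)

theorem sys_x (hU : U ≤ c.source) (a : Fin p ⊕ Fin q) :
    (c.sys hU).x a = (c.isoOn hU).symm (superFun.coord _ a) := rfl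

theorem sys_d (hU : U ≤ c.source) (a : Fin p ⊕ Fin q) (f : M.Sec U) :
    (c.sys hU).d a f = (c.isoOn hU).symm (superFun.pderiv a (c.isoOn hU f)) := rfl

theorem res_sys_x (h : U ≤ V) (hV : V ≤ c.source) (a : Fin p ⊕ Fin q) :
    M.res h ((c.sys hV).x a) = (c.sys (h.trans hV)).x a := by
  apply (c.isoOn (h.trans hV)).injective
  rw [c.isoOn_res h hV, sys_x, sys_x, AlgEquiv.apply_symm_apply,
    AlgEquiv.apply_symm_apply, superFun.res_coord]

theorem res_sys_d (h : U ≤ V) (hV : V ≤ c.source) (a : Fin p ⊕ Fin q) (f : M.Sec V) :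
    M.res h ((c.sys hV).d a f) = (c.sys (h.trans hV)).d a (M.res h f) := by
  apply (c.isoOn (h.trans hV)).injective
  rw [c.isoOn_res h hV, sys_d, sys_d, AlgEquiv.apply_symm_apply,
    AlgEquiv.apply_symm_apply, superFun.res_pderiv, c.isoOn_res h hV]

end SuperChart

/-! ### Sections: values, real powers and the Berezinian of a change of charts -/

namespace superFun

open SuperAlgebra

variable {p q : ℕ} {V W : Opens (EuclideanSpace ℝ (Fin p))}

theorem res_absPow (h : V ≤ W) (w : ℝ) {f : superFun q W} (hf : Homog 0 f)
    (h0 : ∀ z, bodyAt z f ≠ 0) (h1 : ∀ z, bodyAt z (res h f) ≠ 0) :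
    res h (absPow w f h0) = absPow w (res h f) h1 := by
  refine ext_ev fun z => ?_
  have h2 : Homog 0 (res h f) := homog_iff.2 fun z => homog_iff.1 hf ⟨z.1, h z.2⟩
  rw [ev_res, ev_absPow w hf, ev_absPow w h2, ev_res]

end superFun

namespace SuperChart

open SuperAlgebra SuperringedSpace Supermanifold

variable {p q : ℕ} {M : Supermanifold.{u} p q} (c c' c'' : M.Chart) {U V : Opens M.body}

/-- The image of a point under a chart. -/
def pt (hU : U ≤ c.source) (x : U) : chartImage c.φ U :=
  ⟨c.φ x.1, c.φ.map_source (hU x.2), by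
    change c.φ.symm (c.φ x.1) ∈ U
    rw [c.φ.left_inv (hU x.2)]; exact x.2⟩

theorem exists_pt (hU : U ≤ c.source) (z : chartImage c.φ U) : ∃ x : U, c.pt hU x = z :=
  ⟨⟨c.φ.symm z.1, z.2.2⟩, Subtype.ext (c.φ.right_inv z.2.1)⟩

/-- The value of a section at a point, computed in a chart. -/
noncomputable def val (hU : U ≤ c.source) (x : U) : M.Sec U →ₐ[ℝ] ℝ :=
  (superFun.bodyAt (c.pt hU x)).comp (c.isoOn hU : M.Sec U →ₐ[ℝ] superFun q (chartImage c.φ U))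

theorem val_apply (hU : U ≤ c.source) (x : U) (f : M.Sec U) :
    c.val hU x f = superFun.bodyAt (c.pt hU x) (c.isoOn hU f) := rfl

theorem val_res (h : U ≤ V) (hV : V ≤ c.source) (x : U) (f : M.Sec V) :
    c.val (h.trans hV) x (M.res h f) = c.val hV ⟨x.1, h x.2⟩ f := by
  rw [val_apply, c.isoOn_res h hV]; rfl

theorem homog_isoOn (hU : U ≤ c.source) {ε : ZMod 2} {f : M.Sec U} (hf : Homog ε f) :
    Homog ε (c.isoOn hU f) :=
  hf.map (φ := (c.isoOn hU : M.Sec U →ₐ[ℝ] superFun q (chartImage c.φ U))) (c.isoOn_sigma hU)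

theorem homog_isoOn_symm (hU : U ≤ c.source) {ε : ZMod 2} {f : superFun q (chartImage c.φ U)}
    (hf : Homog ε f) : Homog ε ((c.isoOn hU).symm f) :=
  hf.map (φ := ((c.isoOn hU).symm : superFun q (chartImage c.φ U) →ₐ[ℝ] M.Sec U))
    (symm_sigma _ (c.isoOn_sigma hU))

theorem val_of_odd (hU : U ≤ c.source) (x : U) {f : M.Sec U} (hf : Homog 1 f) :
    c.val hU x f = 0 :=
  Grassmann.bodyHom_of_odd (superFun.homog_iff.1 (c.homog_isoOn hU hf) _)

theorem isUnit_of_val_ne_zero (hU : U ≤ c.source) {f : M.Sec U} (hf : Homog 0 f)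
    (h : ∀ x, c.val hU x f ≠ 0) : IsUnit f := by
  have h1 : IsUnit (c.isoOn hU f) :=
    superFun.isUnit_of_bodyAt_ne_zero (c.homog_isoOn hU hf) fun z => by
      obtain ⟨x, rfl⟩ := c.exists_pt hU z
      exact h x
  have h2 := h1.map (c.isoOn hU).symm
  rwa [AlgEquiv.symm_apply_apply] at h2

/-- The value of a section at a point does not depend on the chart: the number `t` is the value of
an even section `f` if and only if `f - t` is not invertible near the point. -/
theorem val_eq (hU : U ≤ c.source) (hU' : U ≤ c'.source) (x : U) (f : M.Sec U) :
    c.val hU x f = c'.val hU' x f := by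
  obtain ⟨b, d, hb, hd, rfl⟩ := exists_homog_add f
  rw [map_add, map_add, c.val_of_odd hU x hd, c'.val_of_odd hU' x hd, add_zero, add_zero]
  by_contra hne
  set t := c.val hU x b with ht
  -- `g` vanishes at `x` in the chart `c`, but is invertible near `x` according to `c'`
  let g : M.Sec U := b - algebraMap ℝ _ t
  have hg : Homog 0 g := hb.sub (homog_zero_iff.2 (AlgHom.commutes _ _))
  have hgx : c.val hU x g = 0 := by
    rw [map_sub, AlgHom.commutes, ← ht]; exact sub_self t
  have hgx' : c'.val hU' x g ≠ 0 := by
    rw [map_sub, AlgHom.commutes]; exact sub_ne_zero.2 (Ne.symm hne)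
  let N : Set (EuclideanSpace ℝ (Fin p)) :=
    chartImage c'.φ U ∩ superFun.bodyFun (c'.isoOn hU' g) ⁻¹' {0}ᶜ
  have hN : IsOpen N := (superFun.contDiffOn_bodyFun _).continuousOn.isOpen_inter_preimage
    (chartImage c'.φ U).isOpen isOpen_compl_singleton
  let W : Opens M.body := ⟨c'.φ.source ∩ c'.φ ⁻¹' N, c'.φ.isOpen_inter_preimage hN⟩
  have hW : W ≤ U := fun y hy => by
    have h1 : c'.φ.symm (c'.φ y) ∈ U := hy.2.1.2
    rwa [c'.φ.left_inv hy.1] at h1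
  have hxW : x.1 ∈ W := by
    refine ⟨hU' x.2, (c'.pt hU' x).2, ?_⟩
    rw [val_apply, ← superFun.bodyFun_apply] at hgx'
    exact hgx'
  have hu : IsUnit (M.res hW g) :=
    c'.isUnit_of_val_ne_zero (hW.trans hU') (hg.map (res_sigma hW)) fun y => by
      rw [c'.val_res hW hU', val_apply, ← superFun.bodyFun_apply]
      exact y.2.2.2
  have h2 := (hu.map (c.val (hW.trans hU) ⟨x.1, hxW⟩)).ne_zero
  rw [c.val_res hW hU] at h2
  exact h2 hgx

theorem bodyAt_isoOn_ne_zero (hU : U ≤ c.source) {f : M.Sec U} (hf : IsUnit f)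
    (z : chartImage c.φ U) : superFun.bodyAt z (c.isoOn hU f) ≠ 0 :=
  ((hf.map (c.isoOn hU)).map (superFun.bodyAt z)).ne_zero

/-- The real power `|f|^w` of an invertible even section, computed in a chart. -/
noncomputable def absPow (w : ℝ) (hU : U ≤ c.source) (f : M.Sec U) (hf : IsUnit f) : M.Sec U :=
  (c.isoOn hU).symm (superFun.absPow w (c.isoOn hU f) (c.bodyAt_isoOn_ne_zero hU hf))

theorem isoOn_absPow (w : ℝ) (hU : U ≤ c.source) (f : M.Sec U) (hf : IsUnit f) :
    c.isoOn hU (c.absPow w hU f hf) =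
      superFun.absPow w (c.isoOn hU f) (c.bodyAt_isoOn_ne_zero hU hf) :=
  AlgEquiv.apply_symm_apply _ _

theorem homog_absPow (w : ℝ) (hU : U ≤ c.source) (f : M.Sec U) (hf : IsUnit f) :
    Homog 0 (c.absPow w hU f hf) := c.homog_isoOn_symm hU (superFun.homog_absPow _ _ _)

variable {f g : M.Sec U}

theorem val_absPow (w : ℝ) (hU : U ≤ c.source) (h0 : Homog 0 f) (hf : IsUnit f) (x : U) :
    c.val hU x (c.absPow w hU f hf) = |c.val hU x f| ^ w := by
  rw [val_apply, isoOn_absPow, superFun.bodyAt_absPow w (c.homog_isoOn hU h0)]; rfl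

theorem isUnit_absPow (w : ℝ) (hU : U ≤ c.source) (h0 : Homog 0 f) (hf : IsUnit f) :
    IsUnit (c.absPow w hU f hf) :=
  c.isUnit_of_val_ne_zero hU (c.homog_absPow _ _ _ _) fun x => by
    rw [c.val_absPow w hU h0]
    exact (Real.rpow_pos_of_pos (abs_pos.2 (hf.map (c.val hU x)).ne_zero) w).ne'

theorem absPow_mul (w : ℝ) (hU : U ≤ c.source) (h0 : Homog 0 f) (hf : IsUnit f) (h0' : Homog 0 g)
    (hg : IsUnit g) :
    c.absPow w hU (f * g) (hf.mul hg) = c.absPow w hU f hf * c.absPow w hU g hg := by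
  apply (c.isoOn hU).injective
  rw [map_mul, isoOn_absPow, isoOn_absPow, isoOn_absPow]
  simp only [map_mul (c.isoOn hU) f g]
  exact superFun.absPow_mul w (c.homog_isoOn hU h0) (c.homog_isoOn hU h0') _ _ _

theorem absPow_absPow_one (w : ℝ) (hU : U ≤ c.source) (h0 : Homog 0 f) (hf : IsUnit f) :
    c.absPow w hU (c.absPow 1 hU f hf) (c.isUnit_absPow 1 hU h0 hf) = c.absPow w hU f hf := by
  apply (c.isoOn hU).injective
  simp only [isoOn_absPow]
  exact superFun.absPow_absPow_one w (c.homog_isoOn hU h0) _ _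

/-- The differential equation of the real power. -/
theorem der_absPow {ε : ZMod 2} {X : M.Sec U →ₗ[ℝ] M.Sec U} (hX : IsDer ε X) (w : ℝ)
    (hU : U ≤ c.source) (h0 : Homog 0 f) (hf : IsUnit f) :
    f * X (c.absPow w hU f hf) = w • (c.absPow w hU f hf * X f) := by
  have h := superFun.der_absPow (hX.conj (c.isoOn hU).symm (symm_sigma _ (c.isoOn_sigma hU))) w
    (c.homog_isoOn hU h0) (c.bodyAt_isoOn_ne_zero hU hf)
  apply (c.isoOn hU).injective
  rw [map_mul, map_smul, map_mul, isoOn_absPow]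
  refine h.trans ?_
  change w • (_ * c.isoOn hU (X ((c.isoOn hU).symm (c.isoOn hU f)))) = _
  rw [AlgEquiv.symm_apply_apply]

theorem res_absPow (h : U ≤ V) (w : ℝ) (hV : V ≤ c.source) {f : M.Sec V} (h0 : Homog 0 f)
    (hf : IsUnit f) :
    M.res h (c.absPow w hV f hf) = c.absPow w (h.trans hV) (M.res h f) (hf.map _) := by
  apply (c.isoOn (h.trans hV)).injective
  rw [c.isoOn_res h hV, isoOn_absPow, isoOn_absPow]
  simp only [c.isoOn_res h hV]
  exact superFun.res_absPow _ w (c.homog_isoOn hV h0) _ _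

/-- The real power does not depend on the chart: it is determined by its body and its logarithmic
derivatives. -/
theorem absPow_eq (w : ℝ) (hU : U ≤ c.source) (hU' : U ≤ c'.source) (h0 : Homog 0 f)
    (hf : IsUnit f) : c.absPow w hU f hf = c'.absPow w hU' f hf := by
  obtain ⟨g, hfg, hgf⟩ := isUnit_iff_exists.1 hf
  have key : ∀ (s : M.Sec U), Homog 0 s → ∀ {X : M.Sec U →ₗ[ℝ] M.Sec U},
      f * X s = w • (s * X f) → X s = s * (w • (g * X f)) := by
    intro s hs X h
    calc X s = g * (f * X s) := by rw [← mul_assoc, hgf, one_mul]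
      _ = s * (w • (g * X f)) := by
        rw [h, mul_smul_comm, mul_smul_comm, ← mul_assoc, ← mul_assoc,
          even_comm s g (homog_zero_iff.1 hs)]
  apply (c.isoOn hU).injective
  refine superFun.eq_of_logDer (c.homog_isoOn hU (c.homog_absPow _ _ _ _))
    (c.homog_isoOn hU (c'.homog_absPow _ _ _ _))
    (fun z => c.bodyAt_isoOn_ne_zero hU (c'.isUnit_absPow w hU' h0 hf) z) (fun z => ?_)
    (fun j => c.isoOn hU (w • (g * (c.sys hU).d (.inr j) f))) (fun j => ?_) (fun j => ?_)
  · obtain ⟨x, rfl⟩ := c.exists_pt hU z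
    rw [← val_apply, ← val_apply, c.val_absPow w hU h0, c.val_eq c' hU hU', c.val_eq c' hU hU',
      c'.val_absPow w hU' h0]
  · have h := key _ (c.homog_absPow w hU f hf)
      (c.der_absPow ((c.sys hU).der (.inr j)) w hU h0 hf)
    have h2 := congrArg (c.isoOn hU) h
    rwa [sys_d, AlgEquiv.apply_symm_apply, map_mul] at h2
  · have h := key _ (c'.homog_absPow w hU' f hf)
      (c'.der_absPow ((c.sys hU).der (.inr j)) w hU' h0 hf)
    have h2 := congrArg (c.isoOn hU) h
    rwa [sys_d, AlgEquiv.apply_symm_apply, map_mul] at h2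

/-- The Berezinian of the change of coordinates between two charts. -/
noncomputable def berJac (hU : U ≤ c.source) (hU' : U ≤ c'.source) : M.Sec U :=
  (ber ((c.sys hU).jac (c'.sys hU')) : evenSub (M.Sec U))

theorem homog_berJac (hU : U ≤ c.source) (hU' : U ≤ c'.source) : Homog 0 (c.berJac c' hU hU') :=
  homog_coe _

theorem isUnit_berJac (hU : U ≤ c.source) (hU' : U ≤ c'.source) : IsUnit (c.berJac c' hU hU') :=
  (isUnit_ber (CoordSys.isSuperMat_jac _ _) (CoordSys.isSuperMat_jac _ _)
    (CoordSys.jac_mul_jac _ _)).map (evenSub (M.Sec U)).val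

theorem isoOn_ber (hU : U ≤ c.source) {J K : Matrix (Fin p ⊕ Fin q) (Fin p ⊕ Fin q) (M.Sec U)}
    (hJ : IsSuperMat 0 J) (hK : IsSuperMat 0 K) (h : J * K = 1) :
    c.isoOn hU (ber J : M.Sec U) = (ber (J.map (c.isoOn hU)) : evenSub _) :=
  ber_map (c.isoOn hU : M.Sec U →ₐ[ℝ] superFun q (chartImage c.φ U)) (c.isoOn_sigma hU)
    (isUnit_det_berD hJ hK h)

theorem isSuperMat_isoOn (hU : U ≤ c.source)
    {J : Matrix (Fin p ⊕ Fin q) (Fin p ⊕ Fin q) (M.Sec U)} (hJ : IsSuperMat 0 J) :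
    IsSuperMat 0 (J.map (c.isoOn hU)) := fun a b => c.homog_isoOn hU (hJ a b)

theorem map_isoOn_mul (hU : U ≤ c.source)
    {J K : Matrix (Fin p ⊕ Fin q) (Fin p ⊕ Fin q) (M.Sec U)} (h : J * K = 1) :
    J.map (c.isoOn hU) * K.map (c.isoOn hU) = 1 := by
  rw [← Matrix.map_mul, h, Matrix.map_one _ (map_zero _) (map_one _)]

theorem berJac_mul (hU : U ≤ c.source) (hU' : U ≤ c'.source) (hU'' : U ≤ c''.source) :
    c.berJac c'' hU hU'' = c.berJac c' hU hU' * c'.berJac c'' hU' hU'' := by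
  have hJ := (c.sys hU).isSuperMat_jac (c'.sys hU')
  have hK := (c'.sys hU').isSuperMat_jac (c.sys hU)
  have hN := (c'.sys hU').isSuperMat_jac (c''.sys hU'')
  have hP := (c''.sys hU'').isSuperMat_jac (c'.sys hU')
  have hQ := (c.sys hU).isSuperMat_jac (c''.sys hU'')
  have hR := (c''.sys hU'').isSuperMat_jac (c.sys hU)
  have hJK := (c.sys hU).jac_mul_jac (c'.sys hU')
  have hKJ := (c'.sys hU').jac_mul_jac (c.sys hU)
  have hNP := (c'.sys hU').jac_mul_jac (c''.sys hU'')
  have hQR := (c.sys hU).jac_mul_jac (c''.sys hU'')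
  have h := superFun.ber_mul (c.isSuperMat_isoOn hU hJ) (c.isSuperMat_isoOn hU hK)
    (c.map_isoOn_mul hU hJK) (c.map_isoOn_mul hU hKJ) (c.isSuperMat_isoOn hU hN)
    (c.isSuperMat_isoOn hU hP) (c.map_isoOn_mul hU hNP)
  apply (c.isoOn hU).injective
  rw [berJac, berJac, berJac, map_mul, c.isoOn_ber hU hJ hK hJK, c.isoOn_ber hU hN hP hNP,
    c.isoOn_ber hU hQ hR hQR, ← Subalgebra.coe_mul, ← h, ← Matrix.map_mul, CoordSys.jac_mul]

theorem res_berJac (h : U ≤ V) (hV : V ≤ c.source) (hV' : V ≤ c'.source) :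
    M.res h (c.berJac c' hV hV') = c.berJac c' (h.trans hV) (h.trans hV') := by
  have e := ber_map (M.res h) (res_sigma h) (isUnit_det_berD
    ((c.sys hV).isSuperMat_jac (c'.sys hV')) ((c'.sys hV').isSuperMat_jac (c.sys hV))
    ((c.sys hV).jac_mul_jac (c'.sys hV')))
  rw [berJac, e, berJac]
  congr 2
  ext a b
  change M.res h ((c.sys hV).d a ((c'.sys hV').x b)) = (c.sys _).d a ((c'.sys _).x b)
  rw [c.res_sys_d h hV, c'.res_sys_x h hV']

/-- The factor `|Ber|^w` that relates the coefficients of a density of weight `w` in two charts. -/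
noncomputable def cocycle (w : ℝ) (hU : U ≤ c.source) (hU' : U ≤ c'.source) : M.Sec U :=
  c.absPow w hU (c.berJac c' hU hU') (c.isUnit_berJac c' hU hU')

theorem res_cocycle (w : ℝ) (h : U ≤ V) (hV : V ≤ c.source) (hV' : V ≤ c'.source) :
    M.res h (c.cocycle c' w hV hV') = c.cocycle c' w (h.trans hV) (h.trans hV') := by
  rw [cocycle, c.res_absPow h w hV (c.homog_berJac c' hV hV'), cocycle]
  simp only [c.res_berJac c' h hV hV']

theorem cocycle_mul (w : ℝ) (hU : U ≤ c.source) (hU' : U ≤ c'.source) (hU'' : U ≤ c''.source) :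
    c.cocycle c'' w hU hU'' = c.cocycle c' w hU hU' * c'.cocycle c'' w hU' hU'' := by
  rw [cocycle, cocycle, cocycle, ← c.absPow_eq c' w hU hU' (homog_berJac _ _ _ _),
    ← c.absPow_mul w hU (homog_berJac _ _ _ _) _ (homog_berJac _ _ _ _)]
  simp only [c.berJac_mul c' c'' hU hU' hU'']

theorem homog_cocycle (w : ℝ) (hU : U ≤ c.source) (hU' : U ≤ c'.source) :
    Homog 0 (c.cocycle c' w hU hU') := c.homog_absPow _ _ _ _

theorem jacobian_eq (z : chartImage c.φ (c.source ⊓ c'.source)) :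
    c.jacobian c' z = (((c.sys inf_le_left).jac (c'.sys inf_le_right)).map
      (c.isoOn inf_le_left)).map (superFun.ev z) := by
  ext a b
  change _ = superFun.ev z (c.isoOn _ ((c.sys _).d a ((c'.sys _).x b)))
  rw [sys_d, AlgEquiv.apply_symm_apply, ← c'.res_sys_x inf_le_right le_rfl]
  rfl

theorem absRpow_berezinian (w : ℝ) (z : chartImage c.φ (c.source ⊓ c'.source)) :
    (Grassmann.absRpow w (Grassmann.berezinian (c.jacobian c' z)) : Grassmann q) =
      superFun.ev z (c.isoOn inf_le_left (c.cocycle c' w inf_le_left inf_le_right)) := by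
  have hJ := (c.sys inf_le_left).isSuperMat_jac (c'.sys (inf_le_right : c.source ⊓ c'.source ≤ _))
  have hK := (c'.sys inf_le_right).isSuperMat_jac (c.sys (inf_le_left : c.source ⊓ c'.source ≤ _))
  have hJK := (c.sys inf_le_left).jac_mul_jac (c'.sys (inf_le_right : c.source ⊓ c'.source ≤ _))
  rw [cocycle, isoOn_absPow, superFun.ev_absPow w (c.homog_isoOn _ (c.homog_berJac c' _ _)),
    berJac, c.isoOn_ber _ hJ hK hJK, superFun.ev_ber (c.isSuperMat_isoOn _ hJ)
      (c.isSuperMat_isoOn _ hK) (c.map_isoOn_mul _ hJK), ← jacobian_eq]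
  congr 2
  apply Subtype.ext
  exact (Grassmann.coe_evenPart_of_homog (Grassmann.homog_coe_even _)).symm

end SuperChart

namespace Supermanifold

open SuperAlgebra SuperringedSpace

variable {p q : ℕ} {M : Supermanifold.{u} p q}

/-- The transformation law of densities, as an identity of sections over the overlap of charts. -/
theorem mem_density_iff {w : ℝ} {s : ∀ c : M.Chart, M.Sec c.source} :
    s ∈ M.density w ↔ ∀ c c' : M.Chart, M.res (inf_le_left : c.source ⊓ c'.source ≤ _) (s c) =
      M.res inf_le_right (s c') * c.cocycle c' w inf_le_left inf_le_right := by
  refine forall_congr' fun c => forall_congr' fun c' => ?_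
  simp only [c.absRpow_berezinian c' w]
  rw [← (c.isoOn inf_le_left).injective.eq_iff, map_mul]
  exact ⟨fun h => superFun.ext_ev h, fun h z => congrArg (superFun.ev z) h⟩

end Supermanifold

/-! ### The Laplace operator of a volume form -/

namespace SuperAlgebra

variable {A : Type*} [Ring A] [Algebra ℝ A] [SuperAlgebra A]

theorem homog_zero_of_mul_eq_one {a b : A} (ha : Homog 0 a) (hab : a * b = 1) (hba : b * a = 1) :
    Homog 0 b := by
  rw [homog_zero_iff] at *
  have h : sigma b * a = 1 := by rw [← ha, ← map_mul, hba, map_one]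
  calc sigma b = sigma b * a * b := by rw [mul_assoc, hab, mul_one]
    _ = b := by rw [h, one_mul]

theorem Homog.ringInverse {a : A} (ha : Homog 0 a) (hu : IsUnit a) : Homog 0 (Ring.inverse a) :=
  homog_zero_of_mul_eq_one ha (Ring.mul_inverse_cancel a hu) (Ring.inverse_mul_cancel a hu)

theorem isBVOperator_lap {p q : ℕ} {S : CoordSys A p q} {br : A →ₗ[ℝ] A →ₗ[ℝ] A} {r r' : A}
    (hb : IsOddBracket br) (hr : Homog 0 r) (hr' : Homog 0 r') :
    IsBVOperator br (lap S br r r') where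
  par f := by
    refine congrArg (fun L : A →ₗ[ℝ] A => L f) (linearMap_ext
      (f := (sigma : A →ₐ[ℝ] A).toLinearMap ∘ₗ lap S br r r')
      (g := -(lap S br r r' ∘ₗ (sigma : A →ₐ[ℝ] A).toLinearMap)) fun ε f hf => ?_)
    change sigma (lap S br r r' f) = - lap S br r r' (sigma f)
    rw [show sigma f = paritySign ε • f from hf, map_smul, ← neg_smul,
      Supermanifold.neg_paritySign]
    exact homog_lap hb hr hr' hf
  mul g hf := lap_mul hb hr hr' hf g

end SuperAlgebra

namespace Supermanifold

open SuperAlgebra SuperringedSpace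

variable {p q : ℕ} {M : Supermanifold.{u} p q} {U V : Opens M.body}

theorem fn_ext {f g : M.Fn}
    (h : ∀ c : M.Chart, M.res (le_top : c.source ≤ ⊤) f = M.res le_top g) : f = g :=
  ext_chart fun c V hV hc => by rw [← res_res hc le_top, h, res_res]

theorem VectorField.isDer {ε : ZMod 2} (X : M.VectorField ε) (U : Opens M.body) :
    IsDer ε (X.app U) :=
  IsDer.of_homog (X.app_mul U) (X.app_parity U)

theorem VectorField.coordDiv_eq {ε : ZMod 2} (X : M.VectorField ε) (c : M.Chart) :
    X.coordDiv c = (c.sys le_rfl).div ε (X.app c.source) := rfl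

/-- The Lie derivative of a density is unique. -/
theorem VectorField.IsLieDeriv.unique {ε : ZMod 2} {X : M.VectorField ε} {w : ℝ}
    {s t t' : M.Density w} (h : X.IsLieDeriv s t) (h' : X.IsLieDeriv s t') : t = t' :=
  Subtype.ext (funext fun c => (h c).trans (h' c).symm)

/-- The logarithmic derivative of `|Ber|`. -/
theorem der_cocycle_one (c c' : M.Chart) (hU : U ≤ c.source) (hU' : U ≤ c'.source) {ε : ZMod 2}
    {X : M.Sec U →ₗ[ℝ] M.Sec U} (hX : IsDer ε X) :
    X (c.cocycle c' 1 hU hU') =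
      c.cocycle c' 1 hU hU' * ((c'.sys hU').div ε X - (c.sys hU).div ε X) := by
  have h := c.der_absPow hX 1 hU (c.homog_berJac c' hU hU') (c.isUnit_berJac c' hU hU')
  have h2 : X (c.berJac c' hU hU') = _ := CoordSys.der_ber_jac (c.sys hU) (c'.sys hU') hX
  rw [h2, one_smul, ← mul_assoc, even_comm _ _ (homog_zero_iff.1 (homog_coe _)), mul_assoc] at h
  exact (c.isUnit_berJac c' hU hU').mul_left_cancel h

namespace OddPoisson

variable (P : M.OddPoisson)

theorem isOddBracket (U : Opens M.body) : IsOddBracket (P.bracket U) where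
  par := P.bracket_parity U
  antisymm hf hg := P.antisymm U _ _ _ _ hf hg
  leibniz k hf hg := P.leibniz U _ _ _ _ k hf hg

theorem hamiltonian_app {ε : ZMod 2} {f : M.Fn} (hf : IsHomog ε f) (U : Opens M.body) :
    (P.hamiltonian f hf).app U = ham (P.bracket U) (M.res le_top f) :=
  (ham_of_homog (hf.res le_top)).symm

theorem res_ham (h : U ≤ V) (f g : M.Sec V) :
    M.res h (ham (P.bracket V) f g) = ham (P.bracket U) (M.res h f) (M.res h g) := by
  rw [ham_apply, ham_apply, map_neg, ← P.bracket_res, res_sigma]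

theorem res_lap (h : U ≤ V) (c : M.Chart) (hV : V ≤ c.source) (r r' f : M.Sec V) :
    M.res h (lap (c.sys hV) (P.bracket V) r r' f) =
      lap (c.sys (h.trans hV)) (P.bracket U) (M.res h r) (M.res h r') (M.res h f) := by
  change M.res h (ham (P.bracket V) f r * r' + (∑ a, (c.sys hV).d a ∘ₗ (ham (P.bracket V)).flip
      ((c.sys hV).x a) ∘ₗ (twist (indexParity a)).toLinearMap : M.Sec V →ₗ[ℝ] M.Sec V) f) =
    ham (P.bracket U) (M.res h f) (M.res h r) * M.res h r' +
      (∑ a, (c.sys (h.trans hV)).d a ∘ₗ (ham (P.bracket U)).flip ((c.sys (h.trans hV)).x a) ∘ₗ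
        (twist (indexParity a)).toLinearMap : M.Sec U →ₗ[ℝ] M.Sec U) (M.res h f)
  rw [map_add, map_mul, P.res_ham, LinearMap.sum_apply, LinearMap.sum_apply, map_sum]
  congr 1
  refine Finset.sum_congr rfl fun a _ => ?_
  change M.res h ((c.sys hV).d a (ham (P.bracket V) (twist (indexParity a) f) ((c.sys hV).x a))) =
    (c.sys _).d a (ham (P.bracket U) (twist (indexParity a) (M.res h f)) ((c.sys _).x a))
  rw [c.res_sys_d h hV, P.res_ham, c.res_sys_x h hV, twist_map (res_sigma h)]

end OddPoisson

theorem IsBasisVolumeForm.homog {ρ : M.Density 1} (hρ : IsBasisVolumeForm ρ) (c : M.Chart) :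
    Homog 0 (ρ.1 c) :=
  homog_zero_iff.2 (congrFun (congrArg Subtype.val hρ.1) c)

namespace OddPoisson

variable (P : M.OddPoisson) {ρ : M.Density 1}

/-- The Laplace operator of a volume form in a chart. -/
noncomputable def chartLap (ρ : M.Density 1) (c : M.Chart) : M.Sec c.source →ₗ[ℝ] M.Sec c.source :=
  lap (c.sys le_rfl) (P.bracket c.source) (ρ.1 c) (Ring.inverse (ρ.1 c))

/-- The Laplace operators in the charts agree on overlaps. -/
theorem exists_laplacian (hρ : IsBasisVolumeForm ρ) (f : M.Fn) :
    ∃ g : M.Fn, ∀ c : M.Chart, M.res le_top g = P.chartLap ρ c (M.res le_top f) := by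
  refine exists_glue (fun c : M.Chart => c.source) (fun _ => le_top)
    (fun x _ => M.exists_chart x) (fun c => P.chartLap ρ c (M.res le_top f)) fun c c' => ?_
  have hi (c : M.Chart) {U : Opens M.body} (hU : U ≤ c.source) :
      M.res hU (ρ.1 c) * M.res hU (Ring.inverse (ρ.1 c)) = 1 := by
    rw [← map_mul, Ring.mul_inverse_cancel _ (hρ.2 c), map_one]
  rw [chartLap, chartLap, P.res_lap inf_le_left c le_rfl, P.res_lap inf_le_right c' le_rfl, res_res,
    res_res, lap_congr (P.isOddBracket _) (mem_density_iff.1 ρ.2 c c') (hi _ _)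
      (((hρ.homog c).ringInverse (hρ.2 c)).map (res_sigma _)) ((hρ.homog c').map (res_sigma _))
      (hi _ _) fun ε X hX => der_cocycle_one c c' _ _ hX]

/-- The Laplace operator `Δ_ρ` on functions, extended linearly to functions that are not
homogeneous. -/
noncomputable def laplacian (hρ : IsBasisVolumeForm ρ) : M.Fn →ₗ[ℝ] M.Fn where
  toFun f := (P.exists_laplacian hρ f).choose
  map_add' f g := fn_ext fun c => by
    rw [map_add, (P.exists_laplacian hρ _).choose_spec, (P.exists_laplacian hρ f).choose_spec,
      (P.exists_laplacian hρ g).choose_spec, map_add, map_add]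
  map_smul' r f := fn_ext fun c => by
    rw [map_smul, (P.exists_laplacian hρ _).choose_spec, (P.exists_laplacian hρ f).choose_spec,
      map_smul, map_smul, RingHom.id_apply]

theorem res_laplacian (hρ : IsBasisVolumeForm ρ) (f : M.Fn) (c : M.Chart) :
    M.res le_top (P.laplacian hρ f) = P.chartLap ρ c (M.res le_top f) :=
  (P.exists_laplacian hρ f).choose_spec c

theorem res_laplacian_of_homog (hρ : IsBasisVolumeForm ρ) {ε : ZMod 2} {f : M.Fn}
    (hf : IsHomog ε f) (c : M.Chart) : M.res le_top (P.laplacian hρ f) =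
      (P.hamiltonian f hf).app c.source (ρ.1 c) * Ring.inverse (ρ.1 c) +
        (P.hamiltonian f hf).coordDiv c := by
  rw [res_laplacian, VectorField.coordDiv_eq, hamiltonian_app]
  exact lap_of_homog (hf.res le_top)

theorem isBVOperator_laplacian (hρ : IsBasisVolumeForm ρ) :
    IsBVOperator (P.bracket ⊤) (P.laplacian hρ) := by
  have h (c : M.Chart) : IsBVOperator (P.bracket c.source) (P.chartLap ρ c) :=
    isBVOperator_lap (P.isOddBracket _) (hρ.homog c) ((hρ.homog c).ringInverse (hρ.2 c))
  refine ⟨fun f => fn_ext fun c => ?_, fun {ε f} g hf => fn_ext fun c => ?_⟩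
  · rw [res_sigma, res_laplacian, (h c).par, map_neg, res_laplacian, res_sigma]
  · rw [res_laplacian, map_mul, (h c).mul _ (hf.map (res_sigma _)), map_add, map_add, map_smul,
      map_smul, map_mul, map_mul, P.res_ham, res_laplacian, res_laplacian]

theorem isLaplacian_iff (hρ : IsBasisVolumeForm ρ) {ε : ZMod 2} {f : M.Fn} (hf : IsHomog ε f)
    (g : M.Fn) : P.IsLaplacian ρ f hf g ↔ g = P.laplacian hρ f := by
  have h : (P.hamiltonian f hf).IsLieDeriv ρ (P.laplacian hρ f • ρ) := fun c => by
    change M.res le_top (P.laplacian hρ f) * ρ.1 c = _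
    rw [P.res_laplacian_of_homog hρ hf, add_mul, mul_assoc, Ring.inverse_mul_cancel _ (hρ.2 c),
      mul_one, one_smul]
  refine ⟨fun hg => fn_ext fun c => ?_, fun hg => hg ▸ h⟩
  have e := congrFun (congrArg Subtype.val (VectorField.IsLieDeriv.unique hg h)) c
  exact (hρ.2 c).mul_right_cancel e

end OddPoisson

/-! ### Trivialisation of densities -/

section Trivialisation

variable {w : ℝ}

theorem smul_apply (f : M.Fn) (s : M.Density w) (c : M.Chart) :
    (f • s).1 c = M.res le_top f * s.1 c := rfl

theorem smul_left_injective {h : M.Density w} (hh : ∀ c, IsUnit (h.1 c)) {f g : M.Fn}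
    (e : f • h = g • h) : f = g :=
  fn_ext fun c => (hh c).mul_right_cancel (congrFun (congrArg Subtype.val e) c)

/-- A density is a multiple of every density with invertible coefficients. -/
theorem exists_eq_smul {h : M.Density w} (hh : ∀ c, IsUnit (h.1 c)) (s : M.Density w) :
    ∃ f : M.Fn, s = f • h := by
  obtain ⟨f, hf⟩ := exists_glue (fun c : M.Chart => c.source) (fun _ => le_top)
    (fun x _ => M.exists_chart x) (fun c => s.1 c * Ring.inverse (h.1 c)) fun c c' => by
      have e1 := mem_density_iff.1 s.2 c c'
      have e2 := mem_density_iff.1 h.2 c c'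
      have e3 : M.res (inf_le_left : c.source ⊓ c'.source ≤ _) (h.1 c) *
          M.res inf_le_left (Ring.inverse (h.1 c)) = 1 := by
        rw [← map_mul, Ring.mul_inverse_cancel _ (hh c), map_one]
      have e4 : M.res (inf_le_right : c.source ⊓ c'.source ≤ _) (Ring.inverse (h.1 c')) *
          M.res inf_le_right (h.1 c') = 1 := by
        rw [← map_mul, Ring.inverse_mul_cancel _ (hh c'), map_one]
      have e5 : c.cocycle c' w inf_le_left inf_le_right *
          M.res inf_le_left (Ring.inverse (h.1 c)) =
            M.res inf_le_right (Ring.inverse (h.1 c')) := by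
        rw [e2, mul_assoc] at e3
        rw [← one_mul (c.cocycle c' w inf_le_left inf_le_right), ← e4, mul_assoc, mul_assoc, e3,
          mul_one]
      rw [map_mul, map_mul, e1, mul_assoc, e5]
  refine ⟨f, Subtype.ext (funext fun c => ?_)⟩
  rw [smul_apply, hf c, mul_assoc, Ring.inverse_mul_cancel _ (hh c), mul_one]

/-- The identification of functions with densities that is given by a density with invertible
coefficients. -/
noncomputable def trivialisation {h : M.Density w} (hh : ∀ c, IsUnit (h.1 c)) :
    M.Fn ≃ₗ[ℝ] M.Density w :=
  LinearEquiv.ofBijective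
    { toFun := fun f => f • h
      map_add' := fun f g => add_smul f g h
      map_smul' := fun r f => Subtype.ext (funext fun c => by
        change M.res le_top (r • f) * h.1 c = r • (M.res le_top f * h.1 c)
        rw [map_smul, smul_mul_assoc]) }
    ⟨fun _ _ e => smul_left_injective hh e, fun s => by
      obtain ⟨f, hf⟩ := exists_eq_smul hh s
      exact ⟨f, hf.symm⟩⟩

theorem parity_smul {h : M.Density w} (hh : ∀ c, Homog 0 (h.1 c)) (f : M.Fn) :
    Density.parity (f • h) = sigma f • h := by
  refine Subtype.ext (funext fun c => ?_)
  change sigma (M.res le_top f * h.1 c) = M.res le_top (sigma f) * h.1 c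
  rw [map_mul, res_sigma, homog_zero_iff.1 (hh c)]

/-- The supercommutator with functions, in a trivialisation of the densities. -/
theorem superComm_smul {h : M.Density w} (hh : ∀ c, Homog 0 (h.1 c)) {Δ : M.Operator w}
    {D : M.Fn →ₗ[ℝ] M.Fn} (hD : ∀ g, Δ (g • h) = D g • h) (ε : ZMod 2) (f g : M.Fn) :
    Operator.superComm Δ ε f (g • h) = superBr ε D f g • h := by
  rw [superBr_apply, sub_smul, mul_smul, ← hD, mul_smul]
  change Δ (f • g • h) - f • (if ε = 0 then Δ else _) (g • h) = _
  congr 2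
  rcases ZMod.two_cases ε with rfl | rfl
  · rw [if_pos rfl, twist_zero, twist_zero, hD]
  · rw [if_neg one_ne_zero, twist_one, twist_one]
    change Density.parity (Δ (Density.parity (g • h))) = _
    rw [parity_smul hh, hD, parity_smul hh]

/-- The density `|ρ|^w` of a basis volume form `ρ`. -/
noncomputable def IsBasisVolumeForm.absPower {ρ : M.Density 1} (hρ : IsBasisVolumeForm ρ) (w : ℝ) :
    M.Density w :=
  ⟨fun c => c.absPow w le_rfl (ρ.1 c) (hρ.2 c), mem_density_iff.2 fun c c' => by
    have hU := (inf_le_right : c.source ⊓ c'.source ≤ c'.source)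
    have h1 := (hρ.homog c').map (res_sigma hU)
    rw [c.res_absPow _ _ _ (hρ.homog c), c'.res_absPow _ _ _ (hρ.homog c'),
      ← c.absPow_eq c' w inf_le_left _ h1]
    -- `ρ` transforms with `|Ber|`, and `||Ber||^w = |Ber|^w`
    have h2 := c.absPow_absPow_one w inf_le_left (c.homog_berJac c' inf_le_left hU)
      (c.isUnit_berJac c' inf_le_left hU)
    rw [SuperChart.cocycle, ← h2, ← c.absPow_mul w _ h1 _ (c.homog_absPow _ _ _ _)]
    simp only [mem_density_iff.1 ρ.2 c c', SuperChart.cocycle]⟩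

variable {ρ : M.Density 1} (hρ : IsBasisVolumeForm ρ)

theorem IsBasisVolumeForm.isAbsPower_absPower (w : ℝ) : IsAbsPower ρ w (hρ.absPower w) :=
  fun c z => by
    change superFun.ev z (c.isoOn le_rfl (c.absPow w le_rfl (ρ.1 c) (hρ.2 c))) = _
    rw [c.isoOn_absPow, superFun.ev_absPow w (c.homog_isoOn _ (hρ.homog c))]
    rfl

theorem IsBasisVolumeForm.isUnit_absPower (w : ℝ) (c : M.Chart) : IsUnit ((hρ.absPower w).1 c) :=
  c.isUnit_absPow _ _ (hρ.homog c) (hρ.2 c)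

theorem IsBasisVolumeForm.homog_absPower (w : ℝ) (c : M.Chart) : Homog 0 ((hρ.absPower w).1 c) :=
  c.homog_absPow _ _ _ (hρ.2 c)

/-- The Lie derivative `L_f (g |ρ|^w) = (X_f g + w (Δ_ρ f) g) |ρ|^w`. -/
theorem OddPoisson.isLieDeriv_smul_absPower (P : M.OddPoisson) (w : ℝ) {ε : ZMod 2} {f : M.Fn}
    (hf : IsHomog ε f) (g : M.Fn) : (P.hamiltonian f hf).IsLieDeriv (g • hρ.absPower w)
      ((ham (P.bracket ⊤) f g + w • (P.laplacian hρ f * g)) • hρ.absPower w) := fun c => by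
  have hd := (P.hamiltonian f hf).isDer c.source
  have hh := hρ.homog_absPower w c
  have hXr : (P.hamiltonian f hf).app c.source ((hρ.absPower w).1 c) =
      w • ((P.hamiltonian f hf).app c.source (ρ.1 c) * Ring.inverse (ρ.1 c) *
        (hρ.absPower w).1 c) := by
    have h := c.der_absPow hd w le_rfl (hρ.homog c) (hρ.2 c)
    apply (hρ.2 c).mul_left_cancel
    refine h.trans ?_
    rw [mul_smul_comm, ← mul_assoc, ← mul_assoc, ← even_comm _ _ (homog_zero_iff.1 (hρ.homog c)),
      mul_assoc ((P.hamiltonian f hf).app c.source (ρ.1 c)),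
      Ring.mul_inverse_cancel _ (hρ.2 c), mul_one]
    rw [even_comm _ _ (homog_zero_iff.1 hh)]
    rfl
  rw [smul_apply, smul_apply, map_add, P.res_ham, map_smul, map_mul,
    P.res_laplacian_of_homog hρ hf, hd.mul, hXr, ← P.hamiltonian_app hf]
  have hc : Homog (ε + 1) ((P.hamiltonian f hf).app c.source (ρ.1 c) * Ring.inverse (ρ.1 c)) := by
    have := (hd.homog (hρ.homog c)).mul ((hρ.homog c).ringInverse (hρ.2 c))
    rwa [add_zero, add_zero] at this
  rw [mul_smul_comm, ← mul_assoc (twist (ε + 1) (M.res le_top g)), hc.comm, twist_twist]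
  simp only [add_mul, smul_add, smul_mul_assoc, mul_assoc]
  abel

end Trivialisation

end Supermanifold

/-! ### Existence of a basis volume form -/

namespace SuperringedSpace

variable {X : SuperringedSpace.{u}}

theorem exists_glue_two {U V W : Opens X.body} (hU : U ≤ W) (hV : V ≤ W)
    (h : ∀ x ∈ W, x ∈ U ∨ x ∈ V) (s : X.Sec U) (t : X.Sec V)
    (hst : ∀ (Z : Opens X.body) (h : Z ≤ U) (h' : Z ≤ V), X.res h s = X.res h' t) :
    ∃ f : X.Sec W, X.res hU f = s ∧ X.res hV f = t := by
  let A : Bool → Opens X.body := fun b => if b then U else V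
  let σ : ∀ b, X.Sec (A b) := fun b => match b with
    | true => s
    | false => t
  have hA : ∀ b, A b ≤ W := fun b => match b with
    | true => hU
    | false => hV
  obtain ⟨f, hf⟩ := exists_glue A hA (fun x hx => (h x hx).elim (fun h => ⟨true, h⟩)
    fun h => ⟨false, h⟩) σ fun i j => match i, j with
      | true, true => rfl
      | false, false => rfl
      | true, false => hst _ inf_le_left inf_le_right
      | false, true => (hst _ inf_le_right inf_le_left).symm
  exact ⟨f, hf true, hf false⟩

theorem exists_finset_of_locallyFinite {ι : Type*} {B : ι → Set X.body} (hB : LocallyFinite B)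
    (U : Opens X.body) (x : X.body) (hx : x ∈ U) : ∃ (W : Opens X.body) (_ : W ≤ U)
      (F : Finset ι), x ∈ W ∧ ∀ i ∉ F, Disjoint (W : Set X.body) (B i) := by
  obtain ⟨t, ht, hfin⟩ := hB x
  obtain ⟨W, hWt, hW, hxW⟩ := mem_nhds_iff.1 ht
  refine ⟨⟨W, hW⟩ ⊓ U, inf_le_right, hfin.toFinset, ⟨hxW, hx⟩, fun i hi => ?_⟩
  rw [Set.disjoint_left]
  intro y hy hyB
  exact hi (hfin.mem_toFinset.2 ⟨y, hyB, hWt hy.1⟩)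

/-- The sum of a locally finite family of sections. -/
theorem exists_sum_of_locallyFinite {ι : Type*} {B : ι → Set X.body} (hB : LocallyFinite B)
    {U : Opens X.body} (s : ι → X.Sec U)
    (hs : ∀ (i : ι) (W : Opens X.body) (h : W ≤ U), Disjoint (W : Set X.body) (B i) →
      X.res h (s i) = 0) :
    ∃ t : X.Sec U, ∀ (W : Opens X.body) (h : W ≤ U) (F : Finset ι),
      (∀ i ∉ F, Disjoint (W : Set X.body) (B i)) → X.res h t = ∑ i ∈ F, X.res h (s i) := by
  classical
  have hFG (W : Opens X.body) (h : W ≤ U) (F G : Finset ι)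
      (hF : ∀ i ∉ F, Disjoint (W : Set X.body) (B i))
      (hG : ∀ i ∉ G, Disjoint (W : Set X.body) (B i)) :
      ∑ i ∈ F, X.res h (s i) = ∑ i ∈ G, X.res h (s i) := by
    rw [Finset.sum_subset (Finset.subset_union_left (s₂ := G)) fun i _ hi => hs i W h (hF i hi),
      Finset.sum_subset (Finset.subset_union_right (s₁ := F)) fun i _ hi => hs i W h (hG i hi)]
  choose W hW F hx hF using fun x : U => exists_finset_of_locallyFinite hB U x.1 x.2
  obtain ⟨t, ht⟩ := exists_glue W hW (fun x hx' => ⟨⟨x, hx'⟩, hx _⟩)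
    (fun x => ∑ i ∈ F x, X.res (hW x) (s i)) fun x y => by
      simp only [map_sum, res_res]
      exact hFG _ _ _ _ (fun i hi => (hF x i hi).mono_left fun z hz => hz.1)
        fun i hi => (hF y i hi).mono_left fun z hz => hz.2
  refine ⟨t, fun W' hW' F' hF' => sec_ext fun x hxW' => ?_⟩
  let y : U := ⟨x, hW' hxW'⟩
  refine ⟨W' ⊓ W y, inf_le_left, ⟨hxW', hx y⟩, ?_⟩
  rw [res_res, ← res_res inf_le_right (hW y), ht]
  simp only [map_sum, res_res]
  exact hFG _ _ _ _ (fun i hi => (hF y i hi).mono_left fun z hz => hz.2)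
    fun i hi => (hF' i hi).mono_left fun z hz => hz.1

end SuperringedSpace

namespace Supermanifold

open SuperAlgebra SuperringedSpace

variable {p q : ℕ} {M : Supermanifold.{u} p q}

/-- A coordinate ball. -/
def coordBall (c : M.Chart) (y : EuclideanSpace ℝ (Fin p)) (r : ℝ) : Set M.body :=
  c.φ.source ∩ c.φ ⁻¹' Metric.ball y r

/-- A density `β |Dx|` with a bump function `β` that is positive exactly on a coordinate ball,
extended by zero outside the chart. -/
theorem exists_bump_density (c₀ : M.Chart) (y : EuclideanSpace ℝ (Fin p)) {r : ℝ} (hr0 : 0 < r)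
    (hr : Metric.closedBall y r ⊆ c₀.φ.target) :
    ∃ η : M.Density 1, (∀ c, Homog 0 (η.1 c)) ∧
      (∀ (c : M.Chart) (W : Opens M.body) (h : W ≤ c.source),
        Disjoint (W : Set M.body) (coordBall c₀ y r) → M.res h (η.1 c) = 0) ∧
      (∀ (c : M.Chart) (x : c.source), 0 ≤ c.val le_rfl x (η.1 c)) ∧
      ∀ (c : M.Chart) (x : c.source), x.1 ∈ coordBall c₀ y r → 0 < c.val le_rfl x (η.1 c) := by
  have := M.t2
  -- the manifold is covered by the domain of `c₀` and the complement `N` of the closed ball `K`,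
  -- which is closed in the whole manifold since the latter is Hausdorff
  let K : Set M.body := c₀.φ.symm '' Metric.closedBall y r
  have hK : IsClosed K := ((isCompact_closedBall y r).image_of_continuousOn
    (c₀.φ.continuousOn_symm.mono hr)).isClosed
  have hKs (x) (hx : x ∈ K) : x ∈ c₀.source := by
    obtain ⟨z, hz, rfl⟩ := hx
    exact c₀.φ.map_target (hr hz)
  let N : Opens M.body := ⟨Kᶜ, hK.isOpen_compl⟩
  have hcov (x : M.body) : x ∈ c₀.source ∨ x ∈ N := by
    by_cases h : x ∈ K
    · exact Or.inl (hKs x h)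
    · exact Or.inr h
  have hNB : Disjoint (N : Set M.body) (coordBall c₀ y r) := by
    rw [Set.disjoint_left]
    intro x hx hxB
    exact hx ⟨c₀.φ x, Metric.ball_subset_closedBall hxB.2, c₀.φ.left_inv hxB.1⟩
  let b : EuclideanSpace ℝ (Fin p) → ℝ := fun z => expNegInvGlue (r ^ 2 - ‖z - y‖ ^ 2)
  have hb : ContDiff ℝ ∞ b := expNegInvGlue.contDiff.comp
    (contDiff_const.sub ((contDiff_norm_sq ℝ).comp (contDiff_id.sub contDiff_const)))
  have hb0 (z) (hz : z ∉ Metric.ball y r) : b z = 0 := by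
    rw [Metric.mem_ball, dist_eq_norm, not_lt] at hz
    refine expNegInvGlue.zero_of_nonpos ?_
    nlinarith
  have hb1 (z) (hz : z ∈ Metric.ball y r) : 0 < b z := by
    rw [Metric.mem_ball, dist_eq_norm] at hz
    refine expNegInvGlue.pos_of_pos ?_
    nlinarith [norm_nonneg (z - y)]
  let β : M.Sec c₀.source := (c₀.isoOn le_rfl).symm (superFun.ofReal b hb.contDiffOn)
  have hβ : Homog 0 β := c₀.homog_isoOn_symm _ (superFun.homog_ofReal _ _)
  have hβval (x : c₀.source) : c₀.val le_rfl x β = b (c₀.φ x.1) := by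
    rw [SuperChart.val_apply, AlgEquiv.apply_symm_apply, superFun.bodyAt_ofReal]; rfl
  have hβ0 (W : Opens M.body) (h : W ≤ c₀.source)
      (hW : Disjoint (W : Set M.body) (coordBall c₀ y r)) : M.res h β = 0 := by
    apply (c₀.isoOn h).injective
    rw [map_zero]
    refine superFun.ext_ev fun z => ?_
    obtain ⟨x, rfl⟩ := c₀.exists_pt h z
    have e := c₀.isoOn_res h le_rfl β
    rw [AlgEquiv.apply_symm_apply] at e
    refine (congrArg (superFun.ev (c₀.pt h x)) e).trans ?_
    rw [superFun.ev_res, superFun.ev_ofReal, map_zero]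
    have hx : c₀.φ x.1 ∉ Metric.ball y r := fun hx =>
      Set.disjoint_left.1 hW x.2 ⟨h x.2, hx⟩
    exact (congrArg _ (hb0 _ hx)).trans (map_zero _)
  -- in the chart `c`, the density is `β |Ber|` on the domain of `c₀` and zero on `N`
  have hglue (c : M.Chart) := exists_glue_two (X := M.toSuperringedSpace)
    (inf_le_left : c.source ⊓ c₀.source ≤ c.source) (inf_le_left : c.source ⊓ N ≤ c.source)
    (fun x hx => (hcov x).imp (fun h => ⟨hx, h⟩) fun h => ⟨hx, h⟩)
    (M.res inf_le_right β * c.cocycle c₀ 1 inf_le_left inf_le_right) 0 fun Z h h' => by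
      rw [map_mul, res_res, hβ0 Z (h.trans inf_le_right) (hNB.mono_left fun z hz => (h' hz).2),
        zero_mul, map_zero]
  choose η h1 h2 using hglue
  have h1' (c : M.Chart) (V : Opens M.body) (h : V ≤ c.source) (h0 : V ≤ c₀.source) :
      M.res h (η c) = M.res h0 β * c.cocycle c₀ 1 h h0 := by
    rw [← res_res (le_inf h h0) inf_le_left, h1, map_mul, res_res, SuperChart.res_cocycle]
  have h2' (c : M.Chart) (V : Opens M.body) (h : V ≤ c.source) (h0 : V ≤ N) :
      M.res h (η c) = 0 := by
    rw [← res_res (le_inf h h0) inf_le_left, h2, map_zero]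
  refine ⟨⟨η, mem_density_iff.2 fun c c' => sec_ext fun x hx => ?_⟩,
    fun c => homog_zero_iff.2 (sec_ext fun x hx => ?_), fun c W h hW => sec_ext fun x hx => ?_,
    fun c x => ?_, fun c x hx => ?_⟩
  -- the transformation law
  · rcases hcov x with h | h
    · refine ⟨c.source ⊓ c'.source ⊓ c₀.source, inf_le_left, ⟨hx, h⟩, ?_⟩
      rw [map_mul, res_res, res_res, h1' c _ _ inf_le_right, h1' c' _ _ inf_le_right,
        SuperChart.res_cocycle, c.cocycle_mul c' c₀ 1 _ (inf_le_left.trans inf_le_right),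
        mul_assoc, even_comm _ _ (homog_zero_iff.1 (c.homog_cocycle c' 1 _ _))]
    · refine ⟨c.source ⊓ c'.source ⊓ N, inf_le_left, ⟨hx, h⟩, ?_⟩
      rw [map_mul, res_res, res_res, h2' c _ _ inf_le_right, h2' c' _ _ inf_le_right, zero_mul]
  -- evenness
  · rcases hcov x with h | h
    · refine ⟨c.source ⊓ c₀.source, inf_le_left, ⟨hx, h⟩, ?_⟩
      rw [res_sigma, h1' c _ _ inf_le_right, map_mul, ← res_sigma, homog_zero_iff.1 hβ,
        homog_zero_iff.1 (c.homog_cocycle c₀ 1 _ _)]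
    · refine ⟨c.source ⊓ N, inf_le_left, ⟨hx, h⟩, ?_⟩
      rw [res_sigma, h2' c _ _ inf_le_right, map_zero]
  -- vanishing away from the ball
  · rcases hcov x with h' | h'
    · refine ⟨W ⊓ c₀.source, inf_le_left, ⟨hx, h'⟩, ?_⟩
      rw [res_res, h1' c _ _ inf_le_right, hβ0 (W ⊓ c₀.source) _ (hW.mono_left fun z hz => hz.1),
        zero_mul, map_zero]
    · refine ⟨W ⊓ N, inf_le_left, ⟨hx, h'⟩, ?_⟩
      rw [res_res, h2' c _ _ inf_le_right, map_zero]
  -- the body on the domain of `c₀` is the bump function times the absolute value of a Berezinian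
  all_goals
    have hval (h : x.1 ∈ c₀.source) : c.val le_rfl x (η c) =
        b (c₀.φ x.1) * |c.val (inf_le_left : c.source ⊓ c₀.source ≤ _) ⟨x.1, x.2, h⟩
          (c.berJac c₀ inf_le_left inf_le_right)| := by
      have e := c.val_res (inf_le_left : c.source ⊓ c₀.source ≤ _) le_rfl ⟨x.1, x.2, h⟩ (η c)
      rw [h1, map_mul, c.val_eq c₀ _ inf_le_right, c₀.val_res inf_le_right le_rfl, hβval,
        SuperChart.cocycle, c.val_absPow 1 _ (c.homog_berJac c₀ _ _), Real.rpow_one] at e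
      exact e.symm
  · rcases hcov x with h | h
    · change 0 ≤ c.val le_rfl x (η c)
      rw [hval h]
      exact mul_nonneg (expNegInvGlue.nonneg _) (abs_nonneg _)
    · have e := c.val_res (inf_le_left : c.source ⊓ N ≤ _) le_rfl ⟨x.1, x.2, h⟩ (η c)
      rw [h2, map_zero] at e
      exact e.le
  · change 0 < c.val le_rfl x (η c)
    rw [hval hx.1]
    exact mul_pos (hb1 _ hx.2)
      (abs_pos.2 ((c.isUnit_berJac c₀ _ _).map (c.val inf_le_left _)).ne_zero)

/-- The sum of a locally finite family of even nonnegative densities, one of which is positive at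
each point, is a basis volume form. -/
theorem isBasisVolumeForm_of_locallyFinite {ι : Type*} {B : ι → Set M.body} (hB : LocallyFinite B)
    (hcov : ∀ x, ∃ i, x ∈ B i) (η : ι → M.Density 1) (he : ∀ i c, Homog 0 ((η i).1 c))
    (hs : ∀ (i : ι) (c : M.Chart) (W : Opens M.body) (h : W ≤ c.source),
      Disjoint (W : Set M.body) (B i) → M.res h ((η i).1 c) = 0)
    (hn : ∀ (i : ι) (c : M.Chart) (x : c.source), 0 ≤ c.val le_rfl x ((η i).1 c))
    (hp : ∀ (i : ι) (c : M.Chart) (x : c.source), x.1 ∈ B i → 0 < c.val le_rfl x ((η i).1 c)) :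
    ∃ ρ : M.Density 1, IsBasisVolumeForm ρ := by
  choose ρ hρ using fun c : M.Chart =>
    exists_sum_of_locallyFinite hB (fun i => (η i).1 c) fun i => hs i c
  have heven (c : M.Chart) : sigma (ρ c) = ρ c := sec_ext fun x hx => by
    obtain ⟨W, hW, F, hxW, hF⟩ := exists_finset_of_locallyFinite hB c.source x hx
    refine ⟨W, hW, hxW, ?_⟩
    rw [res_sigma, hρ c W hW F hF, map_sum]
    refine Finset.sum_congr rfl fun i _ => ?_
    rw [← res_sigma, homog_zero_iff.1 (he i c)]
  refine ⟨⟨ρ, mem_density_iff.2 fun c c' => sec_ext fun x hx => ?_⟩,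
    Subtype.ext (funext heven), fun c => ?_⟩
  · obtain ⟨W, hW, F, hxW, hF⟩ := exists_finset_of_locallyFinite hB (c.source ⊓ c'.source) x hx
    refine ⟨W, hW, hxW, ?_⟩
    rw [map_mul, res_res, res_res, hρ c W _ F hF, hρ c' W _ F hF, Finset.sum_mul]
    refine Finset.sum_congr rfl fun i _ => ?_
    have e := congrArg (M.res hW) (mem_density_iff.1 (η i).2 c c')
    rwa [map_mul, res_res, res_res] at e
  · refine c.isUnit_of_val_ne_zero le_rfl (homog_zero_iff.2 (heven c)) fun x => ?_
    obtain ⟨W, hW, F, hxW, hF⟩ := exists_finset_of_locallyFinite hB c.source x.1 x.2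
    have e := c.val_res hW le_rfl ⟨x.1, hxW⟩ (ρ c)
    rw [hρ c W hW F hF, map_sum] at e
    change c.val le_rfl x (ρ c) ≠ 0
    refine (e.symm.trans_gt ?_).ne'
    obtain ⟨i, hi⟩ := hcov x.1
    refine Finset.sum_pos' (fun j _ => ?_) ⟨i, ?_, ?_⟩
    · rw [c.val_res hW le_rfl]; exact hn j c x
    · by_contra h
      exact Set.disjoint_left.1 (hF i h) hxW hi
    · rw [c.val_res hW le_rfl]; exact hp i c x hi

/-- A basis volume form exists, since the manifold has a locally finite cover by coordinate balls;
it is paracompact, being Hausdorff, second countable and locally compact. -/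
theorem exists_isBasisVolumeForm (M : Supermanifold.{u} p q) :
    ∃ ρ : M.Density 1, IsBasisVolumeForm ρ := by
  have := M.t2
  have := M.secondCountable
  choose c hc using M.exists_chart
  have hball (x : M.body) : ∃ r, 0 < r ∧ Metric.closedBall ((c x).φ x) r ⊆ (c x).φ.target :=
    Metric.nhds_basis_closedBall.mem_iff.1
      ((c x).φ.open_target.mem_nhds ((c x).φ.map_source (hc x)))
  have hbasis (x : M.body) : (nhds x).HasBasis
      (fun r => 0 < r ∧ Metric.closedBall ((c x).φ x) r ⊆ (c x).φ.target)
      (fun r => coordBall (c x) ((c x).φ x) r) := by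
    refine ⟨fun t => ⟨fun ht => ?_, fun ⟨r, hr, ht⟩ => ?_⟩⟩
    · have h1 : (c x).φ.symm ⁻¹' t ∈ nhds ((c x).φ x) :=
        (c x).φ.continuousAt_symm ((c x).φ.map_source (hc x))
          (by rwa [(c x).φ.left_inv (hc x)])
      obtain ⟨r, hr, h2⟩ := Metric.nhds_basis_closedBall.mem_iff.1
        (Filter.inter_mem h1 ((c x).φ.open_target.mem_nhds ((c x).φ.map_source (hc x))))
      refine ⟨r, ⟨hr, fun z hz => (h2 hz).2⟩, fun z hz => ?_⟩
      have h3 : (c x).φ.symm ((c x).φ z) ∈ t := (h2 (Metric.ball_subset_closedBall hz.2)).1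
      rwa [(c x).φ.left_inv hz.1] at h3
    · exact Filter.mem_of_superset (((c x).φ.isOpen_inter_preimage Metric.isOpen_ball).mem_nhds
        ⟨hc x, Metric.mem_ball_self hr.1⟩) ht
  have : WeaklyLocallyCompactSpace M.body := ⟨fun x => by
    obtain ⟨r, hr, h⟩ := hball x
    refine ⟨(c x).φ.symm '' Metric.closedBall ((c x).φ x) r,
      (isCompact_closedBall _ r).image_of_continuousOn ((c x).φ.continuousOn_symm.mono h), ?_⟩
    refine Filter.mem_of_superset ((hbasis x).mem_of_mem ⟨hr, h⟩) fun z hz => ?_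
    exact ⟨(c x).φ z, Metric.ball_subset_closedBall hz.2, (c x).φ.left_inv hz.1⟩⟩
  obtain ⟨ι, a, r, hr, hcov, hfin⟩ := refinement_of_locallyCompact_sigmaCompact_of_nhds_basis hbasis
  choose η h1 h2 h3 h4 using fun i => exists_bump_density (c (a i)) _ (hr i).1 (hr i).2
  exact isBasisVolumeForm_of_locallyFinite hfin
    (fun x => Set.mem_iUnion.1 (hcov ▸ Set.mem_univ x)) η h1 h2 h3 h4

end Supermanifold

/-! ### Operators on densities -/

namespace Supermanifold

open SuperAlgebra SuperringedSpace

variable {p q : ℕ} {M : Supermanifold.{u} p q} {w : ℝ} {ρ : M.Density 1}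

/-- The operator on functions that corresponds to an operator on densities, in a trivialisation. -/
theorem exists_coefficient_operator {h : M.Density w} (hh : ∀ c, IsUnit (h.1 c))
    (Δ : M.Operator w) : ∃ D : M.Fn →ₗ[ℝ] M.Fn, ∀ g : M.Fn, Δ (g • h) = D g • h :=
  ⟨(trivialisation hh).symm.toLinearMap ∘ₗ Δ ∘ₗ (trivialisation hh).toLinearMap,
    fun g => ((trivialisation hh).apply_symm_apply (Δ (g • h))).symm⟩

/-- The operator on densities with a given coefficient operator. -/
theorem exists_operator {h : M.Density w} (hh : ∀ c, IsUnit (h.1 c)) (D : M.Fn →ₗ[ℝ] M.Fn) :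
    ∃ Δ : M.Operator w, ∀ g : M.Fn, Δ (g • h) = D g • h :=
  ⟨(trivialisation hh).toLinearMap ∘ₗ D ∘ₗ (trivialisation hh).symm.toLinearMap, fun g => by
    change trivialisation hh (D ((trivialisation hh).symm (trivialisation hh g))) = _
    rw [LinearEquiv.symm_apply_apply]; rfl⟩

theorem smul_smul_density (r : ℝ) (f : M.Fn) (h : M.Density w) : r • f • h = (r • f) • h := by
  refine Subtype.ext (funext fun c => ?_)
  change r • (M.res le_top f * h.1 c) = M.res le_top (r • f) * h.1 c
  rw [map_smul, smul_mul_assoc]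

namespace OddPoisson

variable (P : M.OddPoisson) (hρ : IsBasisVolumeForm ρ)

/-- The identity `[Δ, f] = 2 L_f` in the trivialisation by `|ρ|^w`. -/
theorem commutatorIdentity_iff_superBr {Δ : M.Operator w} {D : M.Fn →ₗ[ℝ] M.Fn}
    (hD : ∀ g : M.Fn, Δ (g • hρ.absPower w) = D g • hρ.absPower w) :
    P.CommutatorIdentity Δ ↔ ∀ (ε : ZMod 2) (f g : M.Fn), Homog ε f →
      superBr ε D f g = (2 : ℝ) • (ham (P.bracket ⊤) f g + w • (P.laplacian hρ f * g)) := by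
  constructor
  · intro H ε f g hf
    obtain ⟨t, ht, e⟩ := H ε f hf (g • hρ.absPower w)
    rw [ht.unique (isLieDeriv_smul_absPower hρ P w hf g),
      superComm_smul (hρ.homog_absPower w) hD, smul_smul_density] at e
    exact smul_left_injective (hρ.isUnit_absPower w) e
  · intro H ε f hf s
    obtain ⟨g, rfl⟩ := exists_eq_smul (hρ.isUnit_absPower w) s
    refine ⟨_, isLieDeriv_smul_absPower hρ P w hf g, ?_⟩
    rw [superComm_smul (hρ.homog_absPower w) hD, H ε f g hf, smul_smul_density]

/-- In weight `1/2`, the operators with `[Δ, f] = 2 L_f` are `Δ_ρ + C` in the trivialisation by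
`|ρ|^{1/2}`. -/
theorem commutatorIdentity_iff {Δ : M.Operator (1 / 2)} : P.CommutatorIdentity Δ ↔
    ∃ C : M.Fn, ∀ g : M.Fn, Δ (g • hρ.absPower (1 / 2)) =
      P.laplacian hρ g • hρ.absPower (1 / 2) + C • g • hρ.absPower (1 / 2) := by
  obtain ⟨D, hD⟩ := exists_coefficient_operator (hρ.isUnit_absPower (1 / 2)) Δ
  rw [P.commutatorIdentity_iff_superBr hρ hD,
    (P.isBVOperator_laplacian hρ).superBr_iff (P.isOddBracket ⊤)]
  refine exists_congr fun C => ⟨fun e g => ?_, fun e => ?_⟩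
  · rw [hD, e, ← mul_smul, ← add_smul]; rfl
  · refine LinearMap.ext fun g => smul_left_injective (hρ.isUnit_absPower (1 / 2)) ?_
    rw [← hD, e, ← mul_smul, ← add_smul]; rfl

theorem isDifferential_of_commutatorIdentity {Δ : M.Operator (1 / 2)}
    (h : P.CommutatorIdentity Δ) (hρ : IsBasisVolumeForm ρ) : Δ.IsDifferential := by
  obtain ⟨C, hC⟩ := (P.commutatorIdentity_iff hρ).1 h
  have hD (g : M.Fn) : Δ (g • hρ.absPower (1 / 2)) =
      (P.laplacian hρ + LinearMap.mulLeft ℝ C) g • hρ.absPower (1 / 2) := by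
    rw [hC, ← mul_smul, ← add_smul]; rfl
  have hh := hρ.homog_absPower (1 / 2)
  refine ⟨2, fun ε f hf ε' f' hf' ε'' f'' hf'' => LinearMap.ext fun s => ?_⟩
  obtain ⟨g, rfl⟩ := exists_eq_smul (hρ.isUnit_absPower (1 / 2)) s
  rw [superComm_smul hh (superComm_smul hh (superComm_smul hh hD ε f) ε' f'),
    (P.isBVOperator_laplacian hρ).superBr_superBr_superBr (P.isOddBracket ⊤) C hf hf' hf'']
  exact zero_smul _ _

/-- Existence of an odd operator with `[Δ, f] = 2 L_f` on half-densities. -/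
theorem exists_odd_commutatorIdentity (hρ : IsBasisVolumeForm ρ) :
    ∃ Δ : M.Operator (1 / 2), Δ.IsOdd ∧ P.CommutatorIdentity Δ := by
  obtain ⟨Δ, hΔ⟩ := exists_operator (hρ.isUnit_absPower (1 / 2)) (P.laplacian hρ)
  refine ⟨Δ, fun s => ?_, (P.commutatorIdentity_iff hρ).2 ⟨0, fun g => ?_⟩⟩
  · obtain ⟨g, rfl⟩ := exists_eq_smul (hρ.isUnit_absPower (1 / 2)) s
    rw [parity_smul (hρ.homog_absPower _), hΔ, hΔ, parity_smul (hρ.homog_absPower _),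
      (P.isBVOperator_laplacian hρ).par, neg_smul, neg_neg]
  · rw [hΔ, zero_smul, add_zero]

/-- For a nonzero bracket, `[Δ, f] = 2 L_f` has solutions only in weight `1/2`. -/
theorem weight_eq_half (hρ : IsBasisVolumeForm ρ) (hP : P.IsNonzero) {Δ : M.Operator w}
    (h : P.CommutatorIdentity Δ) : w = 1 / 2 := by
  by_contra hw
  obtain ⟨D, hD⟩ := exists_coefficient_operator (hρ.isUnit_absPower w) Δ
  have h0 := (P.isBVOperator_laplacian hρ).ham_eq_zero (P.isOddBracket ⊤) hw
    ((P.commutatorIdentity_iff_superBr hρ hD).1 h)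
  obtain ⟨f, g, hfg⟩ := hP
  have e := congrArg (fun L : M.Fn →ₗ[ℝ] M.Fn →ₗ[ℝ] M.Fn => L (sigma f) g) h0
  change ham (P.bracket ⊤) (sigma f) g = 0 at e
  rw [ham_apply, sigma_sigma, neg_eq_zero] at e
  exact hfg e

end OddPoisson

end Supermanifold

theorem mainTheorem1 {p q : ℕ} (M : Supermanifold.{u} p q) (P : M.OddPoisson) :
    -- if the bracket is not identically zero, then the weight has to be `1/2`
    (P.IsNonzero → ∀ w : ℝ,
      (∃ Δ : M.Operator w, Δ.IsDifferential ∧ P.CommutatorIdentity Δ) ↔ w = 1 / 2) ∧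
    -- existence in weight `1/2`
    (∃ Δ : M.Operator (1 / 2), Δ.IsDifferential ∧ Δ.IsOdd ∧ P.CommutatorIdentity Δ) ∧
    -- uniqueness up to a zeroth-order term
    (∀ Δ Δ' : M.Operator (1 / 2), Δ.IsDifferential → P.CommutatorIdentity Δ →
      ((Δ'.IsDifferential ∧ P.CommutatorIdentity Δ') ↔
        ∃ C : M.Fn, ∀ s : M.Density (1 / 2), Δ' s = Δ s + C • s)) ∧
    -- the formula in terms of a basis volume form `ρ`, with `h = |ρ|^{1/2}`
    (∀ ρ : M.Density 1, Supermanifold.IsBasisVolumeForm ρ →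
      ∃ h : M.Density (1 / 2), Supermanifold.IsAbsPower ρ (1 / 2) h ∧
        (∀ s : M.Density (1 / 2), ∃! f : M.Fn, s = f • h) ∧
        ∀ Δ : M.Operator (1 / 2),
          (Δ.IsDifferential ∧ P.CommutatorIdentity Δ) ↔
            ∃ C : M.Fn, ∀ (ε : ZMod 2) (f : M.Fn) (hf : SuperringedSpace.IsHomog ε f),
              ∃ g : M.Fn, P.IsLaplacian ρ f hf g ∧ Δ (f • h) = g • h + C • (f • h)) := by
  obtain ⟨ρ₀, hρ₀⟩ := M.exists_isBasisVolumeForm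
  have hdiff {Δ : M.Operator (1 / 2)} (h : P.CommutatorIdentity Δ) : Δ.IsDifferential :=
    P.isDifferential_of_commutatorIdentity h hρ₀
  obtain ⟨Δ₀, hodd, hΔ₀⟩ := P.exists_odd_commutatorIdentity hρ₀
  refine ⟨fun hP w => ⟨fun ⟨Δ, _, h⟩ => P.weight_eq_half hρ₀ hP h, ?_⟩,
    ⟨Δ₀, hdiff hΔ₀, hodd, hΔ₀⟩, fun Δ Δ' _ hΔ => ?_, fun ρ hρ => ?_⟩
  · rintro rfl
    exact ⟨Δ₀, hdiff hΔ₀, hΔ₀⟩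
  · obtain ⟨C, hC⟩ := (P.commutatorIdentity_iff hρ₀).1 hΔ
    constructor
    · rintro ⟨_, h'⟩
      obtain ⟨C', hC'⟩ := (P.commutatorIdentity_iff hρ₀).1 h'
      refine ⟨C' - C, fun s => ?_⟩
      obtain ⟨g, rfl⟩ := Supermanifold.exists_eq_smul (hρ₀.isUnit_absPower (1 / 2)) s
      rw [hC, hC', sub_smul]
      abel
    · rintro ⟨K, hK⟩
      have h' : P.CommutatorIdentity Δ' := (P.commutatorIdentity_iff hρ₀).2
        ⟨C + K, fun g => by rw [hK, hC, add_smul, add_assoc]⟩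
      exact ⟨hdiff h', h'⟩
  · have hu := hρ.isUnit_absPower (1 / 2)
    refine ⟨hρ.absPower (1 / 2), hρ.isAbsPower_absPower _, fun s => ?_, fun Δ => ?_⟩
    · obtain ⟨f, hf⟩ := Supermanifold.exists_eq_smul hu s
      exact ⟨f, hf, fun g hg => Supermanifold.smul_left_injective hu (hg.symm.trans hf)⟩
    · constructor
      · rintro ⟨_, h⟩
        obtain ⟨C, hC⟩ := (P.commutatorIdentity_iff hρ).1 h
        exact ⟨C, fun ε f hf => ⟨_, (P.isLaplacian_iff hρ hf _).2 rfl, hC f⟩⟩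
      · rintro ⟨C, hC⟩
        have h : P.CommutatorIdentity Δ := (P.commutatorIdentity_iff hρ).2 ⟨C, fun g => by
          have key (ε : ZMod 2) (f : M.Fn) (hf : SuperAlgebra.Homog ε f) :
              Δ (f • hρ.absPower (1 / 2)) =
                P.laplacian hρ f • hρ.absPower (1 / 2) + C • f • hρ.absPower (1 / 2) := by
            obtain ⟨g, hg, e⟩ := hC ε f hf
            rw [e, (P.isLaplacian_iff hρ hf g).1 hg]
          -- both sides are additive, hence determined by homogeneous functions
          obtain ⟨a, b, ha, hb, rfl⟩ := SuperAlgebra.exists_homog_add g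
          rw [add_smul, map_add, map_add, key 0 a ha, key 1 b hb, add_smul, smul_add]
          abel⟩
        exact ⟨hdiff h, h⟩
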